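/- A Dyck path of semilength $n$ is a lattice path from $(0,0)$ to $(2n,0)$ with steps $U=(1,1)$ and $D=(1,-1)$ that never goes below the $x$-axis. It is irreducible if it is nonempty and returns to the $x$-axis only at its end; every Dyck path is uniquely a concatenation of irreducible ones, its irreducible components. If the valleys (points between a $D$ and an immediately following $U$) of $P$ are, from left to right, preceded by $A_1<\dots<A_h$ up steps and $D_1<\dots<D_h$ down steps, then $(A,D)$ is the ascent-descent code of $P$. Order. For irreducible Dyck paths $P,Q$ of the same semilength, $Q$ covers $P$ if the code of $Q$ is obtained from the code $(A,D)$ of $P$ by removing an entry $A_i$ from $A$ and an entry $D_j$ from $D$ with $j\ge i$. On irreducible paths, $\le$ is the reflexive and transitive closure of this covering relation. For arbitrary Dyck paths of the same semilength with irreducible components $P_1,\dots,P_r$ and $Q_1,\dots,Q_s$, $P\le Q$ means that $r=s$ and $P_i\le Q_i$ for every $i$ (in particular $P_i$ and $Q_i$ have the same semilength). Involutions. The Kreweras involution $L$ sends a Dyck path $P$ to the Dyck path $L(P)$ of the same semilength whose valleys are obtained as follows: flip $P$ around the $x$-axis, draw lines northeast from the midpoints of the (flipped) double ascents $UU$ of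 $P$ and northwest from the midpoints of the (flipped) double descents $DD$ of $P$; the $i$-th valley of $L(P)$ is the intersection of the $i$-th northeast and the $i$-th northwest line. The modified involution $L'$ is obtained by flipping $P$ with respect to a vertical line, decomposing the resulting path into its irreducible components $U\,P_i\,D$, and replacing each of them with $U\,L(P_i)\,D$. Maps. Let $\sigma\in S_n$. The Dyck path $\lambda(\sigma)$ is obtained by reading $\sigma(1),\dots,\sigma(n)$ from left to right: with $m_0=n+1$, the $i$-th left-to-right minimum $m_i$ gives $m_{i-1}-m_i$ up steps followed by one down step, and every other entry gives one down step. The Dyck path $\mu(\sigma)$ is obtained by reading $\sigma(n),\dots,\sigma(1)$, that is, from right to left: with $M_0=0$, the $i$-th right-to-left maximum $M_i$ gives $M_i-M_{i-1}$ up steps followed by one down step, and every other entry gives one down step. Put $\nu(\sigma)=(\lambda(\sigma),\mu(\sigma))$, and let $S_n(1234)$ be the set of permutations in $S_n$ without an increasing subsequence of length $4$. Theorem. Let $n\ge 0$ and let $P,Q$ be Dyck paths of semilength $n$. Then $(P,Q)$ is admissible, that is, there is a permutation $\alpha\in S_n$ with $P=\lambda(\alpha)$ and $Q=\mu(\alpha)$,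 if and only if $P\ge L'(Q)$ and $Q\ge L'(P)$. Moreover, $\nu$ restricts to a bijection from $S_n(1234)$ onto the set of all pairs $(P,Q)$ of Dyck paths of semilength $n$ such that $P\ge L'(Q)$ and $Q\ge L'(P)$. -/

import Mathlib

open DyckStep

namespace DyckPerm

/- A Dyck path is a `DyckWord`, its length is twice its `semilength`. -/

/-! ### Words that are Dyck paths -/

/-- A word which, read from height `h`, never goes below the `x`-axis. -/
def StaysAbove (h : ℕ) (w : List DyckStep) : Prop :=
  ∀ i, (w.take i).count D ≤ h + (w.take i).count U

theorem staysAbove_nil (h : ℕ) : StaysAbove h [] := by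
  intro i; simp

theorem StaysAbove.up {h : ℕ} {w : List DyckStep} (H : StaysAbove (h + 1) w) :
    StaysAbove h (U :: w) := by
  intro i
  cases i with
  | zero => simp
  | succ i =>
    have := H i
    simp only [List.take_succ_cons, List.count_cons_self]
    rw [List.count_cons_of_ne (by decide)]
    omega

theorem StaysAbove.down {h : ℕ} {w : List DyckStep} (H : StaysAbove h w) :
    StaysAbove (h + 1) (D :: w) := by
  intro i
  cases i with
  | zero => simp
  | succ i =>
    have := H i
    simp only [List.take_succ_cons, List.count_cons_self]
    rw [List.count_cons_of_ne (by decide)]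
    omega

theorem StaysAbove.ups {w : List DyckStep} (k : ℕ) : ∀ {h : ℕ}, StaysAbove (h + k) w →
    StaysAbove h (List.replicate k U ++ w) := by
  induction k with
  | zero => intro h H; simpa using H
  | succ k ih =>
    intro h H
    rw [List.replicate_succ, List.cons_append]
    exact StaysAbove.up (ih (by rwa [Nat.add_right_comm, Nat.add_assoc]))

theorem StaysAbove.downs {w : List DyckStep} (k : ℕ) : ∀ {h : ℕ}, StaysAbove h w →
    StaysAbove (h + k) (List.replicate k D ++ w) := by
  induction k with
  | zero => intro h H; simpa using H
  | succ k ih =>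
    intro h H
    rw [List.replicate_succ, List.cons_append]
    exact StaysAbove.down (ih H)

/-- The Dyck path with a given word of steps. -/
def ofWord (w : List DyckStep) (h₁ : w.count U = w.count D) (h₂ : StaysAbove 0 w) : DyckWord where
  toList := w
  count_U_eq_count_D := h₁
  count_D_le_count_U i := by simpa using h₂ i

/-! ### Valleys, double ascents, double descents, and the ascent-descent code -/

/-- The lattice points, in order, at which a step `s` is immediately followed by a step `t`. The
point reached after `u` up steps and `d` down steps is recorded as `(u, d)` (in the plane it is
`(u + d, u - d)`); the reading starts at the point `(u, d)` given as the argument. -/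
def turnsFrom (s t : DyckStep) : ℕ → ℕ → List DyckStep → List (ℕ × ℕ)
  | _, _, [] => []
  | _, _, [_] => []
  | u, d, a :: b :: w =>
    let u' := u + if a = U then 1 else 0
    let d' := d + if a = D then 1 else 0
    (if a = s ∧ b = t then [(u', d')] else []) ++ turnsFrom s t u' d' (b :: w)

/-- The points of a Dyck path between a step `s` and an immediately following step `t`. -/
def turns (s t : DyckStep) (P : DyckWord) : List (ℕ × ℕ) := turnsFrom s t 0 0 P.toList

/-- The valleys of a Dyck path, from left to right. -/
def valleys (P : DyckWord) : List (ℕ × ℕ) := turns D U P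

/-- The midpoints of the double ascents of a Dyck path, from left to right. -/
def doubleAscents (P : DyckWord) : List (ℕ × ℕ) := turns U U P

/-- The midpoints of the double descents of a Dyck path, from left to right. -/
def doubleDescents (P : DyckWord) : List (ℕ × ℕ) := turns D D P

/-- The ascent code `A₁, …, Aₖ₋₁`: the numbers of up steps preceding the valleys. -/
def ascentCode (P : DyckWord) : List ℕ := (valleys P).map Prod.fst

/-- The descent code `D₁, …, Dₖ₋₁`: the numbers of down steps preceding the valleys. -/
def descentCode (P : DyckWord) : List ℕ := (valleys P).map Prod.snd

/-! ### The Kreweras involution `L` -/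

/-- The word that leads from the point `(u, d)` to the point `(n, n)` and has its valleys at the
points `vs`. -/
def wordFrom (n : ℕ) : ℕ → ℕ → List (ℕ × ℕ) → List DyckStep
  | u, d, [] => List.replicate (n - u) U ++ List.replicate (n - d) D
  | u, d, (a, b) :: vs =>
    List.replicate (a - u) U ++ (List.replicate (b - d) D ++ wordFrom n a b vs)

/-- The marked points. The path `P` is flipped around the `x`-axis, so that the point `(u, d)` of
`P`, that is `(u + d, u - d)`, goes to `(u + d, d - u)`. The northeast line through the midpoint
`(u, d)` of a double ascent consists then of the points of the plane `(x, y)` with `x - y = 2 * u`,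
that is the points preceded by `u` down steps, and the northwest line through the midpoint `(u, d)`
of a double descent of the points with `x + y = 2 * d`, that is the points preceded by `d` up
steps. The `i`-th lines of both kinds intersect at the `i`-th marked point. -/
def markedPoints (P : DyckWord) : List (ℕ × ℕ) :=
  List.zip ((doubleDescents P).map Prod.snd) ((doubleAscents P).map Prod.fst)

/-- Lists of points, weakly increasing in both coordinates from `(u, d)` and within the region
`y ≤ x ≤ n`. -/
def GoodFrom (n : ℕ) : ℕ → ℕ → List (ℕ × ℕ) → Prop
  | _, _, [] => True
  | u, d, (a, b) :: vs => u ≤ a ∧ d ≤ b ∧ b ≤ a ∧ a ≤ n ∧ GoodFrom n a b vs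

theorem count_wordFrom (n : ℕ) (vs : List (ℕ × ℕ)) : ∀ u d : ℕ, u ≤ n → d ≤ n →
    GoodFrom n u d vs → (wordFrom n u d vs).count U = n - u ∧ (wordFrom n u d vs).count D = n - d := by
  induction vs with
  | nil => intro u d hu hd _; simp [wordFrom, List.count_replicate]
  | cons v vs ih =>
    obtain ⟨a, b⟩ := v
    intro u d hu hd ⟨h1, h2, h3, h4, h5⟩
    obtain ⟨e1, e2⟩ := ih a b h4 (h3.trans h4) h5
    simp only [wordFrom, List.count_append, e1, e2, List.count_replicate]
    simp
    omega

theorem staysAbove_wordFrom (n : ℕ) (vs : List (ℕ × ℕ)) : ∀ u d : ℕ, u ≤ n → d ≤ u →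
    GoodFrom n u d vs → StaysAbove (u - d) (wordFrom n u d vs) := by
  induction vs with
  | nil =>
    intro u d hu hd _
    refine StaysAbove.ups _ ?_
    have : StaysAbove (0 + (n - d)) (List.replicate (n - d) D ++ []) :=
      StaysAbove.downs _ (staysAbove_nil _)
    rw [List.append_nil] at this
    convert this using 1
    omega
  | cons v vs ih =>
    obtain ⟨a, b⟩ := v
    intro u d hu hd ⟨h1, h2, h3, h4, h5⟩
    refine StaysAbove.ups _ ?_
    have := StaysAbove.downs (b - d) (ih a b h4 h3 h5)
    convert this using 1
    omega

theorem eq_of_mem_ite {c : Prop} [Decidable c] {p x : ℕ × ℕ} (h : p ∈ if c then [x] else []) :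
    p = x := by
  split_ifs at h
  · exact List.mem_singleton.1 h
  · exact absurd h List.not_mem_nil

theorem turnsFrom_bounds (s t : DyckStep) (w : List DyckStep) : ∀ u d : ℕ,
    (∀ p ∈ turnsFrom s t u d w, u ≤ p.1 ∧ p.1 ≤ u + w.count U ∧ d ≤ p.2 ∧ p.2 ≤ d + w.count D) := by
  induction w with
  | nil => simp [turnsFrom]
  | cons a w ih =>
    cases w with
    | nil => simp [turnsFrom]
    | cons b w =>
      intro u d p hp
      simp only [turnsFrom, List.mem_append] at hp
      have e1 : (a :: b :: w).count U = (b :: w).count U + if a = U then 1 else 0 := by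
        rw [List.count_cons]; simp
      have e2 : (a :: b :: w).count D = (b :: w).count D + if a = D then 1 else 0 := by
        rw [List.count_cons]; simp
      rw [e1, e2]
      rcases hp with hp | hp
      · rw [eq_of_mem_ite hp]
        dsimp only
        omega
      · have := ih _ _ p hp
        omega

theorem turnsFrom_sorted (s t : DyckStep) (w : List DyckStep) : ∀ u d : ℕ,
    (turnsFrom s t u d w).Pairwise (fun p q => p.1 ≤ q.1 ∧ p.2 ≤ q.2) := by
  induction w with
  | nil => simp [turnsFrom]
  | cons a w ih =>
    cases w with
    | nil => simp [turnsFrom]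
    | cons b w =>
      intro u d
      simp only [turnsFrom]
      rw [List.pairwise_append]
      refine ⟨by split_ifs <;> simp, ih _ _, ?_⟩
      intro p hp q hq
      have := turnsFrom_bounds s t _ _ _ q hq
      rw [eq_of_mem_ite hp]
      exact ⟨this.1, this.2.2.1⟩

theorem count_up_turns (x : ℕ) (w : List DyckStep) : ∀ u d : ℕ, u ≤ x → x < u + w.count U →
    (turnsFrom U U u d w).countP (fun p => p.1 ≤ x) + (turnsFrom D U u d w).countP (fun p => p.1 ≤ x)
      = x - u + if w.head? = some D then 1 else 0 := by
  induction w with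
  | nil => intro u d h1 h2; simp at h2; omega
  | cons a w ih =>
    cases w with
    | nil =>
      intro u d h1 h2
      cases a <;> simp [turnsFrom] at h2 ⊢ <;> omega
    | cons b w =>
      intro u d h1 h2
      by_cases hx : u + (if a = U then 1 else 0) ≤ x
      · have := ih (u + (if a = U then 1 else 0)) (d + if a = D then 1 else 0) hx
          (by rw [List.count_cons] at h2; simp at h2; omega)
        simp only [turnsFrom, List.countP_append]
        cases a <;> cases b <;> simp at this hx ⊢ <;>
          first | omega | (rw [if_pos hx]; omega)
      · have ha : a = U := by
          by_contra hne
          rw [if_neg hne] at hx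
          omega
        subst ha
        have hz : ∀ s t, (turnsFrom s t u d (U :: b :: w)).countP (fun p => p.1 ≤ x) = 0 := by
          intro s t
          rw [List.countP_eq_zero]
          intro p hp
          simp only [turnsFrom, List.mem_append] at hp
          rcases hp with hp | hp
          · split_ifs at hp <;> simp_all
          · have := turnsFrom_bounds s t _ _ _ p hp
            simp at this hx ⊢
            omega
        rw [hz, hz]
        simp at hx ⊢
        omega

theorem count_down_turns (x : ℕ) (w : List DyckStep) : ∀ u d : ℕ, d ≤ x → x < d + w.count D →
    (turnsFrom D D u d w).countP (fun p => p.2 ≤ x) + (turnsFrom D U u d w).countP (fun p => p.2 ≤ x)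
      = x - d := by
  induction w with
  | nil => intro u d h1 h2; simp at h2; omega
  | cons a w ih =>
    cases w with
    | nil =>
      intro u d h1 h2
      cases a <;> simp [turnsFrom] at h2 ⊢ <;> omega
    | cons b w =>
      intro u d h1 h2
      by_cases hx : d + (if a = D then 1 else 0) ≤ x
      · have := ih (u + (if a = U then 1 else 0)) (d + if a = D then 1 else 0) hx
          (by rw [List.count_cons] at h2; simp at h2; omega)
        simp only [turnsFrom, List.countP_append]
        cases a <;> cases b <;> simp at this hx ⊢ <;>
          first | omega | (rw [if_pos hx]; omega)
      · have ha : a = D := by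
          by_contra hne
          rw [if_neg hne] at hx
          omega
        subst ha
        have hz : ∀ s t, (turnsFrom s t u d (D :: b :: w)).countP (fun p => p.2 ≤ x) = 0 := by
          intro s t
          rw [List.countP_eq_zero]
          intro p hp
          simp only [turnsFrom, List.mem_append] at hp
          rcases hp with hp | hp
          · split_ifs at hp <;> simp_all
          · have := turnsFrom_bounds s t _ _ _ p hp
            simp at this hx ⊢
            omega
        rw [hz, hz]
        simp at hx ⊢
        omega

theorem turnsFrom_above (s t : DyckStep) (w : List DyckStep) : ∀ u d : ℕ, d ≤ u →
    StaysAbove (u - d) w → ∀ p ∈ turnsFrom s t u d w, p.2 ≤ p.1 := by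
  induction w with
  | nil => simp [turnsFrom]
  | cons a w ih =>
    cases w with
    | nil => simp [turnsFrom]
    | cons b w =>
      intro u d hd H p hp
      have h1 := H 1
      have key : d + (if a = D then 1 else 0) ≤ u + if a = U then 1 else 0 := by
        cases a <;> simp at h1 ⊢ <;> omega
      have H' : StaysAbove ((u + if a = U then 1 else 0) - (d + if a = D then 1 else 0)) (b :: w) := by
        intro i
        have := H (i + 1)
        rw [List.take_succ_cons, List.count_cons, List.count_cons] at this
        cases a <;> simp at this key ⊢ <;> omega
      simp only [turnsFrom, List.mem_append] at hp
      rcases hp with hp | hp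
      · rw [eq_of_mem_ite hp]
        exact key
      · exact ih _ _ key H' p hp

theorem count_turns_le (P : DyckWord) (x : ℕ) (hx : x < P.semilength) :
    ((doubleDescents P).map Prod.snd).countP (fun y => y ≤ x) ≤
      ((doubleAscents P).map Prod.fst).countP (fun y => y ≤ x) := by
  have h1 := count_up_turns x P.toList 0 0 (Nat.zero_le _) (by rw [Nat.zero_add]; exact hx)
  have h2 := count_down_turns x P.toList 0 0 (Nat.zero_le _)
    (by rw [Nat.zero_add, ← P.semilength_eq_count_D]; exact hx)
  have h3 : (turnsFrom D U 0 0 P.toList).countP (fun p => p.1 ≤ x) ≤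
      (turnsFrom D U 0 0 P.toList).countP (fun p => p.2 ≤ x) := by
    apply List.countP_mono_left
    intro p hp h
    have := turnsFrom_above D U P.toList 0 0 le_rfl
      (fun i => by simpa using P.count_D_le_count_U i) p hp
    simp at h ⊢
    omega
  simp only [List.countP_map, doubleDescents, doubleAscents, turns, Function.comp_def]
  omega

theorem goodFrom_zip (n : ℕ) : ∀ (as bs : List ℕ) (u d : ℕ), as.Pairwise (· ≤ ·) →
    bs.Pairwise (· ≤ ·) → (∀ a ∈ as, u ≤ a ∧ a ≤ n) → (∀ b ∈ bs, d ≤ b) →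
    (∀ p ∈ as.zip bs, p.2 ≤ p.1) → GoodFrom n u d (as.zip bs) := by
  intro as
  induction as with
  | nil => intros; simp [GoodFrom]
  | cons a as ih =>
    intro bs u d h1 h2 h3 h4 h5
    cases bs with
    | nil => simp [GoodFrom]
    | cons b bs =>
      rw [List.pairwise_cons] at h1 h2
      rw [List.zip_cons_cons] at h5 ⊢
      refine ⟨(h3 a (by simp)).1, h4 b (by simp), h5 (a, b) (by simp), (h3 a (by simp)).2,
        ih bs a b h1.2 h2.2 (fun a' ha' => ⟨h1.1 a' ha', (h3 a' (by simp [ha'])).2⟩) h2.1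
          (fun p hp => h5 p (by simp [hp]))⟩

theorem zip_le (n : ℕ) (as bs : List ℕ) (ha : as.Pairwise (· ≤ ·)) (hb : bs.Pairwise (· ≤ ·))
    (hn : ∀ a ∈ as, a < n)
    (h : ∀ x, x < n → as.countP (fun y => y ≤ x) ≤ bs.countP (fun y => y ≤ x)) :
    ∀ p ∈ as.zip bs, p.2 ≤ p.1 := by
  intro p hp
  obtain ⟨i, hi, rfl⟩ := List.mem_iff_getElem.1 hp
  rw [List.length_zip] at hi
  have hia : i < as.length := by omega
  have hib : i < bs.length := by omega
  rw [List.getElem_zip]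
  by_contra! hlt
  simp only at hlt
  have h1 : i + 1 ≤ as.countP (fun y => y ≤ as[i]) := by
    have e : (as.take (i + 1)).countP (fun y => y ≤ as[i]) = (as.take (i + 1)).length := by
      rw [List.countP_eq_length]
      intro y hy
      obtain ⟨j, hj, rfl⟩ := List.mem_iff_getElem.1 hy
      rw [List.length_take] at hj
      rw [List.getElem_take]
      rcases (show j ≤ i by omega).eq_or_lt with rfl | hji
      · simp
      · simpa using List.pairwise_iff_getElem.1 ha j i (by omega) hia hji
    rw [List.length_take, min_eq_left (by omega)] at e
    calc i + 1 = _ := e.symm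
      _ ≤ _ := (List.take_sublist _ _).countP_le
  have h2 : bs.countP (fun y => y ≤ as[i]) ≤ i := by
    conv_lhs => rw [← List.take_append_drop i bs]
    rw [List.countP_append]
    have e : (bs.drop i).countP (fun y => y ≤ as[i]) = 0 := by
      rw [List.countP_eq_zero]
      intro y hy
      obtain ⟨j, hj, rfl⟩ := List.mem_iff_getElem.1 hy
      rw [List.length_drop] at hj
      rw [List.getElem_drop]
      have : bs[i] ≤ bs[i + j] := by
        rcases Nat.eq_zero_or_pos j with rfl | hj0
        · simp
        · exact List.pairwise_iff_getElem.1 hb i (i + j) hib (by omega) (by omega)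
      simp
      omega
    have := (List.countP_le_length (p := fun y => decide (y ≤ as[i])) (l := bs.take i))
    rw [List.length_take] at this
    omega
  have := h as[i] (hn _ (List.getElem_mem hia))
  omega

theorem snd_lt_of_mem_doubleDescents (w : List DyckStep) : ∀ u d : ℕ,
    ∀ p ∈ turnsFrom D D u d w, p.2 < d + w.count D := by
  induction w with
  | nil => simp [turnsFrom]
  | cons a w ih =>
    cases w with
    | nil => simp [turnsFrom]
    | cons b w =>
      intro u d p hp
      simp only [turnsFrom, List.mem_append] at hp
      have e2 : (a :: b :: w).count D = (b :: w).count D + if a = D then 1 else 0 := by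
        rw [List.count_cons]; simp
      rw [e2]
      rcases hp with hp | hp
      · split_ifs at hp with h <;> simp at hp
        all_goals subst hp
        all_goals simp_all
      · have := ih _ _ p hp
        omega

theorem goodFrom_markedPoints (P : DyckWord) :
    GoodFrom P.semilength 0 0 (markedPoints P) := by
  have hlt : ∀ a ∈ (doubleDescents P).map Prod.snd, a < P.semilength := by
    intro a ha
    obtain ⟨p, hp, rfl⟩ := List.mem_map.1 ha
    have := snd_lt_of_mem_doubleDescents P.toList 0 0 p hp
    rwa [Nat.zero_add, ← P.semilength_eq_count_D] at this
  have h1 : ((doubleDescents P).map Prod.snd).Pairwise (· ≤ ·) :=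
    List.pairwise_map.2 ((turnsFrom_sorted D D P.toList 0 0).imp fun h => h.2)
  have h2 : ((doubleAscents P).map Prod.fst).Pairwise (· ≤ ·) :=
    List.pairwise_map.2 ((turnsFrom_sorted U U P.toList 0 0).imp fun h => h.1)
  exact goodFrom_zip _ _ _ _ _ h1 h2 (fun a ha => ⟨Nat.zero_le _, (hlt a ha).le⟩)
    (fun b _ => Nat.zero_le _) (zip_le P.semilength _ _ h1 h2 hlt (count_turns_le P))

/-- The Kreweras involution `L`: the path `L P` has the semilength of `P` and its valleys at the
marked points. -/
def kreweras (P : DyckWord) : DyckWord :=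
  ofWord (wordFrom P.semilength 0 0 (markedPoints P))
    (by
      obtain ⟨h1, h2⟩ := count_wordFrom P.semilength (markedPoints P) 0 0 (Nat.zero_le _)
        (Nat.zero_le _) (goodFrom_markedPoints P)
      rw [h1, h2])
    (staysAbove_wordFrom P.semilength (markedPoints P) 0 0 (Nat.zero_le _) le_rfl
      (goodFrom_markedPoints P))

/-! ### The modified involution `L'` -/

/-- The step with its direction exchanged. -/
def flipStep : DyckStep → DyckStep
  | U => D
  | D => U

theorem count_map_flipStep (w : List DyckStep) :
    (w.map flipStep).count U = w.count D ∧ (w.map flipStep).count D = w.count U := by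
  induction w with
  | nil => simp
  | cons a w ih => cases a <;> simp [flipStep, ih]

/-- The path flipped with respect to a vertical line. -/
def flipPath (P : DyckWord) : DyckWord where
  toList := P.toList.reverse.map flipStep
  count_U_eq_count_D := by
    rw [(count_map_flipStep _).1, (count_map_flipStep _).2, List.count_reverse, List.count_reverse,
      P.count_U_eq_count_D]
  count_D_le_count_U i := by
    rw [← List.map_take, (count_map_flipStep _).1, (count_map_flipStep _).2, List.take_reverse,
      List.count_reverse, List.count_reverse]
    have h1 := P.count_D_le_count_U (P.toList.length - i)
    have h2 := P.count_U_eq_count_D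
    rw [← List.take_append_drop (P.toList.length - i) P.toList, List.count_append,
      List.count_append] at h2
    omega

/-- The paths `P₁, …, Pᵣ` such that the irreducible components of `P` are `U P₁ D, …, U Pᵣ D`,
from left to right. -/
def insides (P : DyckWord) : List DyckWord :=
  if h : P = 0 then [] else P.insidePart :: insides P.outsidePart
termination_by P.semilength
decreasing_by exact DyckWord.semilength_outsidePart_lt h

/-- The irreducible components of a Dyck path, from left to right. -/
def components (P : DyckWord) : List DyckWord := (insides P).map DyckWord.nest

/-- The involution `L'`: every irreducible component `U Pᵢ D` of the flipped path is replaced with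
`U L(Pᵢ) D`, and the results are concatenated. -/
def modKreweras (P : DyckWord) : DyckWord :=
  ((insides (flipPath P)).map fun p => (kreweras p).nest).sum

/-! ### The order relation -/

/-- The covering relation on irreducible Dyck paths of the same semilength: the codes of `Q` are
obtained by removing the `i`-th entry of the ascent code of `P` and the `j`-th entry of its descent
code, with `i ≤ j`. (`IsNested` is irreducibility: the path is nonempty and returns to the `x`-axis
only at its end.) -/
def Covers (P Q : DyckWord) : Prop :=
  P.IsNested ∧ Q.IsNested ∧ P.semilength = Q.semilength ∧
    ∃ i j : ℕ, i ≤ j ∧ j < (descentCode P).length ∧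
      ascentCode Q = (ascentCode P).eraseIdx i ∧ descentCode Q = (descentCode P).eraseIdx j

/-- The order relation `P ≤ Q` on Dyck paths: componentwise, the reflexive and transitive closure of
the covering relation. -/
def PathLE (P Q : DyckWord) : Prop :=
  List.Forall₂ (Relation.ReflTransGen Covers) (components P) (components Q)

/-! ### Permutations and the maps `λ`, `μ`, `ν` -/

/-- The one-line notation `σ(1) … σ(n)` of a permutation, with values in `{1, …, n}`. -/
def oneLine {n : ℕ} (σ : Equiv.Perm (Fin n)) : List ℕ := List.ofFn fun i => (σ i : ℕ) + 1

/-- Reading a word whose current minimum is `m`: every new minimum `x` gives `m - x` up steps and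
one down step, and every other entry gives one down step. -/
def minWord : ℕ → List ℕ → List DyckStep
  | _, [] => []
  | m, x :: l =>
    if x < m then List.replicate (m - x) U ++ D :: minWord x l else D :: minWord m l

/-- Reading a word whose current maximum is `m`: every new maximum `x` gives `x - m` up steps and
one down step, and every other entry gives one down step. -/
def maxWord : ℕ → List ℕ → List DyckStep
  | _, [] => []
  | m, x :: l =>
    if m < x then List.replicate (x - m) U ++ D :: maxWord x l else D :: maxWord m l

theorem minWord_eq_maxWord (n : ℕ) (l : List ℕ) : ∀ m : ℕ, m ≤ n + 1 → (∀ x ∈ l, x ≤ n + 1) →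
    minWord m l = maxWord (n + 1 - m) (l.map fun x => n + 1 - x) := by
  induction l with
  | nil => intros; rfl
  | cons x l ih =>
    intro m hm hl
    have hx := hl x (by simp)
    have hl' : ∀ y ∈ l, y ≤ n + 1 := fun y hy => hl y (by simp [hy])
    simp only [minWord, List.map_cons, maxWord]
    rw [ih m hm hl', ih x hx hl']
    by_cases h : x < m
    · rw [if_pos h, if_pos (by omega)]
      congr 2
      omega
    · rw [if_neg h, if_neg (by omega)]

theorem staysAbove_maxWord (l : List ℕ) : ∀ (m : ℕ) (r : List ℕ), (∀ x ∈ r, 0 < x ∧ x ≤ m) →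
    (∀ x ∈ l, 0 < x) → (r ++ l).Nodup → StaysAbove (m - r.length) (maxWord m l) := by
  induction l with
  | nil => intros; exact staysAbove_nil _
  | cons x l ih =>
    intro m r hr hl hnd
    have hlen : ∀ M : ℕ, ∀ s : List ℕ, s.Nodup → (∀ x ∈ s, 0 < x ∧ x ≤ M) → s.length ≤ M := by
      intro M s hs h
      have := Finset.card_le_card (s := s.toFinset) (t := Finset.Icc 1 M) (by
        intro y hy
        have := h y (by simpa using hy)
        simp; omega)
      rw [List.toFinset_card_of_nodup hs] at this
      simpa using this
    have hnd' : ((r ++ [x]) ++ l).Nodup := by simpa using hnd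
    have hpos := hl x (by simp)
    have hl' : ∀ y ∈ l, 0 < y := fun y hy => hl y (by simp [hy])
    have hrl := hlen m r (List.Nodup.of_append_left hnd) hr
    have step : ∀ M : ℕ, m ≤ M → x ≤ M →
        r.length + 1 ≤ M ∧ StaysAbove (M - (r.length + 1)) (maxWord M l) := by
      intro M h1 h2
      have hr' : ∀ y ∈ r ++ [x], 0 < y ∧ y ≤ M := by
        intro y hy
        rw [List.mem_append] at hy
        rcases hy with hy | hy
        · have := hr y hy; omega
        · simp at hy; omega
      have e1 := hlen M _ (List.Nodup.of_append_left hnd') hr'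
      have e2 := ih M _ hr' hl' hnd'
      rw [List.length_append, List.length_singleton] at e1 e2
      exact ⟨e1, e2⟩
    simp only [maxWord]
    split_ifs with h
    · obtain ⟨e1, e2⟩ := step x h.le le_rfl
      refine StaysAbove.ups _ ?_
      have := StaysAbove.down e2
      convert this using 1
      omega
    · obtain ⟨e1, e2⟩ := step m le_rfl (by omega)
      have := StaysAbove.down e2
      convert this using 1
      omega

theorem count_maxWord (n : ℕ) (l : List ℕ) : ∀ m : ℕ, m ≤ n → (∀ x ∈ l, x ≤ n) →
    (m = n ∨ n ∈ l) → (maxWord m l).count U = n - m ∧ (maxWord m l).count D = l.length := by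
  induction l with
  | nil => intro m _ _ h; simp at h; simp [maxWord, h]
  | cons x l ih =>
    intro m hm hl h
    have hl' : ∀ y ∈ l, y ≤ n := fun y hy => hl y (by simp [hy])
    have hx := hl x (by simp)
    simp only [maxWord]
    split_ifs with hmx
    · obtain ⟨e1, e2⟩ := ih x hx hl' (by
        rcases h with h | h
        · left; omega
        · rcases List.mem_cons.1 h with h | h
          · left; exact h.symm
          · right; exact h)
      simp [List.count_append, List.count_replicate, e1, e2]
      omega
    · obtain ⟨e1, e2⟩ := ih m hm hl' (by
        rcases h with h | h
        · left; omega
        · rcases List.mem_cons.1 h with h | h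
          · left; omega
          · right; exact h)
      simp [e1, e2]

/-- The Dyck path of a word that contains every one of `1, …, n` exactly once. -/
theorem maxWord_dyck (n : ℕ) (l : List ℕ) (h1 : ∀ x ∈ l, 0 < x ∧ x ≤ n) (h2 : l.Nodup)
    (h3 : l.length = n) :
    (maxWord 0 l).count U = (maxWord 0 l).count D ∧ StaysAbove 0 (maxWord 0 l) := by
  have hmem : 0 = n ∨ n ∈ l := by
    rcases Nat.eq_zero_or_pos n with h | h
    · left; omega
    · right
      have e : l.toFinset = Finset.Icc 1 n := by
        apply Finset.eq_of_subset_of_card_le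
        · intro y hy
          have := h1 y (by simpa using hy)
          simp; omega
        · rw [List.toFinset_card_of_nodup h2]; simp [h3]
      have : n ∈ l.toFinset := by rw [e]; simp; omega
      simpa using this
  obtain ⟨e1, e2⟩ := count_maxWord n l 0 (Nat.zero_le _) (fun x hx => (h1 x hx).2) hmem
  refine ⟨by omega, ?_⟩
  simpa using staysAbove_maxWord l 0 [] (by simp) (fun x hx => (h1 x hx).1) (by simpa using h2)

theorem oneLine_spec {n : ℕ} (σ : Equiv.Perm (Fin n)) :
    (∀ x ∈ oneLine σ, 0 < x ∧ x ≤ n) ∧ (oneLine σ).Nodup ∧ (oneLine σ).length = n := by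
  refine ⟨?_, ?_, by simp [oneLine]⟩
  · intro x hx
    simp only [oneLine, List.mem_ofFn] at hx
    obtain ⟨i, rfl⟩ := hx
    omega
  · rw [oneLine, List.nodup_ofFn]
    intro i j hij
    exact σ.injective (Fin.ext (by simpa using hij))

theorem minWord_dyck {n : ℕ} (σ : Equiv.Perm (Fin n)) :
    (minWord (n + 1) (oneLine σ)).count U = (minWord (n + 1) (oneLine σ)).count D ∧
      StaysAbove 0 (minWord (n + 1) (oneLine σ)) := by
  obtain ⟨h1, h2, h3⟩ := oneLine_spec σ
  rw [minWord_eq_maxWord n _ _ le_rfl (fun x hx => (h1 x hx).2.trans (Nat.le_succ n)), Nat.sub_self]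
  refine maxWord_dyck n _ ?_ ?_ (by simpa using h3)
  · intro y hy
    obtain ⟨x, hx, rfl⟩ := List.mem_map.1 hy
    have := h1 x hx
    omega
  · refine List.Nodup.map_on ?_ h2
    intro x hx y hy hxy
    have := h1 x hx
    have := h1 y hy
    omega

theorem maxWord_oneLine_dyck {n : ℕ} (σ : Equiv.Perm (Fin n)) :
    (maxWord 0 (oneLine σ).reverse).count U = (maxWord 0 (oneLine σ).reverse).count D ∧
      StaysAbove 0 (maxWord 0 (oneLine σ).reverse) := by
  obtain ⟨h1, h2, h3⟩ := oneLine_spec σ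
  exact maxWord_dyck n _ (fun x hx => h1 x (by simpa using hx)) (List.nodup_reverse.2 h2)
    (by simpa using h3)

/-- The path `λ(σ)`: `σ` is read from left to right and `m₀ = n + 1`. -/
def lamPath {n : ℕ} (σ : Equiv.Perm (Fin n)) : DyckWord :=
  ofWord (minWord (n + 1) (oneLine σ)) (minWord_dyck σ).1 (minWord_dyck σ).2

/-- The path `μ(σ)`: `σ` is read from right to left and `M₀ = 0`. -/
def muPath {n : ℕ} (σ : Equiv.Perm (Fin n)) : DyckWord :=
  ofWord (maxWord 0 (oneLine σ).reverse) (maxWord_oneLine_dyck σ).1 (maxWord_oneLine_dyck σ).2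

/-- The map `ν`. -/
def nu {n : ℕ} (σ : Equiv.Perm (Fin n)) : DyckWord × DyckWord := (lamPath σ, muPath σ)

/-- The permutation `σ` contains the pattern `τ`. -/
def ContainsPattern {n k : ℕ} (σ : Equiv.Perm (Fin n)) (τ : Equiv.Perm (Fin k)) : Prop :=
  ∃ f : Fin k → Fin n, StrictMono f ∧ ∀ a b, σ (f a) < σ (f b) ↔ τ a < τ b

/-- The set `Sₙ(1234)` of the permutations avoiding the pattern `1234`, the identity of `S₄`. -/
def avoiding1234 (n : ℕ) : Set (Equiv.Perm (Fin n)) :=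
  {σ | ¬ ContainsPattern σ (1 : Equiv.Perm (Fin 4))}

/-- The admissible pairs of Dyck paths of semilength `n`. -/
def Admissible (n : ℕ) (P Q : DyckWord) : Prop :=
  ∃ α : Equiv.Perm (Fin n), P = lamPath α ∧ Q = muPath α

end DyckPerm

namespace DyckPerm

/-! ### Words, splittings and heights -/

/-! Reverse the values of `α`. For the resulting permutation `τ`, the path `P = λ(α)` records the
left-to-right maxima and `Q = μ(α)` the right-to-left minima; `rotate`, a half turn of the diagram,
exchanges the two. Count from 0 and put `F = flipPath Q`. The left-to-right maxima have the
positions `peakDowns P` and the values `peakUps P`; the right-to-left minima have the positions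
`peakUps F` and the values `peakDowns F`. The remaining positions and values are called free. Thus
`(P, Q)` is admissible when the prescribed extremal entries do not conflict and the free positions
can be matched with the free values so that every entry stays below `P` and above `Q`.

An entry that is extremal in both ways is a fixed point that splits `τ`, and it gives a component
`UD` of both paths; no other overlap may occur. If a prefix of `P` has `d` down steps and `u` up
steps, then `τ` sends the free positions below `d` injectively to free values below `u`. These
conditions, with equality of the returns, form `Compat P F` (`Realizes.compat`). Conversely, `Compat
P (flipPath Q)` and `Compat Q (flipPath P)` suffice: match the free positions and values
increasingly. An entry that violated a bound would contradict the count at that place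
(`exists_entries`).

The free entries also govern the pattern: the middle entries of a `1234` in `α` are free, and two
increasing free entries of `α` extend to a `1234`. So `α` avoids `1234` exactly when the free
entries of `τ` increase (`mem_avoiding1234_iff`), and then the two paths determine them
(`eq_of_realizes`).

It remains to identify `Compat` with the order. On irreducible paths, a chain of covers deletes
entries of both codes, and `j ≥ i` means that every surviving ascent entry had at least the position
of its surviving partner (`CodeLE`). By counting, at every point at most as many descent entries as
ascent entries have been deleted (`reflTransGen_covers_iff`). The involution complements peaks: the
up indices of the peaks of `U L(F) D` are those that are not down indices of peaks of `U F D`, and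
vice versa. So the entries deleted on the way from `U L(F) D` to `U P D` are the free steps, and the
two inequalities coincide (`compat_nest_iff`). `Compat` splits along components (`compat_add_iff`),
and the components `UD`, where the complement rule fails, account for the permitted overlaps. -/

theorem mem_turnsFrom {s t : DyckStep} {w : List DyckStep} : ∀ {u d : ℕ} {p : ℕ × ℕ},
    p ∈ turnsFrom s t u d w ↔ ∃ w₁ w₂, w = w₁ ++ s :: t :: w₂ ∧
      p = (u + (w₁ ++ [s]).count U, d + (w₁ ++ [s]).count D) := by
  induction w with
  | nil => simp [turnsFrom]
  | cons a w ih =>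
    cases w with
    | nil =>
      intro u d p
      simp only [turnsFrom, List.not_mem_nil, false_iff]
      rintro ⟨w₁, w₂, h, -⟩
      have := congrArg List.length h
      simp at this
      omega
    | cons b w =>
      intro u d p
      simp only [turnsFrom, List.mem_append, ih]
      constructor
      · rintro (h | ⟨w₁, w₂, h, rfl⟩)
        · by_cases hc : a = s ∧ b = t
          · rw [if_pos hc] at h
            obtain ⟨rfl, rfl⟩ := hc
            refine ⟨[], w, rfl, ?_⟩
            rw [List.mem_singleton.1 h]
            cases a <;> simp
          · rw [if_neg hc] at h
            simp at h
        · refine ⟨a :: w₁, w₂, by rw [h]; rfl, ?_⟩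
          cases a <;> simp [List.count_cons] <;> omega
      · rintro ⟨w₁, w₂, h, rfl⟩
        cases w₁ with
        | nil =>
          left
          simp only [List.nil_append, List.cons.injEq] at h
          obtain ⟨rfl, rfl, -⟩ := h
          cases a <;> simp
        | cons c w₁ =>
          right
          simp only [List.cons_append, List.cons.injEq] at h
          obtain ⟨rfl, h⟩ := h
          refine ⟨w₁, w₂, h, ?_⟩
          cases a <;> simp [List.count_cons] <;> omega

theorem exists_split_of_lt_count {s : DyckStep} {w : List DyckStep} : ∀ {a : ℕ}, a < w.count s →
    ∃ w₁ w₂, w = w₁ ++ s :: w₂ ∧ w₁.count s = a := by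
  induction w with
  | nil => simp
  | cons x w ih =>
    intro a ha
    by_cases hx : x = s
    · subst hx
      cases a with
      | zero => exact ⟨[], w, rfl, by simp⟩
      | succ a =>
        rw [List.count_cons_self] at ha
        obtain ⟨w₁, w₂, rfl, h⟩ := ih (a := a) (by omega)
        exact ⟨x :: w₁, w₂, rfl, by simp [h]⟩
    · rw [List.count_cons_of_ne hx] at ha
      obtain ⟨w₁, w₂, rfl, h⟩ := ih ha
      exact ⟨x :: w₁, w₂, rfl, by rw [List.count_cons_of_ne hx, h]⟩

/-- Shows that two descriptions of turns concern the same step, so that a step of given index cannot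
have two different neighbours on one side. -/
theorem split_unique {s : DyckStep} : ∀ {w₁ w₂ v₁ v₂ : List DyckStep},
    w₁ ++ s :: w₂ = v₁ ++ s :: v₂ → w₁.count s = v₁.count s → w₁ = v₁ ∧ w₂ = v₂ := by
  intro w₁
  induction w₁ with
  | nil =>
    intro w₂ v₁ v₂ h hc
    cases v₁ with
    | nil => simpa using h
    | cons x v₁ =>
      simp only [List.nil_append, List.cons_append, List.cons.injEq] at h
      obtain ⟨rfl, -⟩ := h
      simp at hc
  | cons y w₁ ih =>
    intro w₂ v₁ v₂ h hc
    cases v₁ with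
    | nil =>
      simp only [List.nil_append, List.cons_append, List.cons.injEq] at h
      obtain ⟨rfl, -⟩ := h
      simp at hc
    | cons x v₁ =>
      simp only [List.cons_append, List.cons.injEq] at h
      obtain ⟨rfl, h⟩ := h
      rw [List.count_cons, List.count_cons] at hc
      obtain ⟨rfl, rfl⟩ := ih h (by omega)
      exact ⟨rfl, rfl⟩

theorem count_le_of_prefix (P : DyckWord) {w : List DyckStep} (h : w <+: P.toList) :
    w.count D ≤ w.count U := by
  have := P.count_D_le_count_U w.length
  rwa [← List.prefix_iff_eq_take.1 h] at this

theorem count_le_semilength (P : DyckWord) {w : List DyckStep} (h : w <+: P.toList) :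
    w.count U ≤ P.semilength ∧ w.count D ≤ P.semilength := by
  refine ⟨h.sublist.count_le U, ?_⟩
  rw [P.semilength_eq_count_D]
  exact h.sublist.count_le D

/-- The numbers of up steps preceding the down steps of a word, for a reading that starts after
`u` up steps. -/
def heights : ℕ → List DyckStep → List ℕ
  | _, [] => []
  | u, U :: w => heights (u + 1) w
  | u, D :: w => u :: heights u w

theorem heights_append (w v : List DyckStep) : ∀ u,
    heights u (w ++ v) = heights u w ++ heights (u + w.count U) v := by
  induction w with
  | nil => simp [heights]
  | cons a w ih =>
    intro u
    cases a <;> simp [heights, ih]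
    congr 1
    omega

theorem length_heights (w : List DyckStep) : ∀ u, (heights u w).length = w.count D := by
  induction w with
  | nil => simp [heights]
  | cons a w ih =>
    intro u
    cases a <;> simp [heights, ih]

theorem le_of_mem_heights (w : List DyckStep) : ∀ u, ∀ x ∈ heights u w, u ≤ x := by
  induction w with
  | nil => simp [heights]
  | cons a w ih =>
    intro u x hx
    cases a
    · have := ih _ _ hx
      omega
    · rcases List.mem_cons.1 hx with rfl | hx
      · exact le_rfl
      · exact ih _ _ hx

/-- The heights place every down step, and the total number of up steps fixes what follows the last
one. -/
theorem eq_of_heights_eq (w : List DyckStep) : ∀ (v : List DyckStep) (u : ℕ),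
    w.count U = v.count U → heights u w = heights u v → w = v := by
  induction w with
  | nil =>
    intro v u hc h
    have := congrArg List.length h
    rw [length_heights, length_heights] at this
    cases v with
    | nil => rfl
    | cons a v => cases a <;> simp at hc this
  | cons a w ih =>
    intro v
    cases v with
    | nil =>
      intro u hc h
      have := congrArg List.length h
      rw [length_heights, length_heights] at this
      cases a <;> simp at hc this
    | cons b v =>
      intro u hc h
      cases a <;> cases b
      · rw [ih v (u + 1) (by simpa using hc) h]
      · have := le_of_mem_heights w (u + 1) u (by
          change heights (u + 1) w = u :: heights u v at h
          simp [h])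
        omega
      · have := le_of_mem_heights v (u + 1) u (by
          change u :: heights u w = heights (u + 1) v at h
          simp [← h])
        omega
      · rw [ih v u (by simpa using hc) (List.cons.inj h).2]

/-- The number of up steps that precede the down step of index `i`. -/
def height (P : DyckWord) (i : ℕ) : ℕ := (heights 0 P.toList).getD i 0

/-! ### Heights of the down steps of a path -/

section Height

variable {P Q : DyckWord} {i j : ℕ}

theorem height_split {w₁ w₂ : List DyckStep} (h : P.toList = w₁ ++ D :: w₂) :
    height P (w₁.count D) = w₁.count U := by
  rw [height, h, heights_append, ← length_heights w₁ 0]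
  simp [heights, List.getD_eq_getElem?_getD]

theorem exists_split_down (hi : i < P.semilength) :
    ∃ w₁ w₂, P.toList = w₁ ++ D :: w₂ ∧ w₁.count D = i := by
  rw [P.semilength_eq_count_D] at hi
  exact exists_split_of_lt_count hi

theorem exists_split_height (hi : i < P.semilength) :
    ∃ w₁ w₂, P.toList = w₁ ++ D :: w₂ ∧ w₁.count D = i ∧ w₁.count U = height P i := by
  obtain ⟨w₁, w₂, h, rfl⟩ := exists_split_down hi
  exact ⟨w₁, w₂, h, rfl, (height_split h).symm⟩

theorem prefix_total {w₁ w₂ w : List DyckStep} (h₁ : w₁ <+: w) (h₂ : w₂ <+: w) :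
    w₁ <+: w₂ ∨ w₂ <+: w₁ := List.prefix_or_prefix_of_prefix h₁ h₂

theorem height_le_of_prefix {w : List DyckStep} (hw : w <+: P.toList) (hi : i < w.count D) :
    height P i ≤ w.count U := by
  obtain ⟨w₁, w₂, rfl, rfl⟩ := exists_split_of_lt_count hi
  obtain ⟨v, hv⟩ := hw
  rw [height_split (w₂ := w₂ ++ v) (by rw [← hv]; simp)]
  simp

theorem exists_prefix_height (hi : i < P.semilength) :
    ∃ w, w <+: P.toList ∧ w.count D = i + 1 ∧ w.count U = height P i := by
  obtain ⟨w₁, w₂, h, h1, h2⟩ := exists_split_height hi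
  refine ⟨w₁ ++ [D], ⟨w₂, by rw [h]; simp⟩, by simp [h1], by simp [h2]⟩

theorem height_mono (hij : i ≤ j) (hj : j < P.semilength) : height P i ≤ height P j := by
  obtain ⟨w, h, h1, h2⟩ := exists_prefix_height hj
  rw [← h2]
  exact height_le_of_prefix h (by omega)

theorem lt_height (hi : i < P.semilength) : i < height P i := by
  obtain ⟨w, h, h1, h2⟩ := exists_prefix_height hi
  have := count_le_of_prefix P h
  omega

theorem height_le (hi : i < P.semilength) : height P i ≤ P.semilength := by
  obtain ⟨w, h, h1, h2⟩ := exists_prefix_height hi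
  have := count_le_semilength P h
  omega

theorem eq_of_height_eq (hn : P.semilength = Q.semilength)
    (h : ∀ i < P.semilength, height P i = height Q i) : P = Q := by
  ext1
  refine eq_of_heights_eq _ _ 0 hn (List.ext_getElem ?_ ?_)
  · rw [length_heights, length_heights, ← P.semilength_eq_count_D, ← Q.semilength_eq_count_D, hn]
  · intro i h1 h2
    have := h i (by rwa [length_heights, ← P.semilength_eq_count_D] at h1)
    rwa [height, height, List.getD_eq_getElem _ _ h1, List.getD_eq_getElem _ _ h2] at this

end Height

/-! ### Peaks and returns -/

/-- The indices of the up steps that are followed by a down step. -/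
def peakUps (P : DyckWord) : Finset ℕ := ((turns U D P).map fun p => p.1 - 1).toFinset

/-- The indices of the down steps that are preceded by an up step. -/
def peakDowns (P : DyckWord) : Finset ℕ := ((turns U D P).map Prod.snd).toFinset

/-- The path is on the `x`-axis after `r` up steps and `r` down steps. -/
def Ret (P : DyckWord) (r : ℕ) : Prop :=
  ∃ w, w <+: P.toList ∧ w.count U = r ∧ w.count D = r

section Peaks

variable {P Q : DyckWord} {a i r : ℕ}

theorem mem_peakUps : a ∈ peakUps P ↔
    ∃ w₁ w₂, P.toList = w₁ ++ U :: D :: w₂ ∧ w₁.count U = a := by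
  simp only [peakUps, List.mem_toFinset, List.mem_map, turns, mem_turnsFrom]
  constructor
  · rintro ⟨_, ⟨w₁, w₂, h, rfl⟩, rfl⟩
    exact ⟨w₁, w₂, h, by simp⟩
  · rintro ⟨w₁, w₂, h, rfl⟩
    exact ⟨_, ⟨w₁, w₂, h, rfl⟩, by simp⟩

theorem mem_peakDowns : a ∈ peakDowns P ↔
    ∃ w₁ w₂, P.toList = w₁ ++ U :: D :: w₂ ∧ w₁.count D = a := by
  simp only [peakDowns, List.mem_toFinset, List.mem_map, turns, mem_turnsFrom]
  constructor
  · rintro ⟨_, ⟨w₁, w₂, h, rfl⟩, rfl⟩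
    exact ⟨w₁, w₂, h, by simp⟩
  · rintro ⟨w₁, w₂, h, rfl⟩
    exact ⟨_, ⟨w₁, w₂, h, rfl⟩, by simp⟩

theorem lt_of_mem_peakUps (h : a ∈ peakUps P) : a < P.semilength := by
  obtain ⟨w₁, w₂, e, rfl⟩ := mem_peakUps.1 h
  rw [DyckWord.semilength, e]
  simp [List.count_append]

theorem lt_of_mem_peakDowns (h : a ∈ peakDowns P) : a < P.semilength := by
  obtain ⟨w₁, w₂, e, rfl⟩ := mem_peakDowns.1 h
  rw [DyckWord.semilength_eq_count_D, e]
  simp [List.count_append]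

theorem height_lt_height (hi : i ∈ peakDowns P) {j : ℕ} (hj : j < i) :
    height P j < height P i := by
  obtain ⟨w₁, w₂, h, rfl⟩ := mem_peakDowns.1 hi
  have h1 := height_le_of_prefix (P := P) (w := w₁) ⟨_, h.symm⟩ hj
  have h2 := height_split (P := P) (w₁ := w₁ ++ [U]) (w₂ := w₂) (by rw [h]; simp)
  simp only [List.count_append] at h2
  simp at h2
  omega

theorem height_eq_of_notMem (hi : i + 1 < P.semilength) (h : i + 1 ∉ peakDowns P) :
    height P (i + 1) = height P i := by
  obtain ⟨w₁, w₂, h1, h2, h3⟩ := exists_split_height hi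
  rcases List.eq_nil_or_concat w₁ with rfl | ⟨v, a, rfl⟩
  · simp at h2
  · cases a with
    | U =>
      refine absurd (mem_peakDowns.2 ⟨v, w₂, by rw [h1]; simp, ?_⟩) h
      simpa using h2
    | D =>
      rw [List.concat_eq_append, List.append_assoc] at h1
      have := height_split h1
      simp at h2 h3
      rw [h2] at this
      omega

/-- The height grows between consecutive down steps precisely when an up step intervenes, so the
peaks are the strict records of the height. -/
theorem mem_peakDowns_iff (hi : i < P.semilength) :
    i ∈ peakDowns P ↔ ∀ j < i, height P j < height P i := by
  refine ⟨fun h j hj => height_lt_height h hj, fun h => ?_⟩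
  by_contra hc
  cases i with
  | zero =>
    obtain ⟨w₁, w₂, h1, h2, h3⟩ := exists_split_height hi
    rcases List.eq_nil_or_concat w₁ with rfl | ⟨v, a, rfl⟩
    · have := lt_height hi
      simp at h3
      omega
    · cases a with
      | U => exact hc (mem_peakDowns.2 ⟨v, w₂, by rw [h1]; simp, by simpa using h2⟩)
      | D => simp at h2
  | succ i =>
    have h1 := height_eq_of_notMem hi hc
    have h2 := h i (by omega)
    omega

theorem mem_peakUps_iff : a ∈ peakUps P ↔ ∃ i ∈ peakDowns P, height P i = a + 1 := by
  constructor
  · intro h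
    obtain ⟨w₁, w₂, e, rfl⟩ := mem_peakUps.1 h
    refine ⟨w₁.count D, mem_peakDowns.2 ⟨w₁, w₂, e, rfl⟩, ?_⟩
    have h2 := height_split (P := P) (w₁ := w₁ ++ [U]) (w₂ := w₂) (by rw [e]; simp)
    simpa using h2
  · rintro ⟨i, hi, h1⟩
    obtain ⟨w₁, w₂, h, rfl⟩ := mem_peakDowns.1 hi
    refine mem_peakUps.2 ⟨w₁, w₂, h, ?_⟩
    have h2 := height_split (P := P) (w₁ := w₁ ++ [U]) (w₂ := w₂) (by rw [h]; simp)
    simp at h2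
    omega

/-- Going back to the start of a run of down steps does not change the height. -/
theorem exists_peakDowns_le (hi : i < P.semilength) :
    ∃ j ∈ peakDowns P, j ≤ i ∧ height P j = height P i := by
  induction i with
  | zero => exact ⟨0, (mem_peakDowns_iff hi).2 (by simp), le_rfl, rfl⟩
  | succ i ih =>
    by_cases h : i + 1 ∈ peakDowns P
    · exact ⟨_, h, le_rfl, rfl⟩
    · obtain ⟨j, h1, h2, h3⟩ := ih (by omega)
      exact ⟨j, h1, by omega, by rw [h3, height_eq_of_notMem hi h]⟩

theorem height_injOn : Set.InjOn (height P) (peakDowns P : Set ℕ) := by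
  intro i hi j hj h
  rcases lt_trichotomy i j with hij | hij | hij
  · exact absurd (height_lt_height hj hij) (by omega)
  · exact hij
  · exact absurd (height_lt_height hi hij) (by omega)

/-- Both sets index the peaks: the peak with down index `i` has up index `height P i - 1`. -/
theorem card_peakUps : (peakUps P).card = (peakDowns P).card := by
  have : peakUps P = (peakDowns P).image fun i => height P i - 1 := by
    ext a
    rw [mem_peakUps_iff, Finset.mem_image]
    refine exists_congr fun i => and_congr_right fun hi => ?_
    have := lt_height (lt_of_mem_peakDowns hi)
    omega
  rw [this, Finset.card_image_of_injOn]
  intro i hi j hj h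
  apply height_injOn hi hj
  have := lt_height (lt_of_mem_peakDowns hi)
  have := lt_height (lt_of_mem_peakDowns hj)
  simp only at h
  omega

/-! ### Returns to the axis -/

theorem ret_zero : Ret P 0 := ⟨[], by simp, by simp, by simp⟩

theorem Ret.le (h : Ret P r) : r ≤ P.semilength := by
  obtain ⟨w, h, h1, h2⟩ := h
  have := count_le_semilength P h
  omega

theorem ret_semilength : Ret P P.semilength :=
  ⟨P.toList, List.prefix_rfl, rfl, P.semilength_eq_count_D.symm⟩

/-- The height of the down step `r` is always at least `r + 1`; equality says that this step lands
on the axis. -/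
theorem ret_succ_iff : Ret P (r + 1) ↔ r < P.semilength ∧ height P r = r + 1 := by
  constructor
  · intro h
    have hr := h.le
    obtain ⟨w, h, h1, h2⟩ := h
    have h3 := height_le_of_prefix (i := r) h (by omega)
    have h4 := lt_height (P := P) (i := r) (by omega)
    omega
  · rintro ⟨h1, h2⟩
    obtain ⟨w, h, h3, h4⟩ := exists_prefix_height h1
    exact ⟨w, h, by omega, h3⟩

/-- Two consecutive returns enclose a component `UD`, both steps of which have index `r`. -/
theorem mem_peakDowns_of_ret (h₁ : Ret P r) (h₂ : Ret P (r + 1)) : r ∈ peakDowns P := by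
  rw [ret_succ_iff] at h₂
  rw [mem_peakDowns_iff h₂.1]
  intro j hj
  cases r with
  | zero => omega
  | succ r =>
    rw [ret_succ_iff] at h₁
    have := height_mono (P := P) (i := j) (j := r) (by omega) (by omega)
    omega

theorem mem_peakUps_of_ret (h₁ : Ret P r) (h₂ : Ret P (r + 1)) : r ∈ peakUps P :=
  mem_peakUps_iff.2 ⟨r, mem_peakDowns_of_ret h₁ h₂, (ret_succ_iff.1 h₂).2⟩

end Peaks

/-! ### Flipping, nesting and concatenation -/

section Operations

variable {P Q : DyckWord} {a i r : ℕ}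

theorem toList_add (P Q : DyckWord) : (P + Q).toList = P.toList ++ Q.toList := rfl

theorem toList_nest (P : DyckWord) : P.nest.toList = U :: (P.toList ++ [D]) := rfl

theorem toList_flipPath (P : DyckWord) : (flipPath P).toList = P.toList.reverse.map flipStep := rfl

theorem flipStep_flipStep (s : DyckStep) : flipStep (flipStep s) = s := by cases s <;> rfl

theorem flipPath_flipPath (P : DyckWord) : flipPath (flipPath P) = P := by
  ext1
  simp [toList_flipPath, List.map_reverse, Function.comp_def, flipStep_flipStep]

theorem semilength_flipPath (P : DyckWord) : (flipPath P).semilength = P.semilength := by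
  rw [DyckWord.semilength, toList_flipPath, (count_map_flipStep _).1, List.count_reverse,
    P.semilength_eq_count_D]

theorem split_flipPath {w₁ w₂ : List DyckStep} (h : P.toList = w₁ ++ w₂) :
    (flipPath P).toList = w₂.reverse.map flipStep ++ w₁.reverse.map flipStep := by
  rw [toList_flipPath, h]
  simp

/-- The flip reverses the word and exchanges the kinds of steps, so the up step of index `a` becomes
the down step of index `n - 1 - a`, where `n` is the semilength. -/
theorem sub_mem_peakDowns_flipPath (h : a ∈ peakUps P) :
    P.semilength - 1 - a ∈ peakDowns (flipPath P) := by
  obtain ⟨w₁, w₂, e, rfl⟩ := mem_peakUps.1 h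
  refine mem_peakDowns.2 ⟨w₂.reverse.map flipStep, w₁.reverse.map flipStep, ?_, ?_⟩
  · rw [split_flipPath e]
    simp [flipStep]
  · rw [(count_map_flipStep _).2, List.count_reverse, DyckWord.semilength, e]
    simp [List.count_append]

theorem sub_mem_peakUps_flipPath (h : a ∈ peakDowns P) :
    P.semilength - 1 - a ∈ peakUps (flipPath P) := by
  obtain ⟨w₁, w₂, e, rfl⟩ := mem_peakDowns.1 h
  refine mem_peakUps.2 ⟨w₂.reverse.map flipStep, w₁.reverse.map flipStep, ?_, ?_⟩
  · rw [split_flipPath e]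
    simp [flipStep]
  · rw [(count_map_flipStep _).1, List.count_reverse, DyckWord.semilength_eq_count_D, e]
    simp [List.count_append]

theorem mem_peakDowns_flipPath (ha : a < P.semilength) :
    a ∈ peakDowns (flipPath P) ↔ P.semilength - 1 - a ∈ peakUps P := by
  constructor
  · intro h
    have := sub_mem_peakUps_flipPath h
    rwa [flipPath_flipPath, semilength_flipPath] at this
  · intro h
    have := sub_mem_peakDowns_flipPath h
    rwa [show P.semilength - 1 - (P.semilength - 1 - a) = a by omega] at this

theorem mem_peakUps_flipPath (ha : a < P.semilength) :
    a ∈ peakUps (flipPath P) ↔ P.semilength - 1 - a ∈ peakDowns P := by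
  constructor
  · intro h
    have := sub_mem_peakDowns_flipPath h
    rwa [flipPath_flipPath, semilength_flipPath] at this
  · intro h
    have := sub_mem_peakUps_flipPath h
    rwa [show P.semilength - 1 - (P.semilength - 1 - a) = a by omega] at this

theorem Ret.flip (h : Ret P r) : Ret (flipPath P) (P.semilength - r) := by
  obtain ⟨w, ⟨v, h⟩, h1, h2⟩ := h
  refine ⟨v.reverse.map flipStep, ⟨_, (split_flipPath h.symm).symm⟩, ?_, ?_⟩
  · rw [(count_map_flipStep _).1, List.count_reverse, P.semilength_eq_count_D, ← h]
    simp [h2]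
  · rw [(count_map_flipStep _).2, List.count_reverse, DyckWord.semilength, ← h]
    simp [h1]

theorem ret_flipPath (hr : r ≤ P.semilength) : Ret (flipPath P) r ↔ Ret P (P.semilength - r) := by
  constructor
  · intro h
    have := h.flip
    rwa [flipPath_flipPath, semilength_flipPath] at this
  · intro h
    have := h.flip
    rwa [show P.semilength - (P.semilength - r) = r by omega] at this

theorem getLast_eq_down {w : List DyckStep} {s : DyckStep} (h : P.toList = w ++ [s]) : s = D := by
  have h0 : P ≠ 0 := by
    rintro rfl
    have h := congrArg List.length h
    rw [List.length_append] at h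
    simp at h
  have := P.getLast_eq_D (DyckWord.toList_ne_nil.2 h0)
  simpa [h] using this

theorem head_eq_up {w : List DyckStep} {s : DyckStep} (h : P.toList = s :: w) : s = U := by
  have h0 : P ≠ 0 := by
    rintro rfl
    exact List.cons_ne_nil _ _ h.symm
  have := P.head_eq_U (DyckWord.toList_ne_nil.2 h0)
  simpa [h] using this

/-- A nonempty `P` begins with `U` and ends with `D`, so neither of the two added steps takes part
in a peak. -/
theorem peak_split_nest (hP : P ≠ 0) {w₁ w₂ : List DyckStep} :
    P.nest.toList = w₁ ++ U :: D :: w₂ ↔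
      ∃ v₁ v₂, w₁ = U :: v₁ ∧ w₂ = v₂ ++ [D] ∧ P.toList = v₁ ++ U :: D :: v₂ := by
  rw [toList_nest]
  constructor
  · intro h
    cases w₁ with
    | nil =>
      simp only [List.nil_append, List.cons.injEq, true_and] at h
      cases hl : P.toList with
      | nil => exact absurd (DyckWord.toList_eq_nil.1 hl) hP
      | cons s w =>
        rw [hl] at h
        simp only [List.cons_append, List.cons.injEq] at h
        rw [head_eq_up hl] at h
        simp at h
    | cons s v₁ =>
      simp only [List.cons_append, List.cons.injEq] at h
      obtain ⟨rfl, h⟩ := h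
      rcases List.eq_nil_or_concat w₂ with rfl | ⟨v₂, t, rfl⟩
      · have h' : P.toList ++ [D] = (v₁ ++ [U]) ++ [D] := by rw [h]; simp
        have := getLast_eq_down (List.append_cancel_right h')
        simp at this
      · have h' : P.toList ++ [D] = (v₁ ++ U :: D :: v₂) ++ [t] := by rw [h]; simp
        obtain ⟨h1, h2⟩ := List.append_inj' h' rfl
        simp at h2
        exact ⟨v₁, v₂, rfl, by simp [h2], h1⟩
  · rintro ⟨v₁, v₂, rfl, rfl, h⟩
    rw [h]
    simp

theorem mem_peakUps_nest (hP : P ≠ 0) : a ∈ peakUps P.nest ↔ ∃ b ∈ peakUps P, a = b + 1 := by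
  simp only [mem_peakUps, peak_split_nest hP]
  constructor
  · rintro ⟨_, _, ⟨v₁, v₂, rfl, rfl, h⟩, rfl⟩
    exact ⟨_, ⟨v₁, v₂, h, rfl⟩, by simp⟩
  · rintro ⟨b, ⟨v₁, v₂, h, rfl⟩, rfl⟩
    exact ⟨_, _, ⟨v₁, v₂, rfl, rfl, h⟩, by simp⟩

theorem peakDowns_nest (hP : P ≠ 0) : peakDowns P.nest = peakDowns P := by
  ext a
  simp only [mem_peakDowns, peak_split_nest hP]
  constructor
  · rintro ⟨_, _, ⟨v₁, v₂, rfl, rfl, h⟩, rfl⟩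
    exact ⟨v₁, v₂, h, by simp⟩
  · rintro ⟨v₁, v₂, h, rfl⟩
    exact ⟨_, _, ⟨v₁, v₂, rfl, rfl, h⟩, by simp⟩

/-- No peak straddles the joint, because `P` cannot end with `U`. -/
theorem peak_split_add {w₁ w₂ : List DyckStep} :
    (P + Q).toList = w₁ ++ U :: D :: w₂ ↔
      (∃ v, w₂ = v ++ Q.toList ∧ P.toList = w₁ ++ U :: D :: v) ∨
      ∃ v, w₁ = P.toList ++ v ∧ Q.toList = v ++ U :: D :: w₂ := by
  rw [toList_add, List.append_eq_append_iff]
  constructor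
  · rintro (⟨v, h1, h2⟩ | ⟨v, h1, h2⟩)
    · exact Or.inr ⟨v, h1, h2⟩
    · match v, h1, h2 with
      | [], h1, h2 => exact Or.inr ⟨[], by simpa using h1.symm, by simpa using h2.symm⟩
      | [s], h1, h2 =>
        simp only [List.cons_append, List.nil_append, List.cons.injEq] at h2
        rw [← h2.1] at h1
        have := getLast_eq_down h1
        simp at this
      | s :: t :: v, h1, h2 =>
        simp only [List.cons_append, List.cons.injEq] at h2
        obtain ⟨rfl, rfl, h2⟩ := h2
        exact Or.inl ⟨v, h2, h1⟩
  · rintro (⟨v, rfl, h⟩ | ⟨v, rfl, h⟩)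
    · exact Or.inr ⟨U :: D :: v, h, rfl⟩
    · exact Or.inl ⟨v, rfl, h⟩

theorem mem_peakUps_add : a ∈ peakUps (P + Q) ↔
    a ∈ peakUps P ∨ ∃ b ∈ peakUps Q, a = P.semilength + b := by
  simp only [mem_peakUps, peak_split_add]
  constructor
  · rintro ⟨w₁, w₂, ⟨v, rfl, h⟩ | ⟨v, rfl, h⟩, rfl⟩
    · exact Or.inl ⟨_, _, h, rfl⟩
    · exact Or.inr ⟨_, ⟨_, _, h, rfl⟩, by simp [DyckWord.semilength]⟩
  · rintro (⟨w₁, v, h, rfl⟩ | ⟨_, ⟨v, w₂, h, rfl⟩, rfl⟩)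
    · exact ⟨w₁, _, Or.inl ⟨v, rfl, h⟩, rfl⟩
    · exact ⟨_, w₂, Or.inr ⟨v, rfl, h⟩, by simp [DyckWord.semilength]⟩

theorem mem_peakDowns_add : a ∈ peakDowns (P + Q) ↔
    a ∈ peakDowns P ∨ ∃ b ∈ peakDowns Q, a = P.semilength + b := by
  simp only [mem_peakDowns, peak_split_add]
  constructor
  · rintro ⟨w₁, w₂, ⟨v, rfl, h⟩ | ⟨v, rfl, h⟩, rfl⟩
    · exact Or.inl ⟨_, _, h, rfl⟩
    · exact Or.inr ⟨_, ⟨_, _, h, rfl⟩, by simp [DyckWord.semilength_eq_count_D]⟩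
  · rintro (⟨w₁, v, h, rfl⟩ | ⟨_, ⟨v, w₂, h, rfl⟩, rfl⟩)
    · exact ⟨w₁, _, Or.inl ⟨v, rfl, h⟩, rfl⟩
    · exact ⟨_, w₂, Or.inr ⟨v, rfl, h⟩, by simp [DyckWord.semilength_eq_count_D]⟩

theorem prefix_add {w : List DyckStep} : w <+: (P + Q).toList ↔
    w <+: P.toList ∨ ∃ v, w = P.toList ++ v ∧ v <+: Q.toList := by
  rw [toList_add]
  constructor
  · intro h
    rcases prefix_total h (List.prefix_append P.toList Q.toList) with h1 | ⟨v, rfl⟩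
    · exact Or.inl h1
    · exact Or.inr ⟨v, rfl, (List.prefix_append_right_inj _).1 h⟩
  · rintro (h | ⟨v, rfl, h⟩)
    · exact h.trans (List.prefix_append _ _)
    · exact (List.prefix_append_right_inj _).2 h

theorem ret_add : Ret (P + Q) r ↔ Ret P r ∨ ∃ b, Ret Q b ∧ r = P.semilength + b := by
  simp only [Ret, prefix_add]
  constructor
  · rintro ⟨w, h | ⟨v, rfl, h⟩, h1, h2⟩
    · exact Or.inl ⟨w, h, h1, h2⟩
    · rw [List.count_append] at h1 h2
      have e1 : P.toList.count U = P.semilength := rfl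
      have e2 := P.semilength_eq_count_D
      exact Or.inr ⟨r - P.semilength, ⟨v, h, by omega, by omega⟩, by omega⟩
  · rintro (⟨w, h, h1, h2⟩ | ⟨b, ⟨v, h, h1, h2⟩, rfl⟩)
    · exact ⟨w, Or.inl h, h1, h2⟩
    · exact ⟨_, Or.inr ⟨v, rfl, h⟩, by simp [h1, DyckWord.semilength],
        by simp [h2, DyckWord.semilength_eq_count_D]⟩

theorem isNested_count_lt (hP : P.IsNested) {w : List DyckStep} (h : w <+: P.toList)
    (h0 : w ≠ []) (h1 : w ≠ P.toList) : w.count D < w.count U := by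
  have hl : w.length < P.toList.length :=
    lt_of_le_of_ne h.length_le fun e => h1 (h.eq_of_length e)
  have := hP.2 (List.length_pos_iff.2 h0) hl
  rwa [← List.prefix_iff_eq_take.1 h] at this

theorem ret_iff_of_isNested (hP : P.IsNested) : Ret P r ↔ r = 0 ∨ r = P.semilength := by
  constructor
  · rintro ⟨w, h, h1, h2⟩
    by_cases h0 : w = []
    · left; simp [h0] at h1; exact h1.symm
    · by_cases h3 : w = P.toList
      · right; rw [← h1, h3]; rfl
      · have := isNested_count_lt hP h h0 h3
        omega
  · rintro (rfl | rfl)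
    · exact ret_zero
    · exact ret_semilength

end Operations

/-! ### Valleys, double ascents and double descents as complements -/

section Codes

variable {P : DyckWord} {a : ℕ}

theorem mem_map_fst_turns {s t : DyckStep} : a ∈ (turns s t P).map Prod.fst ↔
    ∃ w₁ w₂, P.toList = w₁ ++ s :: t :: w₂ ∧ (w₁ ++ [s]).count U = a := by
  simp only [List.mem_map, turns, mem_turnsFrom]
  constructor
  · rintro ⟨_, ⟨w₁, w₂, h, rfl⟩, rfl⟩
    exact ⟨w₁, w₂, h, by simp⟩
  · rintro ⟨w₁, w₂, h, rfl⟩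
    exact ⟨_, ⟨w₁, w₂, h, rfl⟩, by simp⟩

theorem mem_map_snd_turns {s t : DyckStep} : a ∈ (turns s t P).map Prod.snd ↔
    ∃ w₁ w₂, P.toList = w₁ ++ s :: t :: w₂ ∧ (w₁ ++ [s]).count D = a := by
  simp only [List.mem_map, turns, mem_turnsFrom]
  constructor
  · rintro ⟨_, ⟨w₁, w₂, h, rfl⟩, rfl⟩
    exact ⟨w₁, w₂, h, by simp⟩
  · rintro ⟨w₁, w₂, h, rfl⟩
    exact ⟨_, ⟨w₁, w₂, h, rfl⟩, by simp⟩

/-- The up step of index `a > 0` follows either an up step, at a double ascent, or a down step, at a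
valley. A valley has `a > 0` because the path does not go below the axis. -/
theorem mem_ascentCode : a ∈ ascentCode P ↔
    0 < a ∧ a < P.semilength ∧ a ∉ (doubleAscents P).map Prod.fst := by
  rw [ascentCode, valleys, doubleAscents, mem_map_fst_turns, mem_map_fst_turns]
  constructor
  · rintro ⟨w₁, w₂, h, rfl⟩
    have hD : P.toList = (w₁ ++ [D]) ++ U :: w₂ := by rw [h]; simp
    have h1 := count_le_of_prefix P ⟨_, hD.symm⟩
    refine ⟨?_, ?_, ?_⟩
    · have e1 : [D].count D = 1 := rfl
      rw [List.count_append] at h1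
      omega
    · rw [DyckWord.semilength, h]; simp [List.count_append]
    · rintro ⟨v₁, v₂, h2, h3⟩
      have := (split_unique (s := U) (hD.symm.trans (h2.trans
        (show _ = (v₁ ++ [U]) ++ U :: v₂ by simp))) h3.symm).1
      simpa using congrArg List.getLast? this
  · rintro ⟨h1, h2, h3⟩
    obtain ⟨w₁, w₂, h, rfl⟩ := exists_split_of_lt_count h2
    rcases List.eq_nil_or_concat w₁ with rfl | ⟨v, s, rfl⟩
    · simp at h1
    · cases s with
      | U => exact absurd ⟨v, w₂, by rw [h]; simp, by simp⟩ h3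
      | D => exact ⟨v, w₂, by rw [h]; simp, by simp⟩

/-- The same dichotomy for the step that follows the down step of index `a - 1`. -/
theorem mem_descentCode : a ∈ descentCode P ↔
    0 < a ∧ a < P.semilength ∧ a ∉ (doubleDescents P).map Prod.snd := by
  rw [descentCode, valleys, doubleDescents, mem_map_snd_turns, mem_map_snd_turns]
  constructor
  · rintro ⟨w₁, w₂, h, rfl⟩
    refine ⟨by simp, ?_, ?_⟩
    · have h1 := count_le_of_prefix P (w := w₁ ++ [D]) ⟨U :: w₂, by rw [h]; simp⟩
      rw [DyckWord.semilength, h]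
      simp [List.count_append] at h1 ⊢
      omega
    · rintro ⟨v₁, v₂, h2, h3⟩
      have := (split_unique (s := D) (h.symm.trans h2) (by simpa using h3.symm)).2
      simp at this
  · rintro ⟨h1, h2, h3⟩
    obtain ⟨b, rfl⟩ : ∃ b, a = b + 1 := ⟨a - 1, by omega⟩
    obtain ⟨w₁, w₂, h, rfl⟩ := exists_split_down (P := P) (i := b) (by omega)
    match w₂, h with
    | [], h =>
      rw [P.semilength_eq_count_D, h] at h2
      simp at h2
    | D :: v, h => exact absurd ⟨w₁, v, h, by simp⟩ h3
    | U :: v, h => exact ⟨w₁, v, h, by simp⟩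

theorem mem_peakUps_iff_notMem : a ∈ peakUps P ↔
    a < P.semilength ∧ a + 1 ∉ (doubleAscents P).map Prod.fst := by
  rw [doubleAscents, mem_map_fst_turns]
  constructor
  · intro ha
    refine ⟨lt_of_mem_peakUps ha, ?_⟩
    obtain ⟨w₁, w₂, h, rfl⟩ := mem_peakUps.1 ha
    rintro ⟨v₁, v₂, h2, h3⟩
    have := (split_unique (s := U) (h.symm.trans h2) (by simpa using h3.symm)).2
    simp at this
  · rintro ⟨h1, h2⟩
    obtain ⟨w₁, w₂, h, rfl⟩ := exists_split_of_lt_count h1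
    match w₂, h with
    | [], h =>
      have := getLast_eq_down h
      simp at this
    | D :: v, h => exact mem_peakUps.2 ⟨w₁, v, h, rfl⟩
    | U :: v, h => exact absurd ⟨w₁, v, h, by simp⟩ h2

theorem mem_peakDowns_iff_notMem : a ∈ peakDowns P ↔
    a < P.semilength ∧ a ∉ (doubleDescents P).map Prod.snd := by
  rw [doubleDescents, mem_map_snd_turns]
  constructor
  · intro ha
    refine ⟨lt_of_mem_peakDowns ha, ?_⟩
    obtain ⟨w₁, w₂, h, rfl⟩ := mem_peakDowns.1 ha
    rintro ⟨v₁, v₂, h2, h3⟩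
    have := (split_unique (s := D) ((show _ = (w₁ ++ [U]) ++ D :: w₂ by simpa using h).symm.trans
      (h2.trans (show _ = (v₁ ++ [D]) ++ D :: v₂ by simp))) (by simpa using h3.symm)).1
    simpa using congrArg List.getLast? this
  · rintro ⟨h1, h2⟩
    obtain ⟨w₁, w₂, h, rfl⟩ := exists_split_down h1
    rcases List.eq_nil_or_concat w₁ with rfl | ⟨v, s, rfl⟩
    · have := head_eq_up h
      simp at this
    · cases s with
      | U => exact mem_peakDowns.2 ⟨v, w₂, by rw [h]; simp, by simp⟩
      | D => exact absurd ⟨v, w₂, by rw [h]; simp, by simp⟩ h2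

/-- Only down steps lie between a peak and the next valley, which is therefore preceded by `a + 1`
up steps; the last peak has no valley after it. -/
theorem mem_peakUps_iff_code : a ∈ peakUps P ↔
    a + 1 = P.semilength ∨ a + 1 ∈ ascentCode P := by
  rw [mem_ascentCode, mem_peakUps_iff_notMem]
  constructor
  · rintro ⟨h1, h2⟩
    by_cases h : a + 1 = P.semilength
    · exact Or.inl h
    · exact Or.inr ⟨by omega, by omega, h2⟩
  · rintro (h | ⟨h1, h2, h3⟩)
    · refine ⟨by omega, ?_⟩
      rw [doubleAscents, mem_map_fst_turns]
      rintro ⟨w₁, w₂, h2, h3⟩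
      rw [h, DyckWord.semilength, h2] at h3
      simp [List.count_append] at h3
    · exact ⟨by omega, h3⟩

/-- A peak and the valley before it are preceded by equally many down steps; the first peak has no
valley before it. -/
theorem mem_peakDowns_iff_code (hP : P ≠ 0) : a ∈ peakDowns P ↔
    a = 0 ∨ a ∈ descentCode P := by
  rw [mem_descentCode, mem_peakDowns_iff_notMem]
  have hn : P.semilength ≠ 0 := by
    intro h
    have := P.two_mul_semilength_eq_length
    rw [h] at this
    exact hP (DyckWord.toList_eq_nil.1 (List.length_eq_zero_iff.1 this.symm))
  constructor
  · rintro ⟨h1, h2⟩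
    by_cases h : a = 0
    · exact Or.inl h
    · exact Or.inr ⟨by omega, by omega, h2⟩
  · rintro (h | ⟨h1, h2, h3⟩)
    · refine ⟨by omega, ?_⟩
      rw [doubleDescents, mem_map_snd_turns]
      rintro ⟨w₁, w₂, h2, h3⟩
      simp at h3
      omega
    · exact ⟨by omega, h3⟩

end Codes

/-! ### Paths with given valleys -/

theorem turnsFrom_replicate_up (w : List DyckStep) (d i : ℕ) : ∀ u,
    turnsFrom D U u d (List.replicate i U ++ w) = turnsFrom D U (u + i) d w := by
  induction i with
  | zero => simp
  | succ i ih =>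
    intro u
    have : turnsFrom D U u d (U :: (List.replicate i U ++ w)) =
        turnsFrom D U (u + 1) d (List.replicate i U ++ w) := by
      cases List.replicate i U ++ w <;> simp [turnsFrom]
    rw [List.replicate_succ, List.cons_append, this, ih]
    congr 1
    omega

theorem turnsFrom_replicate_down (w : List DyckStep) (u j : ℕ) : ∀ d,
    turnsFrom D U u d (List.replicate (j + 1) D ++ U :: w) =
      (u, d + j + 1) :: turnsFrom D U u (d + j + 1) (U :: w) := by
  induction j with
  | zero => intro d; simp [turnsFrom]
  | succ j ih =>
    intro d
    have : turnsFrom D U u d (D :: (List.replicate (j + 1) D ++ U :: w)) =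
        turnsFrom D U u (d + 1) (List.replicate (j + 1) D ++ U :: w) := by
      simp [List.replicate_succ, turnsFrom]
    rw [List.replicate_succ, List.cons_append, this, ih, show d + 1 + j + 1 = d + (j + 1) + 1 by omega]

/-- Lists of points that are strictly increasing in both coordinates, the first of which stay
below `n`. -/
def StrictFrom (n : ℕ) : ℕ → ℕ → List (ℕ × ℕ) → Prop
  | u, _, [] => u < n
  | u, d, (a, b) :: vs => u < a ∧ d < b ∧ StrictFrom n a b vs

/-- Makes visible the up step after a run of down steps, without which the end of the run would not
be a valley. -/
theorem wordFrom_eq_up_cons {n u d : ℕ} {vs : List (ℕ × ℕ)} (h : StrictFrom n u d vs) :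
    wordFrom n u d vs = U :: wordFrom n (u + 1) d vs := by
  cases vs with
  | nil =>
    have : u < n := h
    simp only [wordFrom]
    rw [show n - u = (n - (u + 1)) + 1 by omega, List.replicate_succ]
    rfl
  | cons v vs =>
    have : u < v.1 := h.1
    simp only [wordFrom]
    rw [show v.1 - u = (v.1 - (u + 1)) + 1 by omega, List.replicate_succ]
    rfl

theorem turnsFrom_wordFrom {n : ℕ} {vs : List (ℕ × ℕ)} : ∀ {u d : ℕ}, StrictFrom n u d vs →
    turnsFrom D U u d (wordFrom n u d vs) = vs := by
  induction vs with
  | nil =>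
    intro u d h
    rw [wordFrom, turnsFrom_replicate_up]
    generalize u + (n - u) = a
    generalize n - d = k
    induction k generalizing d with
    | zero => simp [turnsFrom]
    | succ k ih =>
      cases k with
      | zero => simp [turnsFrom]
      | succ k =>
        have := ih (d := d + 1) h
        simpa [List.replicate_succ, turnsFrom] using this
  | cons v vs ih =>
    obtain ⟨a, b⟩ := v
    rintro u d ⟨h1, h2, h3⟩
    have := ih h3
    rw [wordFrom_eq_up_cons h3] at this
    rw [wordFrom, turnsFrom_replicate_up, show b - d = (b - d - 1) + 1 by omega,
      wordFrom_eq_up_cons h3, turnsFrom_replicate_down, show u + (a - u) = a by omega,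
      show d + (b - d - 1) + 1 = b by omega, this]

/-- From one valley to the next the word is a run of up steps and then a run of down steps, so the
valleys determine it. -/
theorem eq_wordFrom (n : ℕ) (w : List DyckStep) : ∀ u d, w.count U = n - u → w.count D = n - d →
    u ≤ n → d ≤ n → (∀ v, w ≠ v ++ [U]) → w = wordFrom n u d (turnsFrom D U u d w) := by
  induction w with
  | nil =>
    intro u d h1 h2 h3 h4 _
    simp at h1 h2
    simp [turnsFrom, wordFrom, ← h1, ← h2]
  | cons s w ih =>
    intro u d h1 h2 h3 h4 h5
    have h5' : ∀ v, w ≠ v ++ [U] := fun v hv => h5 (s :: v) (by rw [hv]; rfl)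
    cases s with
    | U =>
      simp at h1 h2
      have hw := ih (u + 1) d (by omega) h2 (by omega) h4 h5'
      have e : turnsFrom D U u d (U :: w) = turnsFrom D U (u + 1) d w :=
        turnsFrom_replicate_up w d 1 u
      rw [e]
      have hb := turnsFrom_bounds D U w (u + 1) d
      cases hv : turnsFrom D U (u + 1) d w with
      | nil =>
        rw [hv] at hw
        simp only [wordFrom] at hw ⊢
        rw [show n - u = (n - (u + 1)) + 1 by omega, List.replicate_succ, List.cons_append, ← hw]
      | cons v vs =>
        rw [hv] at hw hb
        have := hb v (by simp)
        simp only [wordFrom] at hw ⊢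
        rw [show v.1 - u = (v.1 - (u + 1)) + 1 by omega, List.replicate_succ, List.cons_append, ← hw]
    | D =>
      cases w with
      | nil =>
        simp at h1 h2
        simp [turnsFrom, wordFrom, ← h1, ← h2]
      | cons t w =>
        have h1' : (t :: w).count U = n - u := by
          rwa [List.count_cons_of_ne (by decide)] at h1
        have h2' : (t :: w).count D = n - (d + 1) ∧ d + 1 ≤ n := by
          rw [List.count_cons_self] at h2
          omega
        have hw := ih u (d + 1) h1' h2'.1 h3 h2'.2 h5'
        cases t with
        | D =>
          have e : turnsFrom D U u d (D :: D :: w) = turnsFrom D U u (d + 1) (D :: w) := by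
            simp [turnsFrom]
          rw [e]
          have hb := turnsFrom_bounds D U (D :: w) u (d + 1)
          cases hv : turnsFrom D U u (d + 1) (D :: w) with
          | nil =>
            rw [hv] at hw
            simp only [wordFrom] at hw ⊢
            -- If up steps were left here, the rebuilt word would begin with `U`, whereas the actual
            -- one begins with `D`.
            obtain h0 | ⟨k, h0⟩ : n - u = 0 ∨ ∃ k, n - u = k + 1 := by
              rcases Nat.eq_zero_or_eq_succ_pred (n - u) with h | h
              · exact Or.inl h
              · exact Or.inr ⟨_, h⟩
            · rw [h0] at hw ⊢
              rw [show n - d = (n - (d + 1)) + 1 by omega, List.replicate_succ, hw]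
              rfl
            · rw [h0, List.replicate_succ] at hw
              simp at hw
          | cons v vs =>
            rw [hv] at hw hb
            have hv1 := hb v (by simp)
            simp only [wordFrom] at hw ⊢
            obtain h0 | ⟨k, h0⟩ : v.1 - u = 0 ∨ ∃ k, v.1 - u = k + 1 := by
              rcases Nat.eq_zero_or_eq_succ_pred (v.1 - u) with h | h
              · exact Or.inl h
              · exact Or.inr ⟨_, h⟩
            · rw [h0] at hw ⊢
              rw [show v.2 - d = (v.2 - (d + 1)) + 1 by omega, List.replicate_succ, hw]
              rfl
            · rw [h0, List.replicate_succ] at hw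
              simp at hw
        | U =>
          have e : turnsFrom D U u d (D :: U :: w) =
              (u, d + 1) :: turnsFrom D U u (d + 1) (U :: w) := by
            simp [turnsFrom]
          rw [e, wordFrom, ← hw]
          simp

theorem eq_of_valleys_eq {P Q : DyckWord} (hn : P.semilength = Q.semilength)
    (h : valleys P = valleys Q) : P = Q := by
  have key : ∀ R : DyckWord, R.toList = wordFrom R.semilength 0 0 (valleys R) := by
    intro R
    refine eq_wordFrom _ _ 0 0 rfl R.semilength_eq_count_D.symm (Nat.zero_le _) (Nat.zero_le _) ?_
    intro v hv
    have := getLast_eq_down hv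
    simp at this
  ext1
  rw [key P, key Q, h, hn]

theorem map_fst_zip_map_snd (l : List (ℕ × ℕ)) :
    (l.map Prod.fst).zip (l.map Prod.snd) = l := by
  induction l with
  | nil => rfl
  | cons p l ih => simp [ih]

theorem valleys_eq_zip (P : DyckWord) : valleys P = (ascentCode P).zip (descentCode P) :=
  (map_fst_zip_map_snd _).symm

theorem length_descentCode (P : DyckWord) :
    (descentCode P).length = (ascentCode P).length := by
  rw [descentCode, ascentCode, List.length_map, List.length_map]

theorem strictFrom_zip {n : ℕ} : ∀ {as bs : List ℕ} {u d : ℕ}, as.length = bs.length → u < n →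
    as.Pairwise (· < ·) → bs.Pairwise (· < ·) → (∀ a ∈ as, u < a ∧ a < n) → (∀ b ∈ bs, d < b) →
    StrictFrom n u d (as.zip bs) := by
  intro as
  induction as with
  | nil => intro bs u d _ hu _ _ _ _; exact hu
  | cons a as ih =>
    intro bs u d hl hu h1 h2 h3 h4
    cases bs with
    | nil => simp at hl
    | cons b bs =>
      rw [List.pairwise_cons] at h1 h2
      refine ⟨(h3 a (by simp)).1, h4 b (by simp), ih (by simpa using hl) (h3 a (by simp)).2
        h1.2 h2.2 (fun x hx => ⟨h1.1 x hx, (h3 x (by simp [hx])).2⟩) h2.1⟩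

/-- Between two turns lie the second step of the earlier one and the first step of the later one,
possibly the same step. -/
theorem turnsFrom_strict {s t : DyckStep} (w : List DyckStep) : ∀ u d : ℕ,
    (turnsFrom s t u d w).Pairwise (fun p q => (t = U → p.1 < q.1) ∧ (s = D → p.2 < q.2)) := by
  induction w with
  | nil => simp [turnsFrom]
  | cons a w ih =>
    cases w with
    | nil => simp [turnsFrom]
    | cons b w =>
      intro u d
      simp only [turnsFrom]
      rw [List.pairwise_append]
      refine ⟨by split_ifs <;> simp, ih _ _, ?_⟩
      intro p hp q hq
      rw [eq_of_mem_ite hp]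
      have hbt : b = t := by
        by_contra hne
        rw [if_neg (fun h => hne h.2)] at hp
        simp at hp
      obtain ⟨w₁, w₂, h, rfl⟩ := mem_turnsFrom.1 hq
      constructor
      · rintro rfl
        cases w₁ with
        | nil =>
          simp only [List.nil_append, List.cons.injEq] at h
          simp [← h.1, hbt]
        | cons c w₁ =>
          simp only [List.cons_append, List.cons.injEq] at h
          simp [← h.1, hbt]
      · rintro rfl
        simp

theorem pairwise_ascentCode (P : DyckWord) : (ascentCode P).Pairwise (· < ·) :=
  List.pairwise_map.2 ((turnsFrom_strict P.toList 0 0).imp fun h => h.1 rfl)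

theorem pairwise_descentCode (P : DyckWord) : (descentCode P).Pairwise (· < ·) :=
  List.pairwise_map.2 ((turnsFrom_strict P.toList 0 0).imp fun h => h.2 rfl)

theorem pairwise_doubleAscents (P : DyckWord) :
    ((doubleAscents P).map Prod.fst).Pairwise (· < ·) :=
  List.pairwise_map.2 ((turnsFrom_strict P.toList 0 0).imp fun h => h.1 rfl)

theorem pairwise_doubleDescents (P : DyckWord) :
    ((doubleDescents P).map Prod.snd).Pairwise (· < ·) :=
  List.pairwise_map.2 ((turnsFrom_strict P.toList 0 0).imp fun h => h.2 rfl)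

theorem goodFrom_of_strict {n : ℕ} (as bs : List ℕ) (ha : as.Pairwise (· < ·))
    (hb : bs.Pairwise (· < ·)) (han : ∀ a ∈ as, a < n) (hle : ∀ p ∈ as.zip bs, p.2 ≤ p.1) :
    GoodFrom n 0 0 (as.zip bs) :=
  goodFrom_zip n as bs 0 0 (ha.imp le_of_lt) (hb.imp le_of_lt)
    (fun a h => ⟨Nat.zero_le _, (han a h).le⟩) (fun _ _ => Nat.zero_le _) hle

/-- Strictly increasing codes that stay weakly above the diagonal belong to a Dyck path. -/
theorem exists_path_of_codes {n : ℕ} (hn : 0 < n) {as bs : List ℕ} (hl : as.length = bs.length)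
    (ha : as.Pairwise (· < ·)) (hb : bs.Pairwise (· < ·)) (han : ∀ a ∈ as, 0 < a ∧ a < n)
    (hb0 : ∀ b ∈ bs, 0 < b) (hle : ∀ p ∈ as.zip bs, p.2 ≤ p.1) :
    ∃ P : DyckWord, P.semilength = n ∧ ascentCode P = as ∧ descentCode P = bs := by
  have hg := goodFrom_of_strict as bs ha hb (fun a h => (han a h).2) hle
  obtain ⟨h1, h2⟩ := count_wordFrom n (as.zip bs) 0 0 (Nat.zero_le _) (Nat.zero_le _) hg
  refine ⟨ofWord _ (by rw [h1, h2])
    (staysAbove_wordFrom n (as.zip bs) 0 0 (Nat.zero_le _) le_rfl hg), h1, ?_⟩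
  rw [ascentCode, descentCode, valleys, turns, ofWord,
    turnsFrom_wordFrom (strictFrom_zip hl hn ha hb han hb0)]
  exact ⟨List.map_fst_zip hl.le, List.map_snd_zip hl.ge⟩

/-! ### Irreducible paths and their valleys -/

section Nested

variable {P : DyckWord}

/-- If the prefix ends with `D`, move forward to the next valley, which adds only down steps; if it
ends with `U`, move back to the previous one, which drops only up steps. This extends inequalities
from valleys to all prefixes. -/
theorem exists_valley_of_prefix {w₁ w₂ : List DyckStep} (h : P.toList = w₁ ++ w₂) (h₁ : D ∈ w₁)
    (h₂ : U ∈ w₂) : ∃ p ∈ valleys P, p.1 ≤ w₁.count U ∧ w₁.count D ≤ p.2 := by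
  have key₁ : ∀ w : List DyckStep, D ∈ w → ∃ v k, w = v ++ D :: List.replicate k U := by
    intro w
    induction w using List.reverseRecOn with
    | nil => simp
    | append_singleton w s ih =>
      intro hw
      cases s with
      | D => exact ⟨w, 0, by simp⟩
      | U =>
        obtain ⟨v, k, rfl⟩ := ih (by simpa using hw)
        exact ⟨v, k + 1, by simp [List.replicate_succ']⟩
  have key₂ : ∀ w : List DyckStep, U ∈ w → ∃ v k, w = List.replicate k D ++ U :: v := by
    intro w
    induction w with
    | nil => simp
    | cons s w ih =>
      intro hw
      cases s with
      | U => exact ⟨w, 0, by simp⟩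
      | D =>
        obtain ⟨v, k, rfl⟩ := ih (by simpa using hw)
        exact ⟨v, k + 1, by simp [List.replicate_succ]⟩
  obtain ⟨v₁, i, rfl⟩ := key₁ w₁ h₁
  obtain ⟨v₂, j, rfl⟩ := key₂ w₂ h₂
  simp only [valleys, turns, mem_turnsFrom]
  cases i with
  | zero =>
    refine ⟨_, ⟨v₁ ++ List.replicate j D, v₂, ?_, rfl⟩, ?_, ?_⟩
    · rw [h]
      have : List.replicate j D ++ D :: U :: v₂ = D :: (List.replicate j D ++ U :: v₂) := by
        rw [← List.cons_append, ← List.replicate_succ, List.replicate_succ']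
        simp
      simp [this]
    · simp [List.count_replicate]
    · simp
  | succ i =>
    refine ⟨_, ⟨v₁, List.replicate i U ++ (List.replicate j D ++ U :: v₂), ?_, rfl⟩, ?_, ?_⟩
    · rw [h]
      simp [List.replicate_succ]
    · simp
    · simp [List.count_replicate]

/-- An interior point is at least as high as the valley that `exists_valley_of_prefix` attaches to
it; a point without such a valley lies on the first ascent or the last descent. -/
theorem isNested_iff_valleys (hP : P ≠ 0) : P.IsNested ↔ ∀ p ∈ valleys P, p.2 < p.1 := by
  constructor
  · intro h p hp
    obtain ⟨w₁, w₂, e, rfl⟩ := mem_turnsFrom.1 hp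
    have e' : P.toList = (w₁ ++ [D]) ++ U :: w₂ := by rw [e]; simp
    have := isNested_count_lt h ⟨_, e'.symm⟩ (by simp) (by rw [e']; simp)
    simpa using this
  · intro h
    refine ⟨hP, fun i h0 h1 => ?_⟩
    have e := (List.take_append_drop i P.toList).symm
    have hle := P.count_D_le_count_U i
    by_cases hD : D ∈ P.toList.take i
    · by_cases hU : U ∈ P.toList.drop i
      · obtain ⟨p, hp, h2, h3⟩ := exists_valley_of_prefix e hD hU
        have := h p hp
        omega
      · have h2 := P.count_U_eq_count_D
        rw [e, List.count_append, List.count_append, List.count_eq_zero.2 hU] at h2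
        have h3 : 0 < (P.toList.drop i).count D := by
          cases hd : P.toList.drop i with
          | nil => simp at hd; omega
          | cons s w =>
            rw [hd] at hU
            cases s <;> simp at hU ⊢
        omega
    · rw [List.count_eq_zero.2 hD]
      cases ht : P.toList.take i with
      | nil =>
        have := congrArg List.length ht
        rw [List.length_take, List.length_nil] at this
        omega
      | cons s w =>
        rw [ht] at hD
        cases s <;> simp at hD ⊢

end Nested

/-! ### The order relation on irreducible paths in terms of the codes -/

/-- The lists `A'`, `B'` consist of entries of `A`, `B`, and every entry of `A'` has at least the
position that the corresponding entry of `B'` has. -/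
def CodeLE (A B A' B' : List ℕ) : Prop :=
  ∃ f g : ℕ → ℕ, (∀ i j, i < j → j < A'.length → f i < f j ∧ g i < g j) ∧
    ∀ i < A'.length, f i < A.length ∧ A'[i]? = A[f i]? ∧ B'[i]? = B[g i]? ∧ g i ≤ f i

theorem CodeLE.refl (A B : List ℕ) : CodeLE A B A B :=
  ⟨id, id, fun _ _ h _ => ⟨h, h⟩, fun _ h => ⟨h, rfl, rfl, le_rfl⟩⟩

/-- Index maps compose, and `g (g' i) ≤ g (f' i) ≤ f (f' i)` because `g` is increasing. -/
theorem CodeLE.trans {A B A' B' A'' B'' : List ℕ} (h₁ : CodeLE A B A' B')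
    (h₂ : CodeLE A' B' A'' B'') : CodeLE A B A'' B'' := by
  obtain ⟨f, g, hm, h⟩ := h₁
  obtain ⟨f', g', hm', h'⟩ := h₂
  refine ⟨f ∘ f', g ∘ g', fun i j hij hj => ?_, fun i hi => ?_⟩
  · obtain ⟨e1, -, -, e2⟩ := h' j hj
    exact ⟨(hm _ _ (hm' i j hij hj).1 e1).1, (hm _ _ (hm' i j hij hj).2 (e2.trans_lt e1)).2⟩
  · obtain ⟨e1, e2, e3, e4⟩ := h' i hi
    obtain ⟨a1, a2, -, a4⟩ := h _ e1
    obtain ⟨-, -, b3, -⟩ := h _ (e4.trans_lt e1)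
    refine ⟨a1, e2.trans a2, e3.trans b3, ?_⟩
    rcases e4.eq_or_lt with e | e
    · simp only [Function.comp, e]; exact a4
    · exact (hm _ _ e e1).2.le.trans a4

/-- The index maps skip `i` and `j`; skipping an earlier index gives the larger map. -/
theorem CodeLE.eraseIdx {A B : List ℕ} {i j : ℕ} (hij : i ≤ j) (hl : i < A.length) :
    CodeLE A B (A.eraseIdx i) (B.eraseIdx j) := by
  refine ⟨fun s => if s < i then s else s + 1, fun s => if s < j then s else s + 1, ?_, ?_⟩
  · intro s t hst _
    dsimp only
    split_ifs <;> omega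
  · intro s hs
    rw [List.length_eraseIdx, if_pos hl] at hs
    refine ⟨by dsimp only; split_ifs <;> omega, ?_, ?_, by dsimp only; split_ifs <;> omega⟩
    · rw [List.getElem?_eraseIdx]; dsimp only; split_ifs <;> rfl
    · rw [List.getElem?_eraseIdx]; dsimp only; split_ifs <;> rfl

theorem lt_add_of_increasing {f : ℕ → ℕ} {k : ℕ} (hf : ∀ i j, i < j → j < k → f i < f j) (i : ℕ) :
    ∀ m, i + m < k → f i + m ≤ f (i + m) := by
  intro m
  induction m with
  | zero => intro _; exact le_rfl
  | succ m ih =>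
    intro h
    have h1 := ih (by omega)
    have h2 := hf (i + m) (i + (m + 1)) (by omega) h
    omega

theorem le_of_increasing {f : ℕ → ℕ} {k : ℕ} (hf : ∀ i j, i < j → j < k → f i < f j) {i : ℕ}
    (hi : i < k) : i ≤ f i := by
  have := lt_add_of_increasing hf 0 i (by omega)
  rw [Nat.zero_add] at this
  omega

/-- Equal lengths leave `f` no room, so it is the identity; then `i ≤ g i ≤ f i` makes `g` the
identity as well. -/
theorem CodeLE.eq_of_length_eq {A B A' B' : List ℕ} (h : CodeLE A B A' B')
    (hA : A.length = A'.length) (hB : B.length = B'.length) (hl : B.length = A.length) :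
    A = A' ∧ B = B' := by
  obtain ⟨f, g, hm, h⟩ := h
  have hf : ∀ i < A'.length, f i = i := by
    intro i hi
    have h1 := le_of_increasing (fun i j h h' => (hm i j h h').1) hi
    have h2 := lt_add_of_increasing (fun i j h h' => (hm i j h h').1) i (A'.length - 1 - i) (by omega)
    have h3 := (h (i + (A'.length - 1 - i)) (by omega)).1
    omega
  have hg : ∀ i < A'.length, g i = i := by
    intro i hi
    have h1 := le_of_increasing (fun i j h h' => (hm i j h h').2) hi
    have h2 := (h i hi).2.2.2
    rw [hf i hi] at h2
    omega
  constructor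
  · apply List.ext_getElem?
    intro i
    by_cases hi : i < A'.length
    · rw [(h i hi).2.1, hf i hi]
    · rw [List.getElem?_eq_none (by omega), List.getElem?_eq_none (by omega)]
  · apply List.ext_getElem?
    intro i
    by_cases hi : i < A'.length
    · rw [(h i hi).2.2.1, hg i hi]
    · rw [List.getElem?_eq_none (by omega), List.getElem?_eq_none (by omega)]

/-- The map that remains of `f` when the first index that is not in its range is removed. -/
theorem exists_first_gap {f : ℕ → ℕ} {k : ℕ} (hf : ∀ i j, i < j → j < k → f i < f j) :
    ∃ i₀ ≤ k, (∀ s < i₀, f s = s) ∧ (∀ s, i₀ ≤ s → s < k → s + 1 ≤ f s) := by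
  classical
  -- The alternative `i = k` covers the case of no gap below `k`.
  have hex : ∃ i, f i ≠ i ∨ i = k := ⟨k, Or.inr rfl⟩
  refine ⟨Nat.find hex, Nat.find_min' hex (Or.inr rfl), fun s hs => ?_, fun s h1 h2 => ?_⟩
  · have := Nat.find_min hex hs
    push Not at this
    exact this.1
  · have h0 := (Nat.find_spec hex).resolve_right (by omega)
    have h3 := le_of_increasing hf (i := Nat.find hex) (by omega)
    have h4 := lt_add_of_increasing hf (Nat.find hex) (s - Nat.find hex) (by omega)
    rw [show Nat.find hex + (s - Nat.find hex) = s by omega] at h4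
    omega

/-- Erase the first index missed by `f` and the first missed by `g`. Since `g ≤ f`, the gap of `f`
cannot come later, which is what a cover demands. -/
theorem CodeLE.exists_eraseIdx {A B A' B' : List ℕ} (h : CodeLE A B A' B') :
    ∃ i j, i ≤ j ∧ j ≤ A'.length ∧ CodeLE (A.eraseIdx i) (B.eraseIdx j) A' B' := by
  obtain ⟨f, g, hm, h⟩ := h
  obtain ⟨i, hi, hi1, hi2⟩ := exists_first_gap (fun i j h h' => (hm i j h h').1)
  obtain ⟨j, hj, hj1, hj2⟩ := exists_first_gap (fun i j h h' => (hm i j h h').2)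
  have hij : i ≤ j := by
    by_contra hc
    have h1 := hi1 j (by omega)
    have h2 := hj2 j le_rfl (by omega)
    have h3 := (h j (by omega)).2.2.2
    omega
  refine ⟨i, j, hij, hj, fun s => if s < i then s else f s - 1, fun s => if s < j then s else g s - 1,
    fun s t hst ht => ?_, fun s hs => ?_⟩
  · have h1 := hm s t hst ht
    have h2 := hi2 t
    have h3 := hj2 t
    have h4 := hi2 s
    have h5 := hj2 s
    dsimp only
    constructor
    · split_ifs <;> omega
    · split_ifs <;> omega
  · obtain ⟨h1, h2, h3, h4⟩ := h s hs
    have a1 := hi1 s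
    have a2 := hi2 s
    have b1 := hj1 s
    have b2 := hj2 s
    refine ⟨?_, ?_, ?_, ?_⟩
    · rw [List.length_eraseIdx]
      dsimp only
      split_ifs <;> omega
    · dsimp only
      by_cases hsi : s < i
      · rw [if_pos hsi, List.getElem?_eraseIdx, if_pos hsi, h2, a1 hsi]
      · rw [if_neg hsi, List.getElem?_eraseIdx, if_neg (by omega), h2,
          show f s - 1 + 1 = f s by omega]
    · dsimp only
      by_cases hsj : s < j
      · rw [if_pos hsj, List.getElem?_eraseIdx, if_pos hsj, h3, b1 hsj]
      · rw [if_neg hsj, List.getElem?_eraseIdx, if_neg (by omega), h3,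
          show g s - 1 + 1 = g s by omega]
    · dsimp only
      split_ifs <;> omega

section Covers

variable {P Q : DyckWord}

theorem Covers.codeLE (h : Covers P Q) :
    CodeLE (ascentCode P) (descentCode P) (ascentCode Q) (descentCode Q) := by
  obtain ⟨-, -, -, i, j, hij, hj, h1, h2⟩ := h
  rw [h1, h2]
  rw [length_descentCode] at hj
  exact CodeLE.eraseIdx hij (by omega)

theorem codeLE_of_reflTransGen (h : Relation.ReflTransGen Covers P Q) :
    CodeLE (ascentCode P) (descentCode P) (ascentCode Q) (descentCode Q) := by
  induction h with
  | refl => exact CodeLE.refl _ _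
  | tail _ h ih => exact ih.trans h.codeLE

theorem semilength_eq_of_reflTransGen (h : Relation.ReflTransGen Covers P Q) :
    P.semilength = Q.semilength := by
  induction h with
  | refl => rfl
  | tail _ h ih => exact ih.trans h.2.2.1

theorem eq_of_codes_eq (hn : P.semilength = Q.semilength) (hA : ascentCode P = ascentCode Q)
    (hD : descentCode P = descentCode Q) : P = Q :=
  eq_of_valleys_eq hn (by rw [valleys_eq_zip, valleys_eq_zip, hA, hD])

theorem semilength_ne_zero (hP : P ≠ 0) : P.semilength ≠ 0 := by
  intro h
  have := P.two_mul_semilength_eq_length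
  rw [h] at this
  exact hP (DyckWord.toList_eq_nil.1 (List.length_eq_zero_iff.1 this.symm))

theorem isNested_iff_codes (hP : P ≠ 0) : P.IsNested ↔
    ∀ i (h : i < (ascentCode P).length),
      (descentCode P)[i]'(by rwa [length_descentCode]) < (ascentCode P)[i] := by
  rw [isNested_iff_valleys hP, valleys_eq_zip]
  constructor
  · intro h i hi
    have hi' : i < (descentCode P).length := by rwa [length_descentCode]
    have hz : i < ((ascentCode P).zip (descentCode P)).length := by
      rw [List.length_zip]
      omega
    have := h _ (List.getElem_mem hz)
    rwa [List.getElem_zip] at this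
  · intro h p hp
    obtain ⟨i, hi, rfl⟩ := List.mem_iff_getElem.1 hp
    rw [List.getElem_zip]
    exact h i (by rw [List.length_zip] at hi; omega)

/-- As `i ≤ j`, the ascent entries move up wherever the descent entries do, so corresponding entries
keep their strict inequality and the codes still belong to an irreducible path. -/
theorem exists_covers_of_eraseIdx (hP : P.IsNested) {i j : ℕ} (hij : i ≤ j)
    (hj : j < (ascentCode P).length) : ∃ Q, Covers P Q ∧
      ascentCode Q = (ascentCode P).eraseIdx i ∧ descentCode Q = (descentCode P).eraseIdx j := by
  have hl := length_descentCode P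
  have hi : i < (ascentCode P).length := by omega
  have hc := (isNested_iff_codes hP.1).1 hP
  have hlt : ∀ s (h : s < ((ascentCode P).eraseIdx i).length)
      (h' : s < ((descentCode P).eraseIdx j).length),
      ((descentCode P).eraseIdx j)[s] < ((ascentCode P).eraseIdx i)[s] := by
    intro s h h'
    have hs := h
    rw [List.length_eraseIdx, if_pos hi] at hs
    have hmono : (ascentCode P)[s] < (ascentCode P)[s + 1] :=
      List.pairwise_iff_getElem.1 (pairwise_ascentCode P) _ _ _ _ (Nat.lt_succ_self s)
    have h1 := hc s (by omega)
    have h2 := hc (s + 1) (by omega)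
    rw [List.getElem_eraseIdx, List.getElem_eraseIdx]
    split_ifs <;> omega
  have hlen : ((ascentCode P).eraseIdx i).length = ((descentCode P).eraseIdx j).length := by
    rw [List.length_eraseIdx, List.length_eraseIdx, if_pos hi, if_pos (by omega), hl]
  obtain ⟨Q, h1, h2, h3⟩ := exists_path_of_codes (Nat.pos_of_ne_zero (semilength_ne_zero hP.1)) hlen
    ((pairwise_ascentCode P).sublist (List.eraseIdx_sublist _ _))
    ((pairwise_descentCode P).sublist (List.eraseIdx_sublist _ _))
    (fun a ha => by
      have := mem_ascentCode.1 ((List.eraseIdx_sublist _ _).subset ha)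
      exact ⟨this.1, this.2.1⟩)
    (fun b hb => (mem_descentCode.1 ((List.eraseIdx_sublist _ _).subset hb)).1)
    (fun p hp => by
      obtain ⟨s, hs, rfl⟩ := List.mem_iff_getElem.1 hp
      rw [List.length_zip] at hs
      rw [List.getElem_zip]
      exact (hlt s (by omega) (by omega)).le)
  have hQ0 : Q ≠ 0 := by
    rintro rfl
    exact semilength_ne_zero hP.1 h1.symm
  refine ⟨Q, ⟨hP, (isNested_iff_codes hQ0).2 ?_, h1.symm, i, j, hij, by omega, h2, h3⟩, h2, h3⟩
  intro s hs
  simp only [h2, h3]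
  exact hlt s (by rwa [h2] at hs) (by rw [h2, hlen] at hs; exact hs)

/-- Induction on the number of entries still to be deleted, one cover for each pair of first gaps.
-/
theorem reflTransGen_of_codeLE (hP : P.IsNested) (hn : P.semilength = Q.semilength)
    (h : CodeLE (ascentCode P) (descentCode P) (ascentCode Q) (descentCode Q))
    (hk : (ascentCode Q).length ≤ (ascentCode P).length) :
    Relation.ReflTransGen Covers P Q := by
  have hP' := length_descentCode P
  have hQ' := length_descentCode Q
  obtain ⟨k, hk⟩ := Nat.exists_eq_add_of_le hk
  induction k generalizing P with
  | zero =>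
    obtain ⟨h1, h2⟩ := h.eq_of_length_eq (by omega) (by omega) (by omega)
    rw [eq_of_codes_eq hn h1 h2]
  | succ k ih =>
    obtain ⟨i, j, hij, hj, h'⟩ := h.exists_eraseIdx
    obtain ⟨R, hc, h1, h2⟩ := exists_covers_of_eraseIdx hP hij (by omega)
    have hlen : (ascentCode R).length = (ascentCode Q).length + k := by
      rw [h1, List.length_eraseIdx, if_pos (by omega)]
      omega
    refine Relation.ReflTransGen.head hc
      (ih hc.2.1 (hc.2.2.1.symm.trans hn) (by rwa [h1, h2]) (by omega) (length_descentCode R) hlen)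

end Covers

/-! ### The comparison of codes by counting -/

theorem card_filter_lt_getElem {l : List ℕ} (hl : l.Pairwise (· < ·)) {i : ℕ} (hi : i < l.length) :
    (l.toFinset.filter (· < l[i])).card = i := by
  have : l.toFinset.filter (· < l[i]) = (l.take i).toFinset := by
    ext x
    simp only [Finset.mem_filter, List.mem_toFinset, List.mem_take_iff_getElem]
    constructor
    · rintro ⟨hx, hlt⟩
      obtain ⟨j, hj, rfl⟩ := List.mem_iff_getElem.1 hx
      refine ⟨j, ?_, rfl⟩
      by_contra hc
      rcases (show i ≤ j by omega).eq_or_lt with rfl | hij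
      · omega
      · have := List.pairwise_iff_getElem.1 hl i j hi hj hij
        omega
    · rintro ⟨j, hj, rfl⟩
      exact ⟨List.getElem_mem _, List.pairwise_iff_getElem.1 hl j i (by omega) hi (by omega)⟩
  rw [this, List.toFinset_card_of_nodup ((hl.imp ne_of_lt).sublist (List.take_sublist _ _)),
    List.length_take]
  omega

/-- In a strictly increasing list the position of an entry is the number of smaller entries. The
index maps are therefore forced, and comparing them is counting. -/
theorem codeLE_iff {A B A' B' : List ℕ} (hA : A.Pairwise (· < ·)) (hB : B.Pairwise (· < ·))
    (hA' : A'.Pairwise (· < ·)) (hB' : B'.Pairwise (· < ·)) (hl : B.length = A.length)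
    (hl' : B'.length = A'.length) :
    CodeLE A B A' B' ↔ A' ⊆ A ∧ B' ⊆ B ∧ ∀ p ∈ A'.zip B',
      (B.toFinset.filter (· < p.2)).card ≤ (A.toFinset.filter (· < p.1)).card := by
  constructor
  · rintro ⟨f, g, hm, h⟩
    have hf : ∀ i (hi : i < A'.length), ∃ h : f i < A.length, A'[i] = A[f i] := by
      intro i hi
      obtain ⟨h1, h2, -, -⟩ := h i hi
      refine ⟨h1, ?_⟩
      rw [List.getElem?_eq_getElem hi, List.getElem?_eq_getElem h1] at h2
      exact Option.some.inj h2
    have hg : ∀ i (hi : i < B'.length), ∃ h : g i < B.length, B'[i] = B[g i] := by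
      intro i hi
      obtain ⟨h1, -, h2, h3⟩ := h i (by omega)
      refine ⟨by omega, ?_⟩
      rw [List.getElem?_eq_getElem hi, List.getElem?_eq_getElem (by omega)] at h2
      exact Option.some.inj h2
    refine ⟨?_, ?_, ?_⟩
    · intro x hx
      obtain ⟨i, hi, rfl⟩ := List.mem_iff_getElem.1 hx
      obtain ⟨h1, h2⟩ := hf i hi
      rw [h2]
      exact List.getElem_mem _
    · intro x hx
      obtain ⟨i, hi, rfl⟩ := List.mem_iff_getElem.1 hx
      obtain ⟨h1, h2⟩ := hg i hi
      rw [h2]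
      exact List.getElem_mem _
    · intro p hp
      obtain ⟨i, hi, rfl⟩ := List.mem_iff_getElem.1 hp
      rw [List.length_zip] at hi
      obtain ⟨h1, h2⟩ := hf i (by omega)
      obtain ⟨h3, h4⟩ := hg i (by omega)
      rw [List.getElem_zip]
      simp only [h2, h4]
      rw [card_filter_lt_getElem hA, card_filter_lt_getElem hB]
      exact (h i (by omega)).2.2.2
  · rintro ⟨h1, h2, h3⟩
    have hidx : ∀ {l l' : List ℕ}, l.Pairwise (· < ·) → l'.Pairwise (· < ·) → l' ⊆ l →
        (∀ i (hi : i < l'.length), ∃ h : l.idxOf (l'.getD i 0) < l.length,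
          l'[i] = l[l.idxOf (l'.getD i 0)]) ∧
        ∀ i j, i < j → j < l'.length → l.idxOf (l'.getD i 0) < l.idxOf (l'.getD j 0) := by
      intro l l' hl hl' hs
      have key : ∀ i (hi : i < l'.length), ∃ h : l.idxOf (l'.getD i 0) < l.length,
          l'[i] = l[l.idxOf (l'.getD i 0)] := by
        intro i hi
        rw [List.getD_eq_getElem _ _ hi]
        have := List.idxOf_lt_length_iff.2 (hs (List.getElem_mem hi))
        exact ⟨this, (List.getElem_idxOf this).symm⟩
      refine ⟨key, fun i j hij hj => ?_⟩
      obtain ⟨a1, a2⟩ := key i (by omega)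
      obtain ⟨b1, b2⟩ := key j hj
      have hlt := List.pairwise_iff_getElem.1 hl' i j (by omega) hj hij
      by_contra hc
      rcases (not_lt.1 hc).eq_or_lt with e | e
      · simp only [e] at b2
        omega
      · have := List.pairwise_iff_getElem.1 hl _ _ b1 a1 e
        omega
    obtain ⟨ka, ma⟩ := hidx hA hA' h1
    obtain ⟨kb, mb⟩ := hidx hB hB' h2
    refine ⟨fun i => A.idxOf (A'.getD i 0), fun i => B.idxOf (B'.getD i 0),
      fun i j hij hj => ⟨ma i j hij hj, mb i j hij (by omega)⟩, fun i hi => ?_⟩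
    obtain ⟨a1, a2⟩ := ka i hi
    obtain ⟨b1, b2⟩ := kb i (by omega)
    refine ⟨a1, ?_, ?_, ?_⟩
    · rw [List.getElem?_eq_getElem hi, List.getElem?_eq_getElem a1, a2]
    · rw [List.getElem?_eq_getElem (by omega), List.getElem?_eq_getElem b1, b2]
    · have := h3 (A'[i], B'[i]) (by
        rw [List.mem_iff_getElem]
        exact ⟨i, by rw [List.length_zip]; omega, List.getElem_zip⟩)
      simp only [a2, b2] at this
      rwa [card_filter_lt_getElem hA, card_filter_lt_getElem hB] at this

/-! ### The peaks of the Kreweras images -/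

section Kreweras

variable {P F : DyckWord} {a : ℕ}

theorem mem_doubleDescents : a ∈ (doubleDescents P).map Prod.snd ↔
    a < P.semilength ∧ a ∉ peakDowns P := by
  rw [mem_peakDowns_iff_notMem]
  constructor
  · intro h
    refine ⟨?_, fun hc => hc.2 h⟩
    obtain ⟨p, hp, rfl⟩ := List.mem_map.1 h
    have := snd_lt_of_mem_doubleDescents P.toList 0 0 p hp
    rwa [Nat.zero_add, ← P.semilength_eq_count_D] at this
  · rintro ⟨h1, h2⟩
    by_contra hc
    exact h2 ⟨h1, hc⟩

theorem succ_mem_doubleAscents : a + 1 ∈ (doubleAscents P).map Prod.fst ↔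
    a < P.semilength ∧ a ∉ peakUps P := by
  rw [mem_peakUps_iff_notMem]
  constructor
  · intro h
    refine ⟨?_, fun hc => hc.2 h⟩
    obtain ⟨w₁, w₂, e, h⟩ := mem_map_fst_turns.1 h
    rw [DyckWord.semilength, e]
    simp [List.count_append] at h ⊢
    omega
  · rintro ⟨h1, h2⟩
    by_contra hc
    exact h2 ⟨h1, hc⟩

theorem zero_notMem_doubleAscents : 0 ∉ (doubleAscents P).map Prod.fst := by
  intro h
  obtain ⟨w₁, w₂, e, h⟩ := mem_map_fst_turns.1 h
  simp at h

theorem zero_mem_peakDowns (hP : P ≠ 0) : 0 ∈ peakDowns P :=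
  (mem_peakDowns_iff_code hP).2 (Or.inl rfl)

/-- Either length is the semilength minus the number of peaks. -/
theorem length_doubleDescents_eq :
    ((doubleDescents P).map Prod.snd).length = ((doubleAscents P).map Prod.fst).length := by
  have h1 : ((doubleDescents P).map Prod.snd).toFinset = Finset.range P.semilength \ peakDowns P := by
    ext a
    rw [List.mem_toFinset, mem_doubleDescents, Finset.mem_sdiff, Finset.mem_range]
  have h2 : ((doubleAscents P).map Prod.fst).toFinset =
      (Finset.range P.semilength \ peakUps P).image (· + 1) := by
    ext a
    rw [List.mem_toFinset, Finset.mem_image]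
    constructor
    · intro h
      cases a with
      | zero => exact absurd h zero_notMem_doubleAscents
      | succ a =>
        rw [succ_mem_doubleAscents] at h
        exact ⟨a, by rwa [Finset.mem_sdiff, Finset.mem_range], rfl⟩
    · rintro ⟨b, hb, rfl⟩
      rwa [Finset.mem_sdiff, Finset.mem_range, ← succ_mem_doubleAscents] at hb
  rw [← List.toFinset_card_of_nodup ((pairwise_doubleDescents P).imp ne_of_lt),
    ← List.toFinset_card_of_nodup ((pairwise_doubleAscents P).imp ne_of_lt), h1, h2,
    Finset.card_image_of_injective _ (add_left_injective 1), Finset.card_sdiff_of_subset,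
    Finset.card_sdiff_of_subset, card_peakUps]
  · exact fun x hx => Finset.mem_range.2 (lt_of_mem_peakUps hx)
  · exact fun x hx => Finset.mem_range.2 (lt_of_mem_peakDowns hx)

theorem pos_of_mem_doubleDescents (hP : P ≠ 0) (h : a ∈ (doubleDescents P).map Prod.snd) :
    0 < a := by
  rw [mem_doubleDescents] at h
  by_contra hc
  exact h.2 (by rw [show a = 0 by omega]; exact zero_mem_peakDowns hP)

/-- The two lists of `markedPoints` have equal length, so zipping loses nothing, and they increase
strictly, so every marked point is indeed a valley. -/
theorem codes_kreweras (hP : P ≠ 0) : ascentCode (kreweras P) = (doubleDescents P).map Prod.snd ∧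
    descentCode (kreweras P) = (doubleAscents P).map Prod.fst := by
  have hz : valleys (kreweras P) = markedPoints P := by
    rw [valleys, turns, kreweras, ofWord]
    refine turnsFrom_wordFrom (strictFrom_zip length_doubleDescents_eq
      (Nat.pos_of_ne_zero (semilength_ne_zero hP)) (pairwise_doubleDescents P)
      (pairwise_doubleAscents P)
      (fun a h => ⟨pos_of_mem_doubleDescents hP h, (mem_doubleDescents.1 h).1⟩)
      fun b hb => Nat.pos_of_ne_zero ?_)
    rintro rfl
    exact zero_notMem_doubleAscents hb
  rw [ascentCode, descentCode, hz, markedPoints]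
  exact ⟨List.map_fst_zip length_doubleDescents_eq.le, List.map_snd_zip length_doubleDescents_eq.ge⟩

theorem semilength_kreweras (P : DyckWord) : (kreweras P).semilength = P.semilength :=
  (count_wordFrom P.semilength (markedPoints P) 0 0 (Nat.zero_le _)
        (Nat.zero_le _) (goodFrom_markedPoints P)).1

theorem ne_zero_of_semilength_eq {Q : DyckWord} (hP : P ≠ 0) (h : Q.semilength = P.semilength) :
    Q ≠ 0 := by
  rintro rfl
  exact semilength_ne_zero hP h.symm

theorem kreweras_ne_zero (hP : P ≠ 0) : kreweras P ≠ 0 :=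
  ne_zero_of_semilength_eq hP (semilength_kreweras P)

/-- The ascent code of `L(F)` lists the down steps of `F` outside its peaks, and nesting absorbs the
shift by one between codes and up indices. For `F = 0` the rule fails: both sets of peaks are `{0}`.
-/
theorem mem_peakUps_nest_kreweras (hF : F ≠ 0) : a ∈ peakUps (kreweras F).nest ↔
    a < F.nest.semilength ∧ a ∉ peakDowns F.nest := by
  rw [mem_peakUps_nest (kreweras_ne_zero hF), peakDowns_nest hF, DyckWord.semilength_nest]
  simp only [mem_peakUps_iff_code, (codes_kreweras hF).1, semilength_kreweras, mem_doubleDescents]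
  constructor
  · rintro ⟨b, h | h, rfl⟩
    · exact ⟨by omega, fun hc => by have := lt_of_mem_peakDowns hc; omega⟩
    · exact ⟨by omega, h.2⟩
  · rintro ⟨h1, h2⟩
    have h0 : a ≠ 0 := by
      rintro rfl
      exact h2 (zero_mem_peakDowns hF)
    refine ⟨a - 1, ?_, by omega⟩
    rw [show a - 1 + 1 = a by omega]
    by_cases h : a = F.semilength
    · exact Or.inl h
    · exact Or.inr ⟨by omega, h2⟩

theorem mem_peakDowns_nest_kreweras (hF : F ≠ 0) : a ∈ peakDowns (kreweras F).nest ↔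
    a < F.nest.semilength ∧ a ∉ peakUps F.nest := by
  rw [peakDowns_nest (kreweras_ne_zero hF), mem_peakUps_nest hF, DyckWord.semilength_nest,
    mem_peakDowns_iff_code (kreweras_ne_zero hF), (codes_kreweras hF).2]
  cases a with
  | zero => simp
  | succ a => simp [succ_mem_doubleAscents]

end Kreweras

/-! ### The order relation on irreducible paths in terms of the peaks -/

section Order

variable {P K : DyckWord}

theorem ascentCode_subset_iff (hn : K.semilength = P.semilength) :
    ascentCode P ⊆ ascentCode K ↔ peakUps P ⊆ peakUps K := by
  constructor
  · intro h a ha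
    rw [mem_peakUps_iff_code] at ha ⊢
    rcases ha with ha | ha
    · exact Or.inl (by omega)
    · exact Or.inr (h ha)
  · intro h a ha
    have h1 := mem_ascentCode.1 ha
    have h2 := h (mem_peakUps_iff_code.2 (Or.inr (by rwa [show a - 1 + 1 = a by omega])))
    rw [mem_peakUps_iff_code, show a - 1 + 1 = a by omega] at h2
    exact h2.resolve_left (by omega)

theorem descentCode_subset_iff (hP : P ≠ 0) (hK : K ≠ 0) :
    descentCode P ⊆ descentCode K ↔ peakDowns P ⊆ peakDowns K := by
  constructor
  · intro h a ha
    rw [mem_peakDowns_iff_code hP] at ha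
    rw [mem_peakDowns_iff_code hK]
    exact ha.imp_right (fun ha => h ha)
  · intro h a ha
    have h1 := mem_descentCode.1 ha
    have h2 := h ((mem_peakDowns_iff_code hP).2 (Or.inr ha))
    rw [mem_peakDowns_iff_code hK] at h2
    exact h2.resolve_left (by omega)

theorem card_filter_codes_eq {p : ℕ × ℕ} (hp : p ∈ valleys P) :
    ((ascentCode P).toFinset.filter (· < p.1)).card =
      ((descentCode P).toFinset.filter (· < p.2)).card := by
  rw [valleys_eq_zip] at hp
  obtain ⟨i, hi, rfl⟩ := List.mem_iff_getElem.1 hp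
  rw [List.length_zip] at hi
  rw [List.getElem_zip]
  simp only
  rw [card_filter_lt_getElem (pairwise_ascentCode P) (by omega),
    card_filter_lt_getElem (pairwise_descentCode P) (by omega)]

theorem card_filter_ascentCode (hn : K.semilength = P.semilength)
    (hs : ascentCode P ⊆ ascentCode K) {u : ℕ} (hu : u ∈ ascentCode P) :
    ((ascentCode K).toFinset.filter (· < u)).card = ((ascentCode P).toFinset.filter (· < u)).card +
      ((Finset.range u).filter fun x => x ∈ peakUps K ∧ x ∉ peakUps P).card := by
  have e : ((Finset.range u).filter fun x => x ∈ peakUps K ∧ x ∉ peakUps P).image (· + 1) =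
      ((ascentCode K).toFinset.filter (· < u)) \ ((ascentCode P).toFinset.filter (· < u)) := by
    ext a
    simp only [Finset.mem_image, Finset.mem_filter, Finset.mem_range, mem_peakUps_iff_code,
      Finset.mem_sdiff, List.mem_toFinset]
    constructor
    · rintro ⟨x, ⟨h1, h2, h3⟩, rfl⟩
      push Not at h3
      have h4 := h2.resolve_left (by omega)
      -- The index `u - 1` is a peak of `P`, so it is not counted, and `x < u` amounts to `x + 1 <
      -- u`.
      have : x + 1 ≠ u := fun h => h3.2 (h ▸ hu)
      exact ⟨⟨h4, by omega⟩, fun h => h3.2 h.1⟩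
    · rintro ⟨⟨h1, h2⟩, h3⟩
      have h4 := mem_ascentCode.1 h1
      refine ⟨a - 1, ?_, by omega⟩
      rw [show a - 1 + 1 = a by omega]
      exact ⟨by omega, Or.inr h1, fun h => h3 ⟨h.resolve_left (by omega), h2⟩⟩
  rw [← Finset.card_image_of_injective ((Finset.range u).filter _) (add_left_injective 1), e,
    Nat.add_comm, Finset.card_sdiff_add_card_eq_card]
  exact Finset.filter_subset_filter _ fun x hx => by
    rw [List.mem_toFinset] at hx ⊢
    exact hs hx

theorem card_filter_descentCode (hP : P ≠ 0) (hK : K ≠ 0)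
    (hs : descentCode P ⊆ descentCode K) (d : ℕ) :
    ((descentCode K).toFinset.filter (· < d)).card = ((descentCode P).toFinset.filter (· < d)).card +
      ((Finset.range d).filter fun x => x ∈ peakDowns K ∧ x ∉ peakDowns P).card := by
  have e : ((Finset.range d).filter fun x => x ∈ peakDowns K ∧ x ∉ peakDowns P) =
      ((descentCode K).toFinset.filter (· < d)) \ ((descentCode P).toFinset.filter (· < d)) := by
    ext a
    simp only [Finset.mem_filter, Finset.mem_range, mem_peakDowns_iff_code hP,
      mem_peakDowns_iff_code hK, Finset.mem_sdiff, List.mem_toFinset]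
    constructor
    · rintro ⟨h1, h2, h3⟩
      push Not at h3
      exact ⟨⟨h2.resolve_left h3.1, h1⟩, fun h => h3.2 h.1⟩
    · rintro ⟨⟨h1, h2⟩, h3⟩
      have h4 := mem_descentCode.1 h1
      exact ⟨h2, Or.inr h1, fun h => h3 ⟨h.resolve_left (by omega), h2⟩⟩
  rw [e, Nat.add_comm, Finset.card_sdiff_add_card_eq_card]
  exact Finset.filter_subset_filter _ fun x hx => by
    rw [List.mem_toFinset] at hx ⊢
    exact hs hx

/-- At a valley of `P`, equally many entries of both codes of `P` are smaller. They cancel from the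
counts for `K` and leave the deleted entries. Monotonicity of the counts carries the inequality from
valleys to all prefixes. -/
theorem reflTransGen_covers_iff (hK : K.IsNested) (hP : P.IsNested)
    (hn : K.semilength = P.semilength) :
    Relation.ReflTransGen Covers K P ↔ peakUps P ⊆ peakUps K ∧ peakDowns P ⊆ peakDowns K ∧
      ∀ w, w <+: P.toList →
        ((Finset.range (w.count D)).filter fun x => x ∈ peakDowns K ∧ x ∉ peakDowns P).card ≤
        ((Finset.range (w.count U)).filter fun x => x ∈ peakUps K ∧ x ∉ peakUps P).card := by
  have hiff : Relation.ReflTransGen Covers K P ↔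
      CodeLE (ascentCode K) (descentCode K) (ascentCode P) (descentCode P) := by
    refine ⟨codeLE_of_reflTransGen, fun h => reflTransGen_of_codeLE hK hn h ?_⟩
    have hs := ((codeLE_iff (pairwise_ascentCode K) (pairwise_descentCode K) (pairwise_ascentCode P)
      (pairwise_descentCode P) (length_descentCode K) (length_descentCode P)).1 h).1
    exact (List.subperm_of_subset ((pairwise_ascentCode P).imp ne_of_lt) hs).length_le
  rw [hiff, codeLE_iff (pairwise_ascentCode K) (pairwise_descentCode K) (pairwise_ascentCode P)
    (pairwise_descentCode P) (length_descentCode K) (length_descentCode P), ← valleys_eq_zip,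
    ascentCode_subset_iff hn, descentCode_subset_iff hP.1 hK.1]
  refine and_congr_right fun hU => and_congr_right fun hD => ?_
  have hU' := (ascentCode_subset_iff hn).2 hU
  have hD' := (descentCode_subset_iff hP.1 hK.1).2 hD
  have hval : ∀ p ∈ valleys P,
      (((descentCode K).toFinset.filter (· < p.2)).card ≤
        ((ascentCode K).toFinset.filter (· < p.1)).card ↔
      ((Finset.range p.2).filter fun x => x ∈ peakDowns K ∧ x ∉ peakDowns P).card ≤
        ((Finset.range p.1).filter fun x => x ∈ peakUps K ∧ x ∉ peakUps P).card) := by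
    intro p hp
    rw [card_filter_descentCode hP.1 hK.1 hD',
      card_filter_ascentCode hn hU' (List.mem_map_of_mem hp), card_filter_codes_eq hp]
    omega
  have hmono : ∀ (p : ℕ → Prop) [DecidablePred p] {m n : ℕ}, m ≤ n →
      ((Finset.range m).filter p).card ≤ ((Finset.range n).filter p).card := fun p _ m n h =>
    Finset.card_le_card (Finset.filter_subset_filter _ (Finset.range_mono h))
  constructor
  · rintro h w ⟨v, e⟩
    by_cases h1 : D ∈ w
    · by_cases h2 : U ∈ v
      · obtain ⟨p, hp, h3, h4⟩ := exists_valley_of_prefix e.symm h1 h2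
        exact (hmono _ h4).trans (((hval p hp).1 (h p hp)).trans (hmono _ h3))
      -- After the last up step every deleted ascent entry is counted, and both codes lose equally
      -- many entries.
      · have h3 : w.count U = P.semilength := by
          rw [DyckWord.semilength, ← e, List.count_append, List.count_eq_zero.2 h2, Nat.add_zero]
        have h4 : (Finset.range (w.count U)).filter (fun x => x ∈ peakUps K ∧ x ∉ peakUps P) =
            peakUps K \ peakUps P := by
          ext x
          rw [h3, Finset.mem_filter, Finset.mem_sdiff, Finset.mem_range]
          exact ⟨fun h => h.2, fun h => ⟨hn ▸ lt_of_mem_peakUps h.1, h⟩⟩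
        rw [h4, Finset.card_sdiff_of_subset hU, card_peakUps, card_peakUps,
          ← Finset.card_sdiff_of_subset hD]
        refine Finset.card_le_card fun x hx => ?_
        rw [Finset.mem_filter] at hx
        exact Finset.mem_sdiff.2 hx.2
    · rw [List.count_eq_zero.2 h1]
      simp
  · intro h p hp
    rw [hval p hp]
    obtain ⟨w₁, w₂, e, rfl⟩ := mem_turnsFrom.1 hp
    simpa using h (w₁ ++ [D]) ⟨U :: w₂, by rw [e]; simp⟩

end Order

/-! ### Compatible pairs of paths -/

/-- The number of down steps among the first `d` that do not belong to a peak of `P` and whose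
index is not that of an up step in a peak of `F`. -/
def freeDowns (P F : DyckWord) (d : ℕ) : ℕ :=
  ((Finset.range d).filter fun y => y ∉ peakUps F ∧ y ∉ peakDowns P).card

/-- The number of up steps among the first `u` that do not belong to a peak of `P` and whose
index is not that of a down step in a peak of `F`. -/
def freeUps (P F : DyckWord) (u : ℕ) : ℕ :=
  ((Finset.range u).filter fun x => x ∉ peakDowns F ∧ x ∉ peakUps P).card

/-- The condition that describes the relation `L'(Q) ≤ P` in terms of the peaks of `P` and of the
flipped path `F` of `Q`. -/
structure Compat (P F : DyckWord) : Prop where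
  ret : ∀ r, Ret P r ↔ Ret F r
  ups : ∀ a ∈ peakUps P, a ∈ peakDowns F → Ret P a ∧ Ret P (a + 1)
  downs : ∀ a ∈ peakDowns P, a ∈ peakUps F → Ret P a ∧ Ret P (a + 1)
  free_le : ∀ w, w <+: P.toList → freeDowns P F (w.count D) ≤ freeUps P F (w.count U)

section Compat

variable {P F P₁ P₂ F₁ F₂ : DyckWord}

theorem semilength_eq_of_ret (h : ∀ r, Ret P r ↔ Ret F r) : P.semilength = F.semilength :=
  le_antisymm ((h _).1 ret_semilength).le ((h _).2 ret_semilength).le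

/-- Inclusion and exclusion: each path has as many up indices as down indices of peaks, and both
overlaps consist of the common components `UD`. -/
theorem freeDowns_eq_freeUps (hr : ∀ r, Ret P r ↔ Ret F r)
    (hu : ∀ a ∈ peakUps P, a ∈ peakDowns F → Ret P a ∧ Ret P (a + 1))
    (hd : ∀ a ∈ peakDowns P, a ∈ peakUps F → Ret P a ∧ Ret P (a + 1)) :
    freeDowns P F P.semilength = freeUps P F P.semilength := by
  have hn := semilength_eq_of_ret hr
  have key : ∀ A B : Finset ℕ, (∀ x ∈ A, x < P.semilength) → (∀ x ∈ B, x < P.semilength) →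
      ((Finset.range P.semilength).filter fun y => y ∉ A ∧ y ∉ B).card + A.card + B.card =
        P.semilength + (A ∩ B).card := by
    intro A B hA hB
    have h1 : (Finset.range P.semilength).filter (fun y => y ∉ A ∧ y ∉ B) =
        Finset.range P.semilength \ (A ∪ B) := by
      ext x
      simp
    have h2 : A ∪ B ⊆ Finset.range P.semilength := by
      intro x hx
      rw [Finset.mem_range]
      rcases Finset.mem_union.1 hx with h | h
      · exact hA x h
      · exact hB x h
    have h3 := Finset.card_sdiff_add_card_eq_card h2
    have h4 := Finset.card_union_add_card_inter A B
    rw [Finset.card_range] at h3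
    rw [h1]
    omega
  have h1 := key (peakUps F) (peakDowns P) (fun x hx => hn ▸ lt_of_mem_peakUps hx)
    fun x hx => lt_of_mem_peakDowns hx
  have h2 := key (peakDowns F) (peakUps P) (fun x hx => hn ▸ lt_of_mem_peakDowns hx)
    fun x hx => lt_of_mem_peakUps hx
  have h3 : peakUps F ∩ peakDowns P = peakDowns F ∩ peakUps P := by
    ext x
    rw [Finset.mem_inter, Finset.mem_inter]
    constructor
    · rintro ⟨h, h'⟩
      obtain ⟨a, b⟩ := hd x h' h
      exact ⟨mem_peakDowns_of_ret ((hr _).1 a) ((hr _).1 b), mem_peakUps_of_ret a b⟩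
    · rintro ⟨h, h'⟩
      obtain ⟨a, b⟩ := hu x h' h
      exact ⟨mem_peakUps_of_ret ((hr _).1 a) ((hr _).1 b), mem_peakDowns_of_ret a b⟩
  have h4 := card_peakUps (P := P)
  have h5 := card_peakUps (P := F)
  rw [h3] at h1
  rw [freeDowns, freeUps]
  omega

/-! ### Compatibility of concatenations -/

theorem mem_peakUps_add_left {a : ℕ} (ha : a < P₁.semilength) :
    a ∈ peakUps (P₁ + P₂) ↔ a ∈ peakUps P₁ := by
  rw [mem_peakUps_add]
  exact ⟨fun h => h.resolve_right fun ⟨b, _, h⟩ => by omega, Or.inl⟩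

theorem mem_peakDowns_add_left {a : ℕ} (ha : a < P₁.semilength) :
    a ∈ peakDowns (P₁ + P₂) ↔ a ∈ peakDowns P₁ := by
  rw [mem_peakDowns_add]
  exact ⟨fun h => h.resolve_right fun ⟨b, _, h⟩ => by omega, Or.inl⟩

theorem mem_peakUps_add_right {a : ℕ} :
    P₁.semilength + a ∈ peakUps (P₁ + P₂) ↔ a ∈ peakUps P₂ := by
  rw [mem_peakUps_add]
  constructor
  · rintro (h | ⟨b, hb, h⟩)
    · have := lt_of_mem_peakUps h
      omega
    · rwa [Nat.add_left_cancel h]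
  · exact fun h => Or.inr ⟨a, h, rfl⟩

theorem mem_peakDowns_add_right {a : ℕ} :
    P₁.semilength + a ∈ peakDowns (P₁ + P₂) ↔ a ∈ peakDowns P₂ := by
  rw [mem_peakDowns_add]
  constructor
  · rintro (h | ⟨b, hb, h⟩)
    · have := lt_of_mem_peakDowns h
      omega
    · rwa [Nat.add_left_cancel h]
  · exact fun h => Or.inr ⟨a, h, rfl⟩

theorem ret_add_left {r : ℕ} (hr : r ≤ P₁.semilength) : Ret (P₁ + P₂) r ↔ Ret P₁ r := by
  rw [ret_add]
  refine ⟨fun h => ?_, Or.inl⟩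
  rcases h with h | ⟨b, _, h⟩
  · exact h
  · rw [show r = P₁.semilength by omega]
    exact ret_semilength

theorem ret_add_right {r : ℕ} : Ret (P₁ + P₂) (P₁.semilength + r) ↔ Ret P₂ r := by
  rw [ret_add]
  constructor
  · rintro (h | ⟨b, hb, h⟩)
    · have := h.le
      rw [show r = 0 by omega]
      exact ret_zero
    · rwa [Nat.add_left_cancel h]
  · exact fun h => Or.inr ⟨r, h, rfl⟩

theorem card_filter_range_add (p : ℕ → Prop) [DecidablePred p] (m n : ℕ) :
    ((Finset.range (m + n)).filter p).card =
      ((Finset.range m).filter p).card + ((Finset.range n).filter fun x => p (m + x)).card := by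
  simp only [← Nat.count_eq_card_filter_range]
  exact Nat.count_add p m n

theorem freeDowns_add_left (hn : P₁.semilength = F₁.semilength) {d : ℕ} (hd : d ≤ P₁.semilength) :
    freeDowns (P₁ + P₂) (F₁ + F₂) d = freeDowns P₁ F₁ d := by
  rw [freeDowns, freeDowns]
  congr 1
  refine Finset.filter_congr fun x hx => ?_
  rw [Finset.mem_range] at hx
  rw [mem_peakUps_add_left (by omega), mem_peakDowns_add_left (by omega)]

theorem freeUps_add_left (hn : P₁.semilength = F₁.semilength) {u : ℕ} (hu : u ≤ P₁.semilength) :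
    freeUps (P₁ + P₂) (F₁ + F₂) u = freeUps P₁ F₁ u := by
  rw [freeUps, freeUps]
  congr 1
  refine Finset.filter_congr fun x hx => ?_
  rw [Finset.mem_range] at hx
  rw [mem_peakUps_add_left (by omega), mem_peakDowns_add_left (by omega)]

theorem freeDowns_add_right (hn : P₁.semilength = F₁.semilength) (d : ℕ) :
    freeDowns (P₁ + P₂) (F₁ + F₂) (P₁.semilength + d) =
      freeDowns P₁ F₁ P₁.semilength + freeDowns P₂ F₂ d := by
  rw [← freeDowns_add_left (P₂ := P₂) (F₂ := F₂) hn le_rfl]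
  simp only [freeDowns]
  rw [card_filter_range_add]
  congr 2
  refine Finset.filter_congr fun x _ => ?_
  rw [mem_peakDowns_add_right]
  rw [hn, mem_peakUps_add_right]

theorem freeUps_add_right (hn : P₁.semilength = F₁.semilength) (u : ℕ) :
    freeUps (P₁ + P₂) (F₁ + F₂) (P₁.semilength + u) =
      freeUps P₁ F₁ P₁.semilength + freeUps P₂ F₂ u := by
  rw [← freeUps_add_left (P₂ := P₂) (F₂ := F₂) hn le_rfl]
  simp only [freeUps]
  rw [card_filter_range_add]
  congr 2
  refine Finset.filter_congr fun x _ => ?_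
  rw [mem_peakUps_add_right]
  rw [hn, mem_peakDowns_add_right]

/-- On a prefix that reaches the second summand, both counts contain the totals of the first, which
cancel by `freeDowns_eq_freeUps`. -/
theorem compat_add_iff (hn : P₁.semilength = F₁.semilength) :
    Compat (P₁ + P₂) (F₁ + F₂) ↔ Compat P₁ F₁ ∧ Compat P₂ F₂ := by
  constructor
  · intro h
    have hr : ∀ r, Ret P₁ r ↔ Ret F₁ r := by
      intro r
      by_cases hr : r ≤ P₁.semilength
      · rw [← ret_add_left (P₂ := P₂) hr, ← ret_add_left (P₁ := F₁) (P₂ := F₂) (by omega)]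
        exact h.ret r
      · exact ⟨fun h => absurd h.le hr, fun h => absurd (hn ▸ h.le) hr⟩
    have hu : ∀ a ∈ peakUps P₁, a ∈ peakDowns F₁ → Ret P₁ a ∧ Ret P₁ (a + 1) := by
      intro a h1 h2
      have h0 := lt_of_mem_peakUps h1
      rw [← ret_add_left (P₂ := P₂) h0, ← ret_add_left (P₂ := P₂) h0.le]
      exact h.ups a (mem_peakUps_add.2 (Or.inl h1)) (mem_peakDowns_add.2 (Or.inl h2))
    have hd : ∀ a ∈ peakDowns P₁, a ∈ peakUps F₁ → Ret P₁ a ∧ Ret P₁ (a + 1) := by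
      intro a h1 h2
      have h0 := lt_of_mem_peakDowns h1
      rw [← ret_add_left (P₂ := P₂) h0, ← ret_add_left (P₂ := P₂) h0.le]
      exact h.downs a (mem_peakDowns_add.2 (Or.inl h1)) (mem_peakUps_add.2 (Or.inl h2))
    refine ⟨⟨hr, hu, hd, fun w hw => ?_⟩, ⟨fun r => ?_, fun a h1 h2 => ?_, fun a h1 h2 => ?_,
      fun w hw => ?_⟩⟩
    · have h1 := count_le_semilength P₁ hw
      rw [← freeDowns_add_left (P₂ := P₂) (F₂ := F₂) hn h1.2,
        ← freeUps_add_left (P₂ := P₂) (F₂ := F₂) hn h1.1]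
      exact h.free_le w (prefix_add.2 (Or.inl hw))
    · have := h.ret (P₁.semilength + r)
      rw [ret_add_right] at this
      rwa [hn, ret_add_right] at this
    · have := h.ups (P₁.semilength + a) (mem_peakUps_add_right.2 h1)
        (by rw [hn]; exact mem_peakDowns_add_right.2 h2)
      rwa [Nat.add_assoc, ret_add_right, ret_add_right] at this
    · have := h.downs (P₁.semilength + a) (mem_peakDowns_add_right.2 h1)
        (by rw [hn]; exact mem_peakUps_add_right.2 h2)
      rwa [Nat.add_assoc, ret_add_right, ret_add_right] at this
    · have := h.free_le _ (prefix_add.2 (Or.inr ⟨w, rfl, hw⟩))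
      rw [List.count_append, List.count_append, ← DyckWord.semilength_eq_count_D,
        show P₁.toList.count U = P₁.semilength from rfl, freeDowns_add_right hn,
        freeUps_add_right hn, freeDowns_eq_freeUps hr hu hd] at this
      omega
  · rintro ⟨h₁, h₂⟩
    have hsplit : ∀ r, r ≤ P₁.semilength ∨ ∃ b, r = P₁.semilength + b := by
      intro r
      rcases le_total r P₁.semilength with h | h
      · exact Or.inl h
      · exact Or.inr ⟨r - P₁.semilength, by omega⟩
    refine ⟨fun r => ?_, fun a h1 h2 => ?_, fun a h1 h2 => ?_, fun w hw => ?_⟩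
    · rcases hsplit r with hr | ⟨b, rfl⟩
      · rw [ret_add_left hr, ret_add_left (by omega)]
        exact h₁.ret r
      · rw [ret_add_right, h₂.ret b, hn, ret_add_right]
    · rcases lt_or_ge a P₁.semilength with ha | ha
      · rw [mem_peakUps_add_left ha] at h1
        rw [mem_peakDowns_add_left (by omega)] at h2
        rw [ret_add_left ha.le, ret_add_left ha]
        exact h₁.ups a h1 h2
      · obtain ⟨b, rfl⟩ := Nat.exists_eq_add_of_le ha
        rw [mem_peakUps_add_right] at h1
        rw [hn, mem_peakDowns_add_right] at h2
        rw [Nat.add_assoc, ret_add_right, ret_add_right]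
        exact h₂.ups b h1 h2
    · rcases lt_or_ge a P₁.semilength with ha | ha
      · rw [mem_peakDowns_add_left ha] at h1
        rw [mem_peakUps_add_left (by omega)] at h2
        rw [ret_add_left ha.le, ret_add_left ha]
        exact h₁.downs a h1 h2
      · obtain ⟨b, rfl⟩ := Nat.exists_eq_add_of_le ha
        rw [mem_peakDowns_add_right] at h1
        rw [hn, mem_peakUps_add_right] at h2
        rw [Nat.add_assoc, ret_add_right, ret_add_right]
        exact h₂.downs b h1 h2
    · rcases prefix_add.1 hw with hw | ⟨v, rfl, hv⟩
      · have h1 := count_le_semilength P₁ hw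
        rw [freeDowns_add_left hn h1.2, freeUps_add_left hn h1.1]
        exact h₁.free_le w hw
      · rw [List.count_append, List.count_append, ← DyckWord.semilength_eq_count_D,
          show P₁.toList.count U = P₁.semilength from rfl, freeDowns_add_right hn,
          freeUps_add_right hn, freeDowns_eq_freeUps h₁.ret h₁.ups h₁.downs]
        have := h₂.free_le v hv
        omega

/-! ### Compatibility of irreducible paths -/

theorem eq_zero_of_semilength_eq_zero (h : P.semilength = 0) : P = 0 := by
  by_contra hc
  exact semilength_ne_zero hc h

theorem kreweras_zero : kreweras 0 = 0 := eq_zero_of_semilength_eq_zero (semilength_kreweras 0)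

theorem compat_nest_zero : Compat (DyckWord.nest 0) (DyckWord.nest 0) := by
  have h0 : ∀ a, a < (DyckWord.nest 0).semilength → a = 0 := by
    intro a ha
    rw [DyckWord.semilength_nest, DyckWord.semilength_zero] at ha
    omega
  have hr : Ret (DyckWord.nest 0) 0 ∧ Ret (DyckWord.nest 0) (0 + 1) :=
    ⟨ret_zero, ret_semilength (P := DyckWord.nest 0)⟩
  refine ⟨fun r => Iff.rfl, fun a ha _ => ?_, fun a ha _ => ?_, fun w hw => ?_⟩
  · rwa [h0 a (lt_of_mem_peakUps ha)]
  · rwa [h0 a (lt_of_mem_peakDowns ha)]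
  · refine le_of_eq_of_le ?_ (Nat.zero_le _)
    rw [freeDowns, Finset.card_eq_zero, Finset.filter_eq_empty_iff]
    rintro x hx ⟨-, h⟩
    rw [Finset.mem_range] at hx
    have := h0 x (hx.trans_le (count_le_semilength _ hw).2)
    subst this
    exact h (mem_peakDowns_of_ret hr.1 hr.2)

/-- An irreducible path other than `UD` has no two consecutive returns, so `ups` and `downs` forbid
every overlap of peaks. By the complement rule this is containment in the peaks of `U L(F) D`, and
the free steps are the deleted entries. -/
theorem compat_nest_iff : Compat P.nest F.nest ↔
    Relation.ReflTransGen Covers (kreweras F).nest P.nest := by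
  by_cases hn : P.semilength = F.semilength
  · by_cases hF : F = 0
    · subst hF
      have hP := eq_zero_of_semilength_eq_zero hn
      subst hP
      rw [kreweras_zero]
      exact ⟨fun _ => Relation.ReflTransGen.refl, fun _ => compat_nest_zero⟩
    · have hn' : P.nest.semilength = F.nest.semilength := by simp [hn]
      have hn1 : 1 < P.nest.semilength := by
        have := semilength_ne_zero hF
        rw [DyckWord.semilength_nest]
        omega
      have hnot : ∀ a, ¬(Ret P.nest a ∧ Ret P.nest (a + 1)) := by
        intro a
        rw [ret_iff_of_isNested DyckWord.IsNested.nest, ret_iff_of_isNested DyckWord.IsNested.nest]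
        omega
      rw [reflTransGen_covers_iff DyckWord.IsNested.nest DyckWord.IsNested.nest
        (by simp [semilength_kreweras, hn])]
      have e : ∀ w, w <+: P.nest.toList →
          (((Finset.range (w.count D)).filter fun x =>
            x ∈ peakDowns (kreweras F).nest ∧ x ∉ peakDowns P.nest).card =
            freeDowns P.nest F.nest (w.count D)) ∧
          (((Finset.range (w.count U)).filter fun x =>
            x ∈ peakUps (kreweras F).nest ∧ x ∉ peakUps P.nest).card =
            freeUps P.nest F.nest (w.count U)) := by
        intro w hw
        have hc := count_le_semilength _ hw
        rw [freeDowns, freeUps]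
        constructor
        · congr 1
          refine Finset.filter_congr fun x hx => ?_
          rw [Finset.mem_range] at hx
          rw [mem_peakDowns_nest_kreweras hF]
          exact and_congr_left fun _ => ⟨fun h => h.2, fun h => ⟨by omega, h⟩⟩
        · congr 1
          refine Finset.filter_congr fun x hx => ?_
          rw [Finset.mem_range] at hx
          rw [mem_peakUps_nest_kreweras hF]
          exact and_congr_left fun _ => ⟨fun h => h.2, fun h => ⟨by omega, h⟩⟩
      constructor
      · intro h
        refine ⟨fun a ha => ?_, fun a ha => ?_, fun w hw => ?_⟩
        · rw [mem_peakUps_nest_kreweras hF]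
          exact ⟨hn' ▸ lt_of_mem_peakUps ha, fun hc => hnot a (h.ups a ha hc)⟩
        · rw [mem_peakDowns_nest_kreweras hF]
          exact ⟨hn' ▸ lt_of_mem_peakDowns ha, fun hc => hnot a (h.downs a ha hc)⟩
        · rw [(e w hw).1, (e w hw).2]
          exact h.free_le w hw
      · rintro ⟨h1, h2, h3⟩
        refine ⟨fun r => ?_, fun a ha hc => ?_, fun a ha hc => ?_, fun w hw => ?_⟩
        · rw [ret_iff_of_isNested DyckWord.IsNested.nest,
            ret_iff_of_isNested DyckWord.IsNested.nest, hn']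
        · exact absurd hc ((mem_peakUps_nest_kreweras hF).1 (h1 ha)).2
        · exact absurd hc ((mem_peakDowns_nest_kreweras hF).1 (h2 ha)).2
        · rw [← (e w hw).1, ← (e w hw).2]
          exact h3 w hw
  · constructor
    · intro h
      have := semilength_eq_of_ret h.ret
      rw [DyckWord.semilength_nest, DyckWord.semilength_nest] at this
      omega
    · intro h
      have := semilength_eq_of_reflTransGen h
      rw [DyckWord.semilength_nest, DyckWord.semilength_nest, semilength_kreweras] at this
      omega

end Compat

/-! ### The order relation in terms of the peaks -/

theorem insides_zero : insides 0 = [] := by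
  rw [insides, dif_pos rfl]

theorem insides_nest_add (P Q : DyckWord) : insides (P.nest + Q) = P :: insides Q := by
  have h : P.nest + Q ≠ 0 := by
    intro h
    have := congrArg DyckWord.semilength h
    simp at this
  rw [insides, dif_neg h, DyckWord.insidePart_add DyckWord.nest_ne_zero, DyckWord.insidePart_nest,
    DyckWord.outsidePart_add DyckWord.nest_ne_zero, DyckWord.outsidePart_nest, zero_add]

theorem insides_sum_nest (l : List DyckWord) : insides (l.map DyckWord.nest).sum = l := by
  induction l with
  | nil => exact insides_zero
  | cons p l ih => rw [List.map_cons, List.sum_cons, insides_nest_add, ih]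

theorem components_modKreweras (Q : DyckWord) : components (modKreweras Q) =
    (insides (flipPath Q)).map fun p => (kreweras p).nest := by
  have : (insides (flipPath Q)).map (fun p => (kreweras p).nest) =
      ((insides (flipPath Q)).map kreweras).map DyckWord.nest := by
    rw [List.map_map]
    rfl
  rw [components, modKreweras, this, insides_sum_nest]

theorem exists_add_of_ne_zero {P : DyckWord} (hP : P ≠ 0) :
    ∃ P₁ P₂ : DyckWord, P = P₁.nest + P₂ ∧ P₂.semilength < P.semilength :=
  ⟨_, _, (DyckWord.nest_insidePart_add_outsidePart hP).symm, DyckWord.semilength_outsidePart_lt hP⟩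

theorem semilength_le_of_ret {P₁ P₂ : DyckWord} {r : ℕ} (h : Ret (P₁.nest + P₂) r) (h0 : 0 < r) :
    P₁.nest.semilength ≤ r := by
  rw [ret_add, ret_iff_of_isNested DyckWord.IsNested.nest] at h
  rcases h with h | ⟨b, -, h⟩ <;> omega

theorem forall₂_components_iff (F : DyckWord) : ∀ P : DyckWord,
    List.Forall₂ (Relation.ReflTransGen Covers) ((insides F).map fun p => (kreweras p).nest)
      (components P) ↔ Compat P F := by
  induction hm : F.semilength using Nat.strong_induction_on generalizing F with
  | _ m ih =>
    intro P
    rw [components]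
    by_cases hF : F = 0
    · subst hF
      by_cases hP : P = 0
      · subst hP
        rw [insides_zero]
        simp only [List.map_nil, List.Forall₂.nil, true_iff]
        refine ⟨fun _ => Iff.rfl, fun a ha => ?_, fun a ha => ?_, fun w hw => ?_⟩
        · exact absurd (lt_of_mem_peakUps ha) (by simp)
        · exact absurd (lt_of_mem_peakDowns ha) (by simp)
        · have : w = [] := List.prefix_nil.1 hw
          rw [this]
          exact Nat.zero_le _
      · obtain ⟨P₁, P₂, rfl, -⟩ := exists_add_of_ne_zero hP
        rw [insides_zero, insides_nest_add]
        simp only [List.map_nil, List.map_cons, List.forall₂_nil_left_iff, reduceCtorEq, false_iff]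
        intro h
        have := semilength_eq_of_ret h.ret
        simp at this
    · obtain ⟨F₁, F₂, rfl, hlt⟩ := exists_add_of_ne_zero hF
      by_cases hP : P = 0
      · subst hP
        rw [insides_zero, insides_nest_add]
        simp only [List.map_nil, List.map_cons, List.forall₂_nil_right_iff, reduceCtorEq, false_iff]
        intro h
        have := semilength_eq_of_ret h.ret
        simp at this
        omega
      · obtain ⟨P₁, P₂, rfl, -⟩ := exists_add_of_ne_zero hP
        rw [insides_nest_add, insides_nest_add, List.map_cons, List.map_cons, List.forall₂_cons,
          ← compat_nest_iff]
        have := ih F₂.semilength (by omega) F₂ rfl P₂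
        rw [components] at this
        rw [this]
        by_cases hn : P₁.nest.semilength = F₁.nest.semilength
        · rw [compat_add_iff hn]
        · constructor
          · intro h
            exact absurd (semilength_eq_of_ret h.1.ret) hn
          · intro h
            -- The end of the first component of either path is a positive return of the other,
            -- hence not before the end of the other's first component.
            refine absurd (le_antisymm ?_ ?_) hn
            · exact semilength_le_of_ret ((h.ret _).2 (ret_add.2 (Or.inl ret_semilength))) (by simp)
            · exact semilength_le_of_ret ((h.ret _).1 (ret_add.2 (Or.inl ret_semilength))) (by simp)

theorem pathLE_modKreweras_iff (P Q : DyckWord) :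
    PathLE (modKreweras Q) P ↔ Compat P (flipPath Q) := by
  rw [PathLE, components_modKreweras, forall₂_components_iff]

/-! ### The paths of a permutation in terms of heights -/

/-- The running maxima of a list, for a reading that starts with the maximum `m`. -/
def runMax : ℕ → List ℕ → List ℕ
  | _, [] => []
  | m, x :: l => max m x :: runMax (max m x) l

theorem heights_replicate_up (k : ℕ) (w : List DyckStep) (u : ℕ) :
    heights u (List.replicate k U ++ w) = heights (u + k) w := by
  rw [heights_append, List.count_replicate_self]
  have : heights u (List.replicate k U) = [] := by
    rw [← List.length_eq_zero_iff, length_heights]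
    simp [List.count_replicate]
  rw [this, List.nil_append]

/-- Every entry contributes exactly one down step, and the up steps read by then add up to the
current maximum. -/
theorem heights_maxWord (l : List ℕ) : ∀ m, heights m (maxWord m l) = runMax m l := by
  induction l with
  | nil => intro m; rfl
  | cons x l ih =>
    intro m
    rw [maxWord, runMax]
    split_ifs with h
    · rw [heights_replicate_up, show m + (x - m) = x by omega, max_eq_right h.le]
      change x :: heights x (maxWord x l) = _
      rw [ih]
    · rw [max_eq_left (not_lt.1 h)]
      change m :: heights m (maxWord m l) = _
      rw [ih]

theorem length_runMax (l : List ℕ) : ∀ m, (runMax m l).length = l.length := by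
  induction l with
  | nil => intro m; rfl
  | cons x l ih => intro m; simp [runMax, ih]

theorem le_of_mem_runMax (l : List ℕ) : ∀ m, ∀ x ∈ runMax m l, m ≤ x := by
  induction l with
  | nil => simp [runMax]
  | cons y l ih =>
    intro m x hx
    rcases List.mem_cons.1 hx with rfl | hx
    · exact le_max_left _ _
    · exact (le_max_left _ _).trans (ih _ x hx)

theorem getElem_le_runMax (l : List ℕ) : ∀ (m i j : ℕ) (_ : j ≤ i) (hi : i < l.length),
    l[j] ≤ (runMax m l)[i]'(by rwa [length_runMax]) := by
  induction l with
  | nil => intro m i j _ hi; simp at hi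
  | cons x l ih =>
    intro m i j hij hi
    cases i with
    | zero =>
      obtain rfl : j = 0 := by omega
      simp [runMax]
    | succ i =>
      have hi' : i < l.length := by simpa using hi
      cases j with
      | zero =>
        have h1 : i < (runMax (max m x) l).length := by rwa [length_runMax]
        have := le_of_mem_runMax l (max m x) _ (List.getElem_mem h1)
        simp only [runMax, List.getElem_cons_zero, List.getElem_cons_succ]
        exact (le_max_right m x).trans this
      | succ j => simpa [runMax] using ih (max m x) i j (by omega) hi'

theorem runMax_eq (l : List ℕ) : ∀ (m i : ℕ) (hi : i < l.length),
    (runMax m l)[i]'(by rwa [length_runMax]) = m ∨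
      ∃ (j : ℕ) (hj : j ≤ i), (runMax m l)[i]'(by rwa [length_runMax]) = l[j] := by
  induction l with
  | nil => intro m i hi; simp at hi
  | cons x l ih =>
    intro m i hi
    have hx : max m x = m ∨ max m x = x := by omega
    cases i with
    | zero =>
      rcases hx with h | h
      · exact Or.inl (by simpa [runMax] using h)
      · exact Or.inr ⟨0, le_rfl, by simpa [runMax] using h⟩
    | succ i =>
      have hi' : i < l.length := by simpa using hi
      rcases ih (max m x) i hi' with h | ⟨j, hj, h⟩
      · rcases hx with h' | h'
        · exact Or.inl (by simpa [runMax] using h.trans h')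
        · exact Or.inr ⟨0, Nat.zero_le _, by simpa [runMax] using h.trans h'⟩
      · exact Or.inr ⟨j + 1, by omega, by simpa [runMax] using h⟩

/-! ### Paths that record a permutation -/

variable {n : ℕ}

/-- The path `P` records the left-to-right maxima of the permutation `τ`. -/
structure Records (τ : Equiv.Perm (Fin n)) (P : DyckWord) : Prop where
  semilength : P.semilength = n
  lt_height : ∀ i : Fin n, (τ i : ℕ) < height P i
  eq_height : ∀ i : Fin n, (i : ℕ) ∈ peakDowns P → (τ i : ℕ) + 1 = height P i

/-- The heights of `R` are the running maxima. The entries at the peaks of `P` push them up to the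
heights of `P`, which are constant between peaks, and `lt_height` with monotonicity keeps them from
exceeding these. -/
theorem eq_iff_records {τ : Equiv.Perm (Fin n)} {P R : DyckWord}
    (hR : R.toList = maxWord 0 (List.ofFn fun i => (τ i : ℕ) + 1)) : P = R ↔ Records τ P := by
  have hn : R.semilength = n := by
    rw [R.semilength_eq_count_D, ← length_heights _ 0, hR, heights_maxWord, length_runMax,
      List.length_ofFn]
  have hl : ∀ i : Fin n, (i : ℕ) < (runMax 0 (List.ofFn fun i => (τ i : ℕ) + 1)).length := by
    intro i
    rw [length_runMax, List.length_ofFn]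
    exact i.2
  have hh : ∀ i : Fin n, height R i = (runMax 0 (List.ofFn fun i => (τ i : ℕ) + 1))[(i : ℕ)]'(hl i) := by
    intro i
    rw [height, hR, heights_maxWord, List.getD_eq_getElem]
  have hle : ∀ i j : Fin n, j ≤ i → (τ j : ℕ) + 1 ≤ height R i := by
    intro i j hij
    rw [hh]
    have := getElem_le_runMax (List.ofFn fun i => (τ i : ℕ) + 1) 0 i j hij (by simp)
    simpa using this
  have heq : ∀ i : Fin n, ∃ j ≤ i, height R i = (τ j : ℕ) + 1 := by
    intro i
    rcases runMax_eq (List.ofFn fun i => (τ i : ℕ) + 1) 0 i (by simp) with h | ⟨j, hj, h⟩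
    · rw [← hh] at h
      have := hle i i le_rfl
      omega
    · rw [← hh] at h
      exact ⟨⟨j, by omega⟩, hj, by simpa using h⟩
  constructor
  · rintro rfl
    refine ⟨hn, fun i => hle i i le_rfl, fun i hi => ?_⟩
    obtain ⟨j, hj, h⟩ := heq i
    rcases hj.eq_or_lt with rfl | hj
    · exact h.symm
    · have h1 := height_lt_height hi (j := j) hj
      have h2 := hle j j le_rfl
      omega
  · intro h
    refine eq_of_height_eq (h.semilength.trans hn.symm) fun i hi => ?_
    rw [h.semilength] at hi
    apply le_antisymm
    · obtain ⟨j, h1, h2, h3⟩ := exists_peakDowns_le (P := P) (i := i) (by rwa [h.semilength])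
      rw [← h3, ← h.eq_height ⟨j, by omega⟩ h1]
      exact hle ⟨i, hi⟩ ⟨j, by omega⟩ h2
    · obtain ⟨j, h1, h2⟩ := heq ⟨i, hi⟩
      rw [h2]
      have h3 := h.lt_height j
      have h4 := height_mono (P := P) (i := j) (j := i) h1 (by rwa [h.semilength])
      omega

/-- The permutation whose diagram is that of `τ` rotated by a half turn. -/
def rotate (τ : Equiv.Perm (Fin n)) : Equiv.Perm (Fin n) :=
  (Fin.revPerm.trans τ).trans Fin.revPerm

theorem rotate_apply (τ : Equiv.Perm (Fin n)) (i : Fin n) : rotate τ i = (τ i.rev).rev := rfl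

theorem rotate_rotate (τ : Equiv.Perm (Fin n)) : rotate (rotate τ) = τ := by
  ext i
  simp [rotate_apply]

/-- The paths `P` and `Q` record the left-to-right maxima and, rotated, the right-to-left minima of
the permutation `τ`. -/
def Realizes (τ : Equiv.Perm (Fin n)) (P Q : DyckWord) : Prop :=
  Records τ P ∧ Records (rotate τ) Q

theorem Realizes.symm {τ : Equiv.Perm (Fin n)} {P Q : DyckWord} (h : Realizes τ P Q) :
    Realizes (rotate τ) Q P := ⟨h.2, by rw [rotate_rotate]; exact h.1⟩

/-- Reversing the values turns left-to-right minima into left-to-right maxima. -/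
theorem eq_lamPath_iff {α : Equiv.Perm (Fin n)} {P : DyckWord} :
    P = lamPath α ↔ Records (α.trans Fin.revPerm) P := by
  apply eq_iff_records
  have h := oneLine_spec α
  change minWord (n + 1) (oneLine α) = _
  rw [minWord_eq_maxWord n _ _ le_rfl fun x hx => (h.1 x hx).2.trans (Nat.le_succ n), Nat.sub_self,
    oneLine, List.map_ofFn]
  congr 2
  funext i
  simp [Fin.val_rev]
  omega

/-- The value reversal inside `rotate` cancels the one applied to `α`; what remains is the reading
from right to left. -/
theorem eq_muPath_iff {α : Equiv.Perm (Fin n)} {Q : DyckWord} :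
    Q = muPath α ↔ Records (rotate (α.trans Fin.revPerm)) Q := by
  apply eq_iff_records
  change maxWord 0 (oneLine α).reverse = _
  congr 1
  apply List.ext_getElem
  · simp [oneLine]
  · intro i h1 h2
    simp [oneLine, rotate_apply]
    congr 2
    ext
    simp [Fin.val_rev]
    omega

theorem nu_eq_iff {α : Equiv.Perm (Fin n)} {P Q : DyckWord} :
    nu α = (P, Q) ↔ Realizes (α.trans Fin.revPerm) P Q := by
  rw [nu, Prod.mk.injEq, Realizes, ← eq_lamPath_iff, ← eq_muPath_iff, eq_comm, eq_comm (a := Q)]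

theorem admissible_iff {P Q : DyckWord} :
    Admissible n P Q ↔ ∃ τ : Equiv.Perm (Fin n), Realizes τ P Q := by
  constructor
  · rintro ⟨α, rfl, rfl⟩
    exact ⟨_, nu_eq_iff.1 rfl⟩
  · rintro ⟨τ, h⟩
    have e : (τ.trans Fin.revPerm).trans Fin.revPerm = τ := by
      ext i
      simp
    rw [← e, ← nu_eq_iff, nu, Prod.mk.injEq] at h
    exact ⟨_, h.1.symm, h.2.symm⟩

/-! ### Necessity -/

section Records

variable {τ : Equiv.Perm (Fin n)} {P Q : DyckWord} {i : Fin n}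

theorem Records.mem_peakDowns_iff (h : Records τ P) :
    (i : ℕ) ∈ peakDowns P ↔ ∀ j < i, τ j < τ i := by
  constructor
  · intro hi j hj
    have h1 := height_lt_height hi (j := j) hj
    have h2 := h.lt_height j
    have h3 := h.eq_height i hi
    rw [Fin.lt_def]
    omega
  · intro hi
    obtain ⟨j, h1, h2, h3⟩ := exists_peakDowns_le (P := P) (i := i) (by rw [h.semilength]; exact i.2)
    rcases h2.eq_or_lt with rfl | hlt
    · exact h1
    · have h4 := hi ⟨j, by omega⟩ hlt
      have h5 := h.eq_height ⟨j, by omega⟩ h1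
      have h6 := h.lt_height i
      rw [Fin.lt_def] at h4
      simp only at h5
      omega

theorem Records.apply_mem_peakUps_iff (h : Records τ P) :
    (τ i : ℕ) ∈ peakUps P ↔ (i : ℕ) ∈ peakDowns P := by
  rw [mem_peakUps_iff]
  constructor
  · rintro ⟨j, hj, e⟩
    have hjn := lt_of_mem_peakDowns hj
    rw [h.semilength] at hjn
    have h1 := h.eq_height ⟨j, hjn⟩ hj
    have h2 : τ ⟨j, hjn⟩ = τ i := Fin.ext (by simp only at h1; omega)
    rw [← τ.injective h2]
    exact hj
  · exact fun hi => ⟨i, hi, (h.eq_height i hi).symm⟩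

/-- The height of the down step `r` is `r + 1` exactly when the first `r + 1` entries do not exceed
`r`. -/
theorem Records.ret_iff (h : Records τ P) {r : ℕ} :
    Ret P r ↔ r ≤ n ∧ ∀ j : Fin n, (j : ℕ) < r → (τ j : ℕ) < r := by
  have hn := h.semilength
  cases r with
  | zero => simp [ret_zero]
  | succ r =>
    rw [ret_succ_iff, hn]
    refine and_congr_right fun hr => ?_
    constructor
    · intro hr' j hj
      have h1 := h.lt_height j
      have h2 := height_mono (P := P) (i := j) (j := r) (by omega) (by omega)
      omega
    · intro hj
      obtain ⟨j, h1, h2, h3⟩ := exists_peakDowns_le (P := P) (i := r) (by omega)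
      have h4 := h.eq_height ⟨j, by omega⟩ h1
      have h5 := hj ⟨j, by omega⟩ (by simp only; omega)
      have h6 := DyckPerm.lt_height (P := P) (i := r) (by omega)
      simp only at h4
      omega

theorem Records.semilength_flip (h : Records (rotate τ) Q) : (flipPath Q).semilength = n :=
  (semilength_flipPath Q).trans h.semilength

theorem Records.mem_peakUps_flip (h : Records (rotate τ) Q) :
    (i : ℕ) ∈ peakUps (flipPath Q) ↔ ∀ j, i < j → τ i < τ j := by
  rw [mem_peakUps_flipPath (by rw [h.semilength]; exact i.2), h.semilength,
    show n - 1 - (i : ℕ) = (i.rev : ℕ) by rw [Fin.val_rev]; omega, h.mem_peakDowns_iff]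
  simp only [rotate_apply, Fin.rev_rev, Fin.rev_lt_rev]
  constructor
  · intro hi j hj
    have := hi j.rev (Fin.rev_lt_rev.2 hj)
    rwa [Fin.rev_rev] at this
  · intro hi j hj
    exact hi j.rev (by rwa [← Fin.rev_lt_rev, Fin.rev_rev])

theorem Records.apply_mem_peakDowns_flip_iff (h : Records (rotate τ) Q) :
    (τ i : ℕ) ∈ peakDowns (flipPath Q) ↔ (i : ℕ) ∈ peakUps (flipPath Q) := by
  rw [mem_peakUps_flipPath (by rw [h.semilength]; exact i.2),
    mem_peakDowns_flipPath (by rw [h.semilength]; exact (τ i).2), h.semilength,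
    show n - 1 - (i : ℕ) = (i.rev : ℕ) by rw [Fin.val_rev]; omega, ← h.apply_mem_peakUps_iff,
    rotate_apply, Fin.rev_rev, Fin.val_rev, Nat.sub_sub, Nat.add_comm 1]

/-- An injective map of a finite set into itself is onto. Hence an initial block is preserved
exactly when the final block is, which makes the returns of the two paths agree. -/
theorem apply_iff_of_mapsTo {p : Fin n → Prop} (h : ∀ j, p j → p (τ j)) (j : Fin n) :
    p (τ j) ↔ p j := by
  refine ⟨fun hj => ?_, h j⟩
  have := Equiv.Perm.perm_symm_on_of_perm_on_finite (f := τ) (p := p) (fun x hx => h x hx) hj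
  simpa using this

theorem Records.ret_flip_iff (h : Records (rotate τ) Q) {r : ℕ} :
    Ret (flipPath Q) r ↔ r ≤ n ∧ ∀ j : Fin n, r ≤ (j : ℕ) → r ≤ (τ j : ℕ) := by
  by_cases hr : r ≤ n
  · rw [ret_flipPath (by rwa [h.semilength]), h.ret_iff, h.semilength]
    constructor
    · rintro ⟨-, h1⟩
      refine ⟨hr, fun j hj => ?_⟩
      have := h1 j.rev (by rw [Fin.val_rev]; omega)
      rw [rotate_apply, Fin.rev_rev, Fin.val_rev] at this
      have := (τ j).2
      omega
    · rintro ⟨-, h1⟩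
      refine ⟨by omega, fun j hj => ?_⟩
      have := h1 j.rev (by rw [Fin.val_rev]; omega)
      rw [rotate_apply, Fin.val_rev]
      omega
  · constructor
    · intro h1
      have := h1.le
      rw [h.semilength_flip] at this
      omega
    · exact fun h1 => absurd h1.1 hr

/-- For the counting condition, `τ` itself injects the free positions before a point of `P` into the
free values below it. -/
theorem Realizes.compat (h : Realizes τ P Q) : Compat P (flipPath Q) := by
  obtain ⟨hP, hQ⟩ := h
  -- As a left-to-right maximum, the entry satisfies `τ x ≥ x`; by the half turn, as a right-to-left
  -- minimum, it satisfies `τ x ≤ x`. So it is fixed, and all earlier entries are smaller.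
  have hret : ∀ x : Fin n, (x : ℕ) ∈ peakDowns P → (x : ℕ) ∈ peakUps (flipPath Q) →
      (τ x : ℕ) = x ∧ Ret P x ∧ Ret P (x + 1) := by
    intro x h1 h2
    have h3 := hP.eq_height x h1
    have h4 := DyckPerm.lt_height (P := P) (i := x) (by rw [hP.semilength]; exact x.2)
    rw [mem_peakUps_flipPath (by rw [hQ.semilength]; exact x.2), hQ.semilength,
      show n - 1 - (x : ℕ) = (x.rev : ℕ) by rw [Fin.val_rev]; omega] at h2
    have h5 := hQ.eq_height _ h2
    have h6 := DyckPerm.lt_height (P := Q) (i := x.rev) (by rw [hQ.semilength]; exact x.rev.2)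
    rw [rotate_apply, Fin.rev_rev] at h5
    have h7 := (τ x).2
    rw [Fin.val_rev] at h5 h6
    have e : (τ x : ℕ) = x := by
      rw [Fin.val_rev] at h5
      omega
    refine ⟨e, hP.ret_iff.2 ⟨x.2.le, fun j hj => ?_⟩, ret_succ_iff.2
      ⟨by rw [hP.semilength]; exact x.2, by omega⟩⟩
    have := hP.mem_peakDowns_iff.1 h1 j hj
    rw [Fin.lt_def] at this
    omega
  refine ⟨fun r => ?_, fun a ha h1 => ?_, fun a ha h1 => ?_, fun w hw => ?_⟩
  · rw [hP.ret_iff, hQ.ret_flip_iff]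
    refine and_congr_right fun _ => ?_
    constructor
    · intro h1 j hj
      have := apply_iff_of_mapsTo (τ := τ) (p := fun j => (j : ℕ) < r) h1 j
      omega
    · intro h1 j hj
      have := apply_iff_of_mapsTo (τ := τ) (p := fun j => r ≤ (j : ℕ)) h1 j
      omega
  · have hn := lt_of_mem_peakUps ha
    rw [hP.semilength] at hn
    obtain ⟨x, hx⟩ := τ.surjective ⟨a, hn⟩
    have hxa : (τ x : ℕ) = a := congrArg Fin.val hx
    rw [← hxa, hP.apply_mem_peakUps_iff] at ha
    rw [← hxa, hQ.apply_mem_peakDowns_flip_iff] at h1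
    obtain ⟨e, h2⟩ := hret x ha h1
    rwa [← hxa, e]
  · have hn := lt_of_mem_peakDowns ha
    rw [hP.semilength] at hn
    exact (hret ⟨a, hn⟩ ha h1).2
  · rw [freeDowns, freeUps]
    have hd := (count_le_semilength P hw).2
    rw [hP.semilength] at hd
    refine Finset.card_le_card_of_injOn (fun y => if h : y < n then (τ ⟨y, h⟩ : ℕ) else 0) ?_ ?_
    · intro y hy
      simp only [Finset.coe_filter, Finset.mem_range, Set.mem_ofPred_eq] at hy ⊢
      have hyn : y < n := by omega
      rw [dif_pos hyn, hP.apply_mem_peakUps_iff, hQ.apply_mem_peakDowns_flip_iff]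
      refine ⟨?_, hy.2⟩
      have h1 := hP.lt_height ⟨y, hyn⟩
      have h2 := height_le_of_prefix hw hy.1
      exact h1.trans_le h2
    · intro y hy z hz hyz
      simp only [Finset.coe_filter, Finset.mem_range, Set.mem_ofPred_eq] at hy hz
      have hyn : y < n := by omega
      have hzn : z < n := by omega
      simp only [dif_pos hyn, dif_pos hzn] at hyz
      exact congrArg Fin.val (τ.injective (Fin.ext hyz))

/-! ### The permutations that avoid `1234` -/

theorem containsPattern_iff {α : Equiv.Perm (Fin n)} :
    ContainsPattern α (1 : Equiv.Perm (Fin 4)) ↔ ∃ a b c d : Fin n, a < b ∧ b < c ∧ c < d ∧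
      α a < α b ∧ α b < α c ∧ α c < α d := by
  constructor
  · rintro ⟨f, hf, h⟩
    exact ⟨f 0, f 1, f 2, f 3, hf (by decide), hf (by decide), hf (by decide),
      (h _ _).2 (by decide), (h _ _).2 (by decide), (h _ _).2 (by decide)⟩
  · rintro ⟨a, b, c, d, h1, h2, h3, h4, h5, h6⟩
    have hf : StrictMono ![a, b, c, d] := by
      rw [Fin.strictMono_iff_lt_succ]
      intro i
      fin_cases i <;> simp [h1, h2, h3]
    have hg : StrictMono fun i => α (![a, b, c, d] i) := by
      rw [Fin.strictMono_iff_lt_succ]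
      intro i
      fin_cases i <;> simp [h4, h5, h6]
    exact ⟨_, hf, fun x y => hg.lt_iff_lt⟩

/-- A middle entry of a `1234` has a smaller entry before it and a larger one after it, hence is
free. Conversely, for free `b < c` with `α b < α c`, a smaller entry before `b` and a larger one
after `c` complete a `1234`. -/
theorem mem_avoiding1234_iff {α : Equiv.Perm (Fin n)} (h : Realizes (α.trans Fin.revPerm) P Q) :
    α ∈ avoiding1234 n ↔ ∀ b c : Fin n,
      ((b : ℕ) ∉ peakUps (flipPath Q) ∧ (b : ℕ) ∉ peakDowns P) →
      ((c : ℕ) ∉ peakUps (flipPath Q) ∧ (c : ℕ) ∉ peakDowns P) → b < c → α c < α b := by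
  obtain ⟨hP, hQ⟩ := h
  simp only [hP.mem_peakDowns_iff, hQ.mem_peakUps_flip, Equiv.trans_apply, Fin.revPerm_apply,
    Fin.rev_lt_rev, avoiding1234, Set.mem_ofPred_eq, containsPattern_iff]
  constructor
  · rintro h b c ⟨-, hb⟩ ⟨hc, -⟩ hbc
    push Not at hb hc
    obtain ⟨a, hab, ha⟩ := hb
    obtain ⟨d, hcd, hd⟩ := hc
    by_contra hlt
    exact h ⟨a, b, c, d, hab, hbc, hcd, ha.lt_of_ne (α.injective.ne hab.ne),
      (not_lt.1 hlt).lt_of_ne (α.injective.ne hbc.ne), hd.lt_of_ne (α.injective.ne hcd.ne)⟩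
  · rintro h ⟨a, b, c, d, h1, h2, h3, h4, h5, h6⟩
    exact absurd (h b c ⟨fun hb => (hb c h2).not_gt h5, fun hb => (hb a h1).not_gt h4⟩
      ⟨fun hc => (hc d h3).not_gt h6, fun hc => (hc b h2).not_gt h5⟩ h2) h5.not_gt

/-- The peaks fix the extremal entries, and the free entries of both permutations enumerate the same
set of free values increasingly. -/
theorem eq_of_realizes {τ' : Equiv.Perm (Fin n)} (h : Realizes τ P Q) (h' : Realizes τ' P Q)
    (hm : ∀ b c : Fin n, ((b : ℕ) ∉ peakUps (flipPath Q) ∧ (b : ℕ) ∉ peakDowns P) →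
      ((c : ℕ) ∉ peakUps (flipPath Q) ∧ (c : ℕ) ∉ peakDowns P) → b < c → τ b < τ c)
    (hm' : ∀ b c : Fin n, ((b : ℕ) ∉ peakUps (flipPath Q) ∧ (b : ℕ) ∉ peakDowns P) →
      ((c : ℕ) ∉ peakUps (flipPath Q) ∧ (c : ℕ) ∉ peakDowns P) → b < c → τ' b < τ' c) :
    τ = τ' := by
  ext i
  by_cases h1 : (i : ℕ) ∈ peakDowns P
  · have e := h.1.eq_height i h1
    rw [← h'.1.eq_height i h1] at e
    omega
  by_cases h2 : (i : ℕ) ∈ peakUps (flipPath Q)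
  · rw [mem_peakUps_flipPath (by rw [h.2.semilength]; exact i.2), h.2.semilength,
      show n - 1 - (i : ℕ) = (i.rev : ℕ) by rw [Fin.val_rev]; omega] at h2
    have e := h.2.eq_height _ h2
    rw [← h'.2.eq_height _ h2, rotate_apply, rotate_apply, Fin.rev_rev, Fin.val_rev,
      Fin.val_rev] at e
    omega
  · let S := {b : Fin n // (b : ℕ) ∉ peakUps (flipPath Q) ∧ (b : ℕ) ∉ peakDowns P}
    have hrange : ∀ {σ : Equiv.Perm (Fin n)}, Realizes σ P Q → Set.range (fun b : S => σ b.1) =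
        {w : Fin n | (w : ℕ) ∉ peakDowns (flipPath Q) ∧ (w : ℕ) ∉ peakUps P} := by
      intro σ hσ
      ext w
      constructor
      · rintro ⟨b, rfl⟩
        change ((σ b.1 : Fin n) : ℕ) ∉ _ ∧ _
        rw [hσ.1.apply_mem_peakUps_iff, hσ.2.apply_mem_peakDowns_flip_iff]
        exact b.2
      · intro hw
        obtain ⟨b, rfl⟩ := σ.surjective w
        change ((σ b : Fin n) : ℕ) ∉ _ ∧ _ at hw
        rw [hσ.1.apply_mem_peakUps_iff, hσ.2.apply_mem_peakDowns_flip_iff] at hw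
        exact ⟨⟨b, hw⟩, rfl⟩
    have hs : StrictMono fun b : S => τ b.1 := fun b c hbc => hm b.1 c.1 b.2 c.2 hbc
    have hs' : StrictMono fun b : S => τ' b.1 := fun b c hbc => hm' b.1 c.1 b.2 c.2 hbc
    have := (hs.range_inj hs').1 ((hrange h).trans (hrange h').symm)
    exact congrArg Fin.val (congrFun this ⟨i, h2, h1⟩)

end Records

/-! ### Sufficiency -/

/-- Two finite sets of the same cardinality are matched by an increasing map. -/
theorem exists_increasing_matching {Y X : Finset ℕ} (h : Y.card = X.card) :
    ∃ r : ℕ → ℕ, (∀ y ∈ Y, r y ∈ X) ∧ (∀ y ∈ Y, ∀ z ∈ Y, y < z → r y < r z) ∧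
      ∀ y ∈ Y, (Y.filter (· ≤ y)).card = (X.filter (· ≤ r y)).card ∧
        (Y.filter (y ≤ ·)).card = (X.filter (r y ≤ ·)).card := by
  let e : Y ≃o X := (Y.orderIsoOfFin h).symm.trans (X.orderIsoOfFin rfl)
  let r : ℕ → ℕ := fun y => if hy : y ∈ Y then (e ⟨y, hy⟩ : ℕ) else 0
  have hr : ∀ y (hy : y ∈ Y), r y = e ⟨y, hy⟩ := fun y hy => dif_pos hy
  have hle : ∀ y ∈ Y, ∀ z ∈ Y, r y ≤ r z ↔ y ≤ z := by
    intro y hy z hz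
    rw [hr y hy, hr z hz, Subtype.coe_le_coe, e.le_iff_le, Subtype.mk_le_mk]
  have hmem : ∀ y ∈ Y, r y ∈ X := fun y hy => by
    rw [hr y hy]
    exact (e ⟨y, hy⟩).2
  have hsurj : ∀ x ∈ X, ∃ y ∈ Y, r y = x := fun x hx =>
    ⟨e.symm ⟨x, hx⟩, (e.symm ⟨x, hx⟩).2, by rw [hr _ (e.symm ⟨x, hx⟩).2]; simp⟩
  have hlt : ∀ y ∈ Y, ∀ z ∈ Y, y < z → r y < r z := fun y hy z hz hyz =>
    lt_of_not_ge fun hc => hyz.not_ge ((hle z hz y hy).1 hc)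
  have hinj : Set.InjOn r (Y : Set ℕ) := fun y hy z hz hyz =>
    le_antisymm ((hle y hy z hz).1 hyz.le) ((hle z hz y hy).1 hyz.ge)
  refine ⟨r, hmem, hlt, fun y hy => ⟨?_, ?_⟩⟩
  · rw [← Finset.card_image_of_injOn (hinj.mono (Finset.coe_subset.2 (Finset.filter_subset _ _)))]
    congr 1
    ext x
    simp only [Finset.mem_image, Finset.mem_filter]
    constructor
    · rintro ⟨z, ⟨hz, hzy⟩, rfl⟩
      exact ⟨hmem z hz, (hle z hz y hy).2 hzy⟩
    · rintro ⟨hx, hxy⟩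
      obtain ⟨z, hz, rfl⟩ := hsurj x hx
      exact ⟨z, ⟨hz, (hle z hz y hy).1 hxy⟩, rfl⟩
  · rw [← Finset.card_image_of_injOn (hinj.mono (Finset.coe_subset.2 (Finset.filter_subset _ _)))]
    congr 1
    ext x
    simp only [Finset.mem_image, Finset.mem_filter]
    constructor
    · rintro ⟨z, ⟨hz, hzy⟩, rfl⟩
      exact ⟨hmem z hz, (hle y hy z hz).2 hzy⟩
    · rintro ⟨hx, hxy⟩
      obtain ⟨z, hz, rfl⟩ := hsurj x hx
      exact ⟨z, ⟨hz, (hle y hy z hz).1 hxy⟩, rfl⟩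

/-! ### The permutation with increasing free entries -/

section Construction

variable {n : ℕ} {P Q : DyckWord}

/-- The height of the flipped path over its up step of index `i`, measured by down steps. -/
def coheight (Q : DyckWord) (i : ℕ) : ℕ := Q.semilength - height Q (Q.semilength - 1 - i)

theorem coheight_le {i : ℕ} (hi : i < Q.semilength) : coheight Q i ≤ i := by
  have := lt_height (P := Q) (i := Q.semilength - 1 - i) (by omega)
  rw [coheight]
  omega

theorem coheight_add {i : ℕ} (hi : i < Q.semilength) :
    coheight Q i + height Q (Q.semilength - 1 - i) = Q.semilength := by
  have := height_le (P := Q) (i := Q.semilength - 1 - i) (by omega)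
  rw [coheight]
  omega

theorem coheight_mem {i : ℕ} (hi : i ∈ peakUps (flipPath Q)) :
    coheight Q i ∈ peakDowns (flipPath Q) := by
  have hn := lt_of_mem_peakUps hi
  rw [semilength_flipPath] at hn
  have h1 := coheight_le hn
  have h2 := coheight_add hn
  rw [mem_peakUps_flipPath hn] at hi
  rw [mem_peakDowns_flipPath (by omega), mem_peakUps_iff]
  exact ⟨_, hi, by omega⟩

theorem coheight_injOn : Set.InjOn (coheight Q) (peakUps (flipPath Q) : Set ℕ) := by
  intro i hi j hj hij
  have hin := lt_of_mem_peakUps hi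
  have hjn := lt_of_mem_peakUps hj
  rw [semilength_flipPath] at hin hjn
  have h1 := coheight_add hin
  have h2 := coheight_add hjn
  rw [Finset.mem_coe, mem_peakUps_flipPath hin] at hi
  rw [Finset.mem_coe, mem_peakUps_flipPath hjn] at hj
  have := height_injOn hi hj (by omega)
  omega

theorem coheight_eq_of_ret {i : ℕ} (h₁ : Ret (flipPath Q) i) (h₂ : Ret (flipPath Q) (i + 1)) :
    coheight Q i = i := by
  have hn := h₂.le
  rw [semilength_flipPath] at hn
  have h3 := (ret_flipPath (by omega)).1 h₁
  rw [show Q.semilength - i = (Q.semilength - 1 - i) + 1 by omega, ret_succ_iff] at h3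
  have := coheight_add (Q := Q) (i := i) (by omega)
  omega

/-- The half turn `y ↦ n - 1 - y` turns the first free down steps of `Q` into the last free
positions, so that `free_le` for the exchanged pair becomes a count from above. -/
theorem freeDowns_flip {d : ℕ} (hn : P.semilength = n) (hn' : Q.semilength = n) (hd : d ≤ n) :
    freeDowns Q (flipPath P) d = (((Finset.range n).filter fun y =>
      y ∉ peakUps (flipPath Q) ∧ y ∉ peakDowns P).filter (n - d ≤ ·)).card := by
  rw [freeDowns]
  refine Finset.card_nbij' (fun y => n - 1 - y) (fun y => n - 1 - y) ?_ ?_ ?_ ?_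
  · intro y hy
    simp only [Finset.coe_filter, Finset.mem_range, Finset.mem_filter, Set.mem_ofPred_eq] at hy ⊢
    have h1 := hy.2
    rw [mem_peakUps_flipPath (by omega), hn] at h1
    rw [mem_peakUps_flipPath (by omega), hn', show n - 1 - (n - 1 - y) = y by omega]
    exact ⟨⟨by omega, h1.2, h1.1⟩, by omega⟩
  · intro y hy
    simp only [Finset.coe_filter, Finset.mem_range, Finset.mem_filter, Set.mem_ofPred_eq] at hy ⊢
    have h1 := hy.1.2
    rw [mem_peakUps_flipPath (by omega), hn'] at h1
    rw [mem_peakUps_flipPath (by omega), hn, show n - 1 - (n - 1 - y) = y by omega]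
    exact ⟨by omega, h1.2, h1.1⟩
  · intro y hy
    simp only [Finset.coe_filter, Finset.mem_range, Set.mem_ofPred_eq] at hy ⊢
    omega
  · intro y hy
    simp only [Finset.coe_filter, Finset.mem_range, Finset.mem_filter, Set.mem_ofPred_eq] at hy ⊢
    omega

theorem freeUps_flip {u : ℕ} (hn : P.semilength = n) (hn' : Q.semilength = n) (hu : u ≤ n) :
    freeUps Q (flipPath P) u = (((Finset.range n).filter fun x =>
      x ∉ peakDowns (flipPath Q) ∧ x ∉ peakUps P).filter (n - u ≤ ·)).card := by
  rw [freeUps]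
  refine Finset.card_nbij' (fun y => n - 1 - y) (fun y => n - 1 - y) ?_ ?_ ?_ ?_
  · intro y hy
    simp only [Finset.coe_filter, Finset.mem_range, Finset.mem_filter, Set.mem_ofPred_eq] at hy ⊢
    have h1 := hy.2
    rw [mem_peakDowns_flipPath (by omega), hn] at h1
    rw [mem_peakDowns_flipPath (by omega), hn', show n - 1 - (n - 1 - y) = y by omega]
    exact ⟨⟨by omega, h1.2, h1.1⟩, by omega⟩
  · intro y hy
    simp only [Finset.coe_filter, Finset.mem_range, Finset.mem_filter, Set.mem_ofPred_eq] at hy ⊢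
    have h1 := hy.1.2
    rw [mem_peakDowns_flipPath (by omega), hn'] at h1
    rw [mem_peakDowns_flipPath (by omega), hn, show n - 1 - (n - 1 - y) = y by omega]
    exact ⟨by omega, h1.2, h1.1⟩
  · intro y hy
    simp only [Finset.coe_filter, Finset.mem_range, Set.mem_ofPred_eq] at hy ⊢
    omega
  · intro y hy
    simp only [Finset.coe_filter, Finset.mem_range, Finset.mem_filter, Set.mem_ofPred_eq] at hy ⊢
    omega

/-- The entries of the permutation that realizes a compatible pair of paths, the entries outside
the peaks being increasing. -/
theorem exists_entries (hP : P.semilength = n) (hQ : Q.semilength = n)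
    (h : Compat P (flipPath Q)) (h' : Compat Q (flipPath P)) :
    ∃ t : ℕ → ℕ, (∀ i < n, t i < n) ∧ Set.InjOn t (Set.Iio n) ∧
      (∀ i < n, t i < height P i) ∧ (∀ i ∈ peakDowns P, t i + 1 = height P i) ∧
      (∀ i < n, coheight Q i ≤ t i) ∧ (∀ i ∈ peakUps (flipPath Q), t i = coheight Q i) ∧
      ∀ b < n, ∀ c < n, (b ∉ peakUps (flipPath Q) ∧ b ∉ peakDowns P) →
        (c ∉ peakUps (flipPath Q) ∧ c ∉ peakDowns P) → b < c → t b < t c := by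
  set Y := (Finset.range n).filter fun y => y ∉ peakUps (flipPath Q) ∧ y ∉ peakDowns P with hY
  set X := (Finset.range n).filter fun x => x ∉ peakDowns (flipPath Q) ∧ x ∉ peakUps P with hX
  have hcard : Y.card = X.card := by
    have := freeDowns_eq_freeUps h.ret h.ups h.downs
    rwa [freeDowns, freeUps, hP] at this
  obtain ⟨r, hr, hmono, hrank⟩ := exists_increasing_matching hcard
  have hYm : ∀ {y}, y ∈ Y ↔ y < n ∧ y ∉ peakUps (flipPath Q) ∧ y ∉ peakDowns P := by
    intro y
    rw [hY, Finset.mem_filter, Finset.mem_range]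
  have hXm : ∀ {y}, y ∈ X ↔ y < n ∧ y ∉ peakDowns (flipPath Q) ∧ y ∉ peakUps P := by
    intro y
    rw [hX, Finset.mem_filter, Finset.mem_range]
  -- A position in both sets of peaks takes the first branch; `t2` shows that the second would give
  -- the same value.
  let t : ℕ → ℕ := fun i => if i ∈ peakDowns P then height P i - 1 else
    if i ∈ peakUps (flipPath Q) then coheight Q i else r i
  have hh : ∀ i < n, i < height P i := fun i hi => lt_height (by omega)
  have hco : ∀ i < n, coheight Q i ≤ i := fun i hi => coheight_le (by omega)
  have t1 : ∀ i ∈ peakDowns P, t i + 1 = height P i := by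
    intro i hi
    have := hh i (hP ▸ lt_of_mem_peakDowns hi)
    simp only [t, if_pos hi]
    omega
  have t2 : ∀ i ∈ peakUps (flipPath Q), t i = coheight Q i := by
    intro i hi
    by_cases hi' : i ∈ peakDowns P
    · obtain ⟨h1, h2⟩ := h.downs i hi' hi
      rw [coheight_eq_of_ret ((h.ret _).1 h1) ((h.ret _).1 h2)]
      have := t1 i hi'
      have := (ret_succ_iff.1 h2).2
      omega
    · simp only [t, if_neg hi', if_pos hi]
  have t3 : ∀ i ∈ Y, t i = r i := by
    intro i hi
    rw [hYm] at hi
    simp only [t, if_neg hi.2.1, if_neg hi.2.2]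
  have hcases : ∀ i < n, i ∈ peakDowns P ∨ i ∈ peakUps (flipPath Q) ∨ i ∈ Y := by
    intro i hi
    by_cases h1 : i ∈ peakDowns P
    · exact Or.inl h1
    · by_cases h2 : i ∈ peakUps (flipPath Q)
      · exact Or.inr (Or.inl h2)
      · exact Or.inr (Or.inr (hYm.2 ⟨hi, h2, h1⟩))
  have m1 : ∀ i ∈ peakDowns P, t i ∈ peakUps P := fun i hi =>
    mem_peakUps_iff.2 ⟨i, hi, (t1 i hi).symm⟩
  have m2 : ∀ i ∈ peakUps (flipPath Q), t i ∈ peakDowns (flipPath Q) := fun i hi => by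
    rw [t2 i hi]
    exact coheight_mem hi
  have m3 : ∀ i ∈ Y, t i ∈ X := fun i hi => by
    rw [t3 i hi]
    exact hr i hi
  -- A common value lies in both sets of extremal values, so it comes from a component `UD`, in
  -- which position and value agree.
  have hmix : ∀ i ∈ peakDowns P, ∀ j ∈ peakUps (flipPath Q), t i = t j → i = j := by
    intro i hi j hj hij
    obtain ⟨h1, h2⟩ := h.ups (t i) (m1 i hi) (by rw [hij]; exact m2 j hj)
    have h1' := (h.ret _).1 h1
    have h2' := (h.ret _).1 h2
    have e1 : i = t i := height_injOn hi (mem_peakDowns_of_ret h1 h2)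
      (by rw [← t1 i hi, (ret_succ_iff.1 h2).2])
    have e2 : j = t i := coheight_injOn hj (mem_peakUps_of_ret h1' h2')
      (by rw [← t2 j hj, coheight_eq_of_ret h1' h2', hij])
    omega
  have inj : Set.InjOn t (Set.Iio n) := by
    intro i hi j hj hij
    rcases hcases i hi with hi | hi | hi <;> rcases hcases j hj with hj | hj | hj
    · exact height_injOn hi hj (by rw [← t1 i hi, ← t1 j hj, hij])
    · exact hmix i hi j hj hij
    · exact absurd (hij ▸ m1 i hi) (hXm.1 (m3 j hj)).2.2
    · exact (hmix j hj i hi hij.symm).symm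
    · exact coheight_injOn hi hj (by rw [← t2 i hi, ← t2 j hj, hij])
    · exact absurd (hij ▸ m2 i hi) (hXm.1 (m3 j hj)).2.1
    · exact absurd (hij ▸ m1 j hj) (hXm.1 (m3 i hi)).2.2
    · exact absurd (hij ▸ m2 j hj) (hXm.1 (m3 i hi)).2.1
    · rw [t3 i hi, t3 j hj] at hij
      rcases lt_trichotomy i j with hlt | hlt | hlt
      · exact absurd hij (hmono i hi j hj hlt).ne
      · exact hlt
      · exact absurd hij (hmono j hj i hi hlt).ne'
  have bound : ∀ i < n, t i < height P i := by
    intro i hi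
    rcases hcases i hi with h1 | h1 | h1
    · have := t1 i h1
      omega
    · rw [t2 i h1]
      exact (hco i hi).trans_lt (hh i hi)
    -- The free values up to `r i` are as many as the free positions up to `i`. By `free_le` after
    -- the down step `i`, these are at most the free values below `height P i`, which would miss `r
    -- i`.
    · by_contra hc
      obtain ⟨w, hw, e1, e2⟩ := exists_prefix_height (P := P) (i := i) (by omega)
      have hle := h.free_le w hw
      rw [e1, e2, freeDowns, freeUps] at hle
      have e3 : (Finset.range (i + 1)).filter (fun y => y ∉ peakUps (flipPath Q) ∧ y ∉ peakDowns P) =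
          Y.filter (· ≤ i) := by
        ext y
        simp only [Finset.mem_filter, hYm, Finset.mem_range]
        exact ⟨fun ⟨a, b⟩ => ⟨⟨by omega, b⟩, by omega⟩, fun ⟨a, b⟩ => ⟨by omega, a.2⟩⟩
      rw [e3, (hrank i h1).1, ← t3 i h1] at hle
      refine hle.not_gt (Finset.card_lt_card (Finset.ssubset_iff_of_subset ?_ |>.2 ⟨t i, ?_, ?_⟩))
      · intro x hx
        simp only [Finset.mem_filter, hXm, Finset.mem_range] at hx ⊢
        exact ⟨⟨by have := height_le (P := P) (i := i) (by omega); omega, hx.2⟩, by omega⟩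
      · rw [Finset.mem_filter]
        exact ⟨m3 i h1, le_rfl⟩
      · rw [Finset.mem_filter, Finset.mem_range]
        exact fun hx => hc hx.1
  have cobound : ∀ i < n, coheight Q i ≤ t i := by
    intro i hi
    rcases hcases i hi with h1 | h1 | h1
    · have := t1 i h1
      have := hco i hi
      have := hh i hi
      omega
    · rw [t2 i h1]
    -- The same argument from above: the free positions from `i` on are as many as the free values
    -- from `r i` on, and those from `coheight Q i` on would miss `r i`.
    · by_contra hc
      have hadd := coheight_add (Q := Q) (i := i) (by omega)
      obtain ⟨w, hw, e1, e2⟩ := exists_prefix_height (P := Q) (i := Q.semilength - 1 - i) (by omega)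
      have hle := h'.free_le w hw
      rw [freeDowns_flip hP hQ (by omega), freeUps_flip hP hQ (by omega), e1, e2,
        show n - (Q.semilength - 1 - i + 1) = i by omega,
        show n - height Q (Q.semilength - 1 - i) = coheight Q i by omega, ← hY, ← hX,
        (hrank i h1).2, ← t3 i h1] at hle
      refine hle.not_gt (Finset.card_lt_card (Finset.ssubset_iff_of_subset ?_ |>.2 ⟨t i, ?_, ?_⟩))
      · intro x hx
        rw [Finset.mem_filter] at hx ⊢
        exact ⟨hx.1, by omega⟩
      · rw [Finset.mem_filter]
        exact ⟨m3 i h1, le_rfl⟩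
      · rw [Finset.mem_filter]
        exact fun hx => hc hx.2
  refine ⟨t, fun i hi => ?_, inj, bound, t1, cobound, t2, fun b hb c hc hb' hc' hbc => ?_⟩
  · have h1 := bound i hi
    have h2 := height_le (P := P) (i := i) (by omega)
    omega
  · have hb2 := hYm.2 ⟨hb, hb'⟩
    have hc2 := hYm.2 ⟨hc, hc'⟩
    rw [t3 b hb2, t3 c hc2]
    exact hmono b hb2 c hc2 hbc

theorem exists_realizes (hP : P.semilength = n) (hQ : Q.semilength = n)
    (h : Compat P (flipPath Q)) (h' : Compat Q (flipPath P)) :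
    ∃ τ : Equiv.Perm (Fin n), Realizes τ P Q ∧ ∀ b c : Fin n,
      ((b : ℕ) ∉ peakUps (flipPath Q) ∧ (b : ℕ) ∉ peakDowns P) →
      ((c : ℕ) ∉ peakUps (flipPath Q) ∧ (c : ℕ) ∉ peakDowns P) → b < c → τ b < τ c := by
  obtain ⟨t, ht, hinj, h1, h2, h3, h4, h5⟩ := exists_entries hP hQ h h'
  let f : Fin n → Fin n := fun i => ⟨t i, ht i i.2⟩
  have hf : Function.Injective f := fun i j hij =>
    Fin.ext (hinj i.2 j.2 (congrArg Fin.val hij))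
  let τ : Equiv.Perm (Fin n) := Equiv.ofBijective f (Finite.injective_iff_bijective.1 hf)
  have hτ : ∀ i, (τ i : ℕ) = t i := fun i => rfl
  have hrot : ∀ i : Fin n, (rotate τ i : ℕ) + 1 + t (i.rev : ℕ) = n := by
    intro i
    rw [rotate_apply, Fin.val_rev, hτ]
    have := ht _ i.rev.2
    omega
  have hco : ∀ i : Fin n, coheight Q (i.rev : ℕ) + height Q i = n := by
    intro i
    have := coheight_add (Q := Q) (i := (i.rev : ℕ)) (by rw [hQ]; exact i.rev.2)
    rwa [hQ, show n - 1 - (i.rev : ℕ) = i by rw [Fin.val_rev]; omega] at this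
  refine ⟨τ, ⟨⟨hP, fun i => h1 i i.2, fun i hi => h2 i hi⟩, ⟨hQ, fun i => ?_, fun i hi => ?_⟩⟩,
    fun b c hb hc hbc => h5 b b.2 c c.2 hb hc hbc⟩
  · have := hrot i
    have := hco i
    have := h3 _ i.rev.2
    omega
  · have a1 := hrot i
    have a2 := hco i
    have a3 := h4 (i.rev : ℕ) (by
      rw [mem_peakUps_flipPath (by rw [hQ]; exact i.rev.2), hQ,
        show n - 1 - (i.rev : ℕ) = i by rw [Fin.val_rev]; omega]
      exact hi)
    omega

end Construction

end DyckPerm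

/-! ### The main theorem -/

theorem theorem7 (n : ℕ) :
    (∀ P Q : DyckWord, P.semilength = n → Q.semilength = n →
      (DyckPerm.Admissible n P Q ↔
        DyckPerm.PathLE (DyckPerm.modKreweras Q) P ∧ DyckPerm.PathLE (DyckPerm.modKreweras P) Q)) ∧
    Set.BijOn DyckPerm.nu (DyckPerm.avoiding1234 n)
      {p : DyckWord × DyckWord | p.1.semilength = n ∧ p.2.semilength = n ∧
        DyckPerm.PathLE (DyckPerm.modKreweras p.2) p.1 ∧
        DyckPerm.PathLE (DyckPerm.modKreweras p.1) p.2} := by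
  simp only [DyckPerm.pathLE_modKreweras_iff]
  refine ⟨fun P Q hP hQ => ?_, ?_, ?_, ?_⟩
  · rw [DyckPerm.admissible_iff]
    constructor
    · rintro ⟨τ, h⟩
      exact ⟨h.compat, h.symm.compat⟩
    · rintro ⟨h, h'⟩
      obtain ⟨τ, hτ, -⟩ := DyckPerm.exists_realizes hP hQ h h'
      exact ⟨τ, hτ⟩
  · intro α _
    have h := DyckPerm.nu_eq_iff.1 (Prod.mk.eta (p := DyckPerm.nu α)).symm
    exact ⟨h.1.semilength, h.2.semilength, h.compat, h.symm.compat⟩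
  · intro α hα β hβ hαβ
    have h := DyckPerm.nu_eq_iff.1 (Prod.mk.eta (p := DyckPerm.nu α)).symm
    have h' : DyckPerm.Realizes (β.trans Fin.revPerm) (DyckPerm.nu α).1 (DyckPerm.nu α).2 :=
      DyckPerm.nu_eq_iff.1 hαβ.symm
    rw [DyckPerm.mem_avoiding1234_iff h] at hα
    rw [DyckPerm.mem_avoiding1234_iff h'] at hβ
    -- Avoidance makes the free entries of `α` and `β` decrease, hence those of the value-reversed
    -- permutations increase.
    have := DyckPerm.eq_of_realizes h h'
      (fun b c hb hc hbc => Fin.rev_lt_rev.2 (hα b c hb hc hbc))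
      (fun b c hb hc hbc => Fin.rev_lt_rev.2 (hβ b c hb hc hbc))
    ext i
    have := congrArg (fun σ : Equiv.Perm (Fin n) => (σ i).rev) this
    simpa using congrArg Fin.val this
  · rintro ⟨P, Q⟩ ⟨hP, hQ, h, h'⟩
    obtain ⟨τ, hτ, hm⟩ := DyckPerm.exists_realizes hP hQ h h'
    have e : (τ.trans Fin.revPerm).trans Fin.revPerm = τ := by
      ext i
      simp
    refine ⟨τ.trans Fin.revPerm, ?_, DyckPerm.nu_eq_iff.2 (by rwa [e])⟩
    rw [DyckPerm.mem_avoiding1234_iff (P := P) (Q := Q) (by rwa [e])]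
    exact fun b c hb hc hbc => Fin.rev_lt_rev.2 (hm b c hb hc hbc)
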